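/- **Theorem (Fuzzy-Circuit-SAT is complete for Fuzzy-NPA(1)).** *Fuzzy objects.* A fuzzy subset of a set $U$ is a map $U\to[0,1]$. A fuzzy string over a finite alphabet $A$ is a fuzzy subset $s$ of $A^*$ with finite support and with exactly one $x_0\in A^*$ such that $s(x_0)=1$; put $\ell(s)=\max\{|x| : s(x)>0\}$. A fuzzy decision problem $L$ maps each fuzzy string of a given set of instances to a fuzzy subset of $\{0,1\}$. *Machines.* A deterministic fuzzy Turing machine (DFTM) has a rewritable input/work tape, a read-only auxiliary tape, a write-only output tape and a finite transition table $\delta$ with values in $[0,1]$. On a fuzzy string $s$ it starts, for every $x$, with degree $s(x)$ with $x$ on the work tape and $1^{\ell(s)}$ on the auxiliary tape (both between endmarkers). The degree of a configuration at time $i+1$ is the maximum, over its predecessors that are not halted, of $\min$(degree of the predecessor at time $i$, degree of the transition). $M(s)(w)$ is the maximal degree, over all times, of a halted configuration with output $w$. The machine halts in time $t$ if no configuration has positive degree after time $t$. A fuzzy proof verification system (FPVS) with proof set $\Theta$, a set of fuzzy subsets of $\{0,1\}^*$, is such a machine $N$ with an additional read-only proof tape; on $s$ with proof $\phi\in\Theta$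 it starts with degree $J(s(x),\phi(y))$ with $x$ on the work tape and $y$ on the proof tape, and outputs a fuzzy subset $N(s,\phi)$ of $\{0,1\}$. Its outcome is $N(s)(1)=\sup_{\phi\in\Theta}N(s,\phi)(1)$, $N(s)(0)=\inf_{\phi\in\Theta}N(s,\phi)(0)$. Throughout, $\Theta$ and $J$ are fixed, and either $J(a,b)=\min(a,b)$ and $\Theta$ is arbitrary, or $J(a,b)=ab$ and for every $\phi\in\Theta$ there is $y$ with $\phi(y)=1$, and every $y$ with $\phi(y)>0$ is, as a crisp proof, an element of $\Theta$ (for instance, $\Theta$ is the set of all fuzzy strings over $\{0,1\}$, or a set of crisp strings). *Classes and reductions.* Fuzzy-FPA(1) is the set of fuzzy functions $s\mapsto M(s)$ computed by DFTMs $M$ that halt in time polynomial in $\ell(s)$. Fuzzy-NPA(1) (with respect to $\Theta$) is the set of fuzzy decision problems $L$ for which there is an FPVS $N$ with proof set $\Theta$ that halts, for all instances $s$ and all $\phi\in\Theta$, in time polynomial in $\ell(s)$, with $N(s)=L(s)$ for all instances $s$. $F$ is AF(1)-reducible to $G$ if there are $f,g$ in Fuzzy-FPA(1), $f$ mapping instances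 of $F$ to instances of $G$ and $g$ mapping pairs (instance of $F$, possible output of $G$) to possible outputs of $F$, with $g(s,G(f(s)))=F(s)$ for all instances $s$ of $F$. A pair $(s,b)$ is given to a DFTM as the fuzzy string in which $xy$ (in disjoint alphabets) has degree $\min(s(x),b(y))$. *Circuits.* A fuzzy gate with $m$ inputs and $k$ outputs is a map from $\{0,1\}^m$ to fuzzy subsets of $\{0,1\}^k$. A fuzzy circuit $C$ consists of levels of fuzzy gates (at least one per level) that read variables of the level below, with one output variable at the last level; its variables at level $0$ are those for a fuzzy constant $e$ (a fuzzy string over $\{0,1\}$, all of whose support strings have a common length) and those for $m$ cells of the input. A string $y\in\{0,1\}^*$ is presented as the first $m$ cells of a tape that holds $y$, coded by two bits each ($00$ for a blank cell, $1b$ for a cell with bit $b$). On a fuzzy input $\phi$ the configuration at level $0$ gives $(z,u)$ the degree $\sup\{J(e(z),\phi(y)) : y \text{ is presented as } u\}$, and $conf_{t+1}(w)=\max_v\min_k\min(conf_t(v),G_k(v_k)(w_k))$, where $G_k$ are the gates of level $t+1$ and $v_k,w_k$ the values of their input and output variables. $C(\phi)$ is the configuration at the last level. $C$ is described by a fuzzy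 string over a fixed alphabet: for $0<r\le1$ let $C_r$ be the crisp circuit whose gates have exactly the entries of the gates of $C$ of degree $\ge r$; a standard description (input labels in unary, explicit lists of entries) of $C_r$ with constant $z\in\{0,1\}^*$ gets the degree $\min(r,e(z))$ (the largest such value if several $r$ give the same string). *Fuzzy-Circuit-SAT* (with respect to $\Theta$): the instances are the descriptions of fuzzy circuits $C$; the output is $b$ with $b(1)=\sup_{\phi\in\Theta}C(\phi)(1)$ and $b(0)=\inf_{\phi\in\Theta}C(\phi)(0)$. **Claim.** Fuzzy-Circuit-SAT with respect to $\Theta$ is complete for Fuzzy-NPA(1) with respect to $\Theta$: (i) it belongs to Fuzzy-NPA(1), i.e. some FPVS with proof set $\Theta$ solves it in polynomial time; (ii) every fuzzy decision problem in Fuzzy-NPA(1) is AF(1)-reducible to Fuzzy-Circuit-SAT. -/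

import Mathlib

noncomputable section

namespace FuzzyComputation

/-! ### Fuzzy sets and fuzzy strings -/

/-- Membership degrees: the unit interval with its order and its multiplication. -/
abbrev Deg : Type := unitInterval

/-- A fuzzy subset of the universe `X`. -/
abbrev FuzzySet (X : Type) : Type := X → Deg

/-- The support. -/
def supp {X : Type} (s : FuzzySet X) : Set X := {x | s x ≠ 0}

/-- The core. -/
def core {X : Type} (s : FuzzySet X) : Set X := {x | s x = 1}

open Classical in
/-- The fuzzy set that consists of the single crisp element `x`. -/
def crisp {X : Type} (x : X) : FuzzySet X := fun y => if y = x then 1 else 0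

/-- A fuzzy string: a fuzzy set of strings with finite support whose core consists of exactly one
string, its target. -/
def IsFuzzyString {A : Type} (s : FuzzySet (List A)) : Prop :=
  (supp s).Finite ∧ ∃ x₀, core s = {x₀}

/-- The length of a fuzzy string: the maximal length of a string in its support. -/
def len {A : Type} (s : FuzzySet (List A)) : ℕ := sSup (List.length '' supp s)

/-- The two fuzzy strings `s`, `t` written one after the other (in disjoint alphabets), as one
fuzzy string. -/
def pair {A B : Type} (s : FuzzySet (List A)) (t : FuzzySet (List B)) :
    FuzzySet (List (A ⊕ B)) :=
  fun u => ⨆ (x : List A) (y : List B) (_ : u = x.map Sum.inl ++ y.map Sum.inr), s x ⊓ t y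

/-! ### Fuzzy problems and relative approximation -/

/-- A fuzzy function (fuzzy problem) from the set `dom` of fuzzy objects to the set `cod`; values
of `val` outside `dom` are irrelevant. -/
structure FuzzyProblem (A B : Type) where
  dom : Set (FuzzySet (List A))
  cod : Set (FuzzySet (List B))
  val : FuzzySet (List A) → FuzzySet (List B)
  maps_to : ∀ s ∈ dom, val s ∈ cod

/-- The fuzzy subset of `{0,1}` that contains `1` with degree `b₁` and `0` with degree `b₀`. -/
def decision (b₁ b₀ : Deg) : FuzzySet (List Bool) := fun w =>
  if w = [true] then b₁ else if w = [false] then b₀ else 0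

/-- The set of all fuzzy subsets of `{0,1}`, as fuzzy sets of strings of length one. -/
def decisions : Set (FuzzySet (List Bool)) := {t | ∃ b₁ b₀, t = decision b₁ b₀}

/-- Fuzzy decision problems: the instances are fuzzy strings, the outputs are fuzzy subsets of
`{0,1}`. -/
def IsDecisionProblem {A : Type} (L : FuzzyProblem A Bool) : Prop :=
  (∀ s ∈ L.dom, IsFuzzyString s) ∧ L.cod = decisions

/-- `F` is a `γ`-approximation of `G`, for an imprecision tolerance parameter `γ`. -/
def Approximates {B : Type} (γ : ℕ → ℝ) (F G : FuzzySet (List B)) : Prop :=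
  ∀ x, (F x : ℝ) / γ x.length ≤ (G x : ℝ) ∧ (G x : ℝ) ≤ γ x.length * (F x : ℝ)

/-- The set of tolerance parameters that consists of the constant `1`. -/
def tolOne : Set (ℕ → ℝ) := {fun _ => 1}

/-! ### Deterministic fuzzy Turing machines with a proof tape -/

/-- Symbols of the input/work tape: the blank, the two endmarkers, the input symbols and the
additional work symbols of the machine. -/
inductive WorkSym (A W : Type) : Type
  | blank | left | right
  | inp (a : A)
  | wrk (a : W)

/-- Symbols of the read-only auxiliary tape. -/
inductive AuxSym : Type
  | blank | left | right | one

/-- Head movements. -/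
inductive Move : Type
  | stay | fwd | bwd

def Move.shift : Move → ℤ
  | .stay => 0
  | .fwd => 1
  | .bwd => -1

/-- What a machine does in one step: the new state, the symbol written on the work tape, the symbol
(if any) appended to the output tape, and the moves of the three reading heads. -/
structure Action (Q A W B : Type) where
  next : Q
  write : WorkSym A W
  emit : Option B
  workMove : Move
  auxMove : Move
  proofMove : Move

/-- A fuzzy machine with input alphabet `A`, proof alphabet `P` and output alphabet `B`. It has a
rewritable input/work tape, a read-only auxiliary tape, a read-only proof tape (`none` is its blank)
and a write-only output tape. `δ` is only applied in states that are not halting. -/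
structure FuzzyMachine (A P B : Type) where
  Q : Type
  W : Type
  finQ : Finite Q
  finW : Finite W
  start : Q
  halting : Set Q
  δ : Q → WorkSym A W → AuxSym → Option P → FuzzySet (Action Q A W B)

namespace FuzzyMachine

variable {A P B : Type}

/-- Configurations. All tapes are two-way infinite with cells indexed by integers. -/
structure Cfg (M : FuzzyMachine A P B) where
  state : M.Q
  work : ℤ → WorkSym A M.W
  workHead : ℤ
  auxHead : ℤ
  proof : List P
  proofHead : ℤ
  out : List B

/-- The work tape with `x` between endmarkers, the left one in cell `0`. -/
def inputTape {W : Type} (x : List A) : ℤ → WorkSym A W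
  | .ofNat 0 => .left
  | .ofNat (i + 1) =>
    if h : i < x.length then .inp x[i] else if i = x.length then .right else .blank
  | .negSucc _ => .blank

/-- The auxiliary tape with `1ⁿ` between endmarkers, the left one in cell `0`. -/
def auxTape (n : ℕ) : ℤ → AuxSym
  | .ofNat 0 => .left
  | .ofNat (i + 1) => if i < n then .one else if i = n then .right else .blank
  | .negSucc _ => .blank

/-- The proof tape with `y` in the cells `0, …, |y| - 1`. -/
def proofTape (y : List P) : ℤ → Option P
  | .ofNat i => y[i]?
  | .negSucc _ => none

/-- The initial configuration on the crisp input `x` with the crisp proof `y`. -/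
def init (M : FuzzyMachine A P B) (x : List A) (y : List P) : M.Cfg where
  state := M.start
  work := inputTape x
  workHead := 0
  auxHead := 0
  proof := y
  proofHead := 0
  out := []

/-- The configuration after the action `a`. -/
def Cfg.apply {M : FuzzyMachine A P B} (c : M.Cfg) (a : Action M.Q A M.W B) : M.Cfg where
  state := a.next
  work := Function.update c.work c.workHead a.write
  workHead := c.workHead + a.workMove.shift
  auxHead := c.auxHead + a.auxMove.shift
  proof := c.proof
  proofHead := c.proofHead + a.proofMove.shift
  out := c.out ++ a.emit.toList

/-- The possibility degree of the action `a` in the configuration `c`, when the auxiliary tape holds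
`1ⁿ`. -/
def Cfg.degree {M : FuzzyMachine A P B} (n : ℕ) (c : M.Cfg) (a : Action M.Q A M.W B) : Deg :=
  M.δ c.state (c.work c.workHead) (auxTape n c.auxHead) (proofTape c.proof c.proofHead) a

/-- The fuzzy configuration at time `i` on the fuzzy input `s` with the fuzzy proof `φ`, for the
standard safe auxiliary operators `μ₁ = min`, `μ₂ = max`. The operation `J` combines the degree of
the input string with the degree of the proof string at the start. A configuration whose state is
halting has no successor. -/
def conf (M : FuzzyMachine A P B) (J : Deg → Deg → Deg)
    (s : FuzzySet (List A)) (φ : FuzzySet (List P)) : ℕ → FuzzySet M.Cfg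
  | 0 => fun c => ⨆ (x : List A) (y : List P) (_ : c = M.init x y), J (s x) (φ y)
  | i + 1 => fun c' =>
    ⨆ (c : M.Cfg) (a : Action M.Q A M.W B) (_ : c.state ∉ M.halting ∧ c' = c.apply a),
      conf M J s φ i c ⊓ c.degree (len s) a

/-- All computation paths of positive degree have stopped by time `t`. -/
def HaltsIn (M : FuzzyMachine A P B) (J : Deg → Deg → Deg)
    (s : FuzzySet (List A)) (φ : FuzzySet (List P)) (t : ℕ) : Prop :=
  ∀ i, t < i → ∀ c, M.conf J s φ i c = 0

/-- The output `M(s, φ)`: the degree of `w` is the maximal degree, over all times, of a final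
configuration with `w` on the output tape (`μ₃ = ξ = max`). -/
def output (M : FuzzyMachine A P B) (J : Deg → Deg → Deg)
    (s : FuzzySet (List A)) (φ : FuzzySet (List P)) : FuzzySet (List B) := fun w =>
  ⨆ (i : ℕ) (c : M.Cfg) (_ : c.state ∈ M.halting ∧ c.out = w), M.conf J s φ i c

end FuzzyMachine

/-! ### DFTMs and the classes Fuzzy-FPA -/

/-- A deterministic fuzzy Turing machine: a fuzzy machine without proofs (the proof alphabet is
empty, so that the proof tape is always blank). -/
abbrev DFTM (A B : Type) : Type 1 := FuzzyMachine A Empty B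

/-- The DFTM `M` halts on `s` in time `t`. -/
def DFTM.Halts {A B : Type} (M : DFTM A B) (s : FuzzySet (List A)) (t : ℕ) : Prop :=
  M.HaltsIn (· ⊓ ·) s (crisp []) t

/-- The output `M(s)` of a DFTM. -/
def DFTM.result {A B : Type} (M : DFTM A B) (s : FuzzySet (List A)) : FuzzySet (List B) :=
  M.output (· ⊓ ·) s (crisp [])

/-- Fuzzy-FPA: some polynomial-time DFTM `γ`-approximately solves `L`, for some `γ` in `𝓕`. -/
def FuzzyFPA {A B : Type} (𝓕 : Set (ℕ → ℝ)) (L : FuzzyProblem A B) : Prop :=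
  ∃ γ ∈ 𝓕, ∃ (M : DFTM A B) (p : Polynomial ℕ), ∀ s ∈ L.dom,
    M.Halts s (p.eval (len s)) ∧ M.result s ∈ L.cod ∧ Approximates γ (M.result s) (L.val s)

/-! ### Fuzzy proof verification systems and the classes Fuzzy-NPA -/

/-- The machine of a fuzzy proof verification system with binary proofs. -/
abbrev Verifier (A : Type) : Type 1 := FuzzyMachine A Bool Bool

/-- The outcome `N(s)` of the fuzzy proof verification system with machine `N` and set `Θ` of
possible fuzzy proofs. -/
def Verifier.outcome {A : Type} (N : Verifier A) (J : Deg → Deg → Deg)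
    (Θ : Set (FuzzySet (List Bool))) (s : FuzzySet (List A)) : FuzzySet (List Bool) :=
  decision (⨆ φ ∈ Θ, N.output J s φ [true]) (⨅ φ ∈ Θ, N.output J s φ [false])

/-- Fuzzy-NPA with respect to the set `Θ` of fuzzy proofs: `L` is a fuzzy decision problem that is
`γ`-approximately solved, for some `γ` in `𝓕`, by a fuzzy proof verification system with proof
set `Θ`; its running time, for all proofs, is bounded by a polynomial in the length of the
instance. -/
def FuzzyNPA {A : Type} (J : Deg → Deg → Deg) (Θ : Set (FuzzySet (List Bool)))
    (𝓕 : Set (ℕ → ℝ)) (L : FuzzyProblem A Bool) : Prop :=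
  IsDecisionProblem L ∧ ∃ γ ∈ 𝓕, ∃ (N : Verifier A) (p : Polynomial ℕ), ∀ s ∈ L.dom,
    (∀ φ ∈ Θ, N.HaltsIn J s φ (p.eval (len s)) ∧ N.output J s φ ∈ decisions) ∧
    Approximates γ (N.outcome J Θ s) (L.val s)

/-! ### Approximate fuzzy reductions and completeness -/

/-- `F` is AF(`𝓕`)-reducible to `G`: there are `f : F.dom → G.dom` and
`g : F.dom × G.cod → F.cod` in Fuzzy-FPA(`𝓕`) and `γ` in `𝓕` such that `g(s, G(f(s)))` is a
`γ`-approximation of `F(s)`. -/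
def AFReducible {A B C D : Type} (𝓕 : Set (ℕ → ℝ))
    (F : FuzzyProblem A B) (G : FuzzyProblem C D) : Prop :=
  ∃ (f : FuzzyProblem A C) (g : FuzzyProblem (A ⊕ D) B),
    f.dom = F.dom ∧ f.cod = G.dom ∧ FuzzyFPA 𝓕 f ∧
    g.dom = Set.image2 pair F.dom G.cod ∧ g.cod = F.cod ∧ FuzzyFPA 𝓕 g ∧
    ∃ γ ∈ 𝓕, ∀ s ∈ F.dom, Approximates γ (g.val (pair s (G.val (f.val s)))) (F.val s)

/-- `L` is complete for Fuzzy-NPA(`𝓕`) with respect to the set `Θ` of fuzzy proofs. -/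
def IsCompleteNPA {A : Type} (J : Deg → Deg → Deg) (Θ : Set (FuzzySet (List Bool)))
    (𝓕 : Set (ℕ → ℝ)) (L : FuzzyProblem A Bool) : Prop :=
  FuzzyNPA J Θ 𝓕 L ∧
    ∀ (A' : Type) [Finite A'] (L' : FuzzyProblem A' Bool),
      FuzzyNPA J Θ 𝓕 L' → AFReducible 𝓕 L' L

/-! ### Fuzzy circuits -/

/-- A gate over the set `R` of degrees (`R = Deg`: fuzzy gates, `R = Bool`: crisp gates). Its `m`
input variables are given by their labels, it has `k = outs` output variables, and `tab v w` is the
degree of the output `w ∈ {0,1}^k` on the input `v ∈ {0,1}^m` (`tab` is only used for `v` of length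
`m` and `w` of length `k`). -/
structure Gate (R : Type) where
  ins : List ℕ
  outs : ℕ
  tab : List Bool → List Bool → R

/-- A layered circuit. The variables at level `0` are `consts` variables for a fuzzy constant and
two variables for each of `cells` cells of the true input. The variables at level `t + 1` are the
output variables of the gates of that level, labelled `0, 1, 2, …` in the order of the gates; the
gates read variables at level `t`. -/
structure Circuit (R : Type) where
  consts : ℕ
  cells : ℕ
  levels : List (List (Gate R))

/-- The levels have at least one gate each, read only existing variables when there are `c`
variables before the first one, and end with exactly one output variable. -/
def WellFormedLevels {R : Type} : ℕ → List (List (Gate R)) → Prop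
  | c, [] => c = 1
  | c, l :: ls => l ≠ [] ∧ (∀ G ∈ l, ∀ i ∈ G.ins, i < c) ∧
      WellFormedLevels (l.map Gate.outs).sum ls

def Circuit.WellFormed {R : Type} (C : Circuit R) : Prop :=
  WellFormedLevels (C.consts + 2 * C.cells) C.levels

/-- The minimum of the degrees `G_k(v_k)(w_k)` over the gates of a level, where `w` is the
concatenation of the `w_k`. It is `0` if the length of `w` is wrong. -/
def levelDegree : List (Gate Deg) → List Bool → List Bool → Deg
  | [], _, w => if w = [] then 1 else 0
  | G :: gs, v, w =>
    if w.length < G.outs then 0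
    else G.tab (G.ins.map fun i => v.getD i false) (w.take G.outs) ⊓
      levelDegree gs v (w.drop G.outs)

/-- From the global configuration at one level to that at the next one: the maximum over `v` of
`min_k min(conf(v), G_k(v_k)(w_k))`. -/
def nextConf (κ : FuzzySet (List Bool)) (l : List (Gate Deg)) : FuzzySet (List Bool) :=
  fun w => ⨆ v : List Bool, κ v ⊓ levelDegree l v w

/-- How a binary string is presented to a circuit with `m` input cells: the cells of a tape that
holds `y`, each coded by two bits, `00` for a blank cell and `1b` for a cell with the bit `b`. -/
def window (m : ℕ) (y : List Bool) : List Bool :=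
  (List.range m).flatMap fun i =>
    match y[i]? with
    | none => [false, false]
    | some b => [true, b]

/-- The outcome `C(φ)` of the fuzzy circuit `C` with fuzzy constant `e` on the fuzzy input `φ`. -/
def Circuit.outcome (C : Circuit Deg) (J : Deg → Deg → Deg)
    (e φ : FuzzySet (List Bool)) : FuzzySet (List Bool) :=
  C.levels.foldl nextConf fun v =>
    ⨆ (z : List Bool) (y : List Bool) (_ : v = z ++ window C.cells y), J (e z) (φ y)

/-! ### Descriptions of fuzzy circuits -/

/-- The symbols used in descriptions of circuits. -/
inductive Tok : Type
  | bit (b : Bool)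
  | cell | level | gate | tick | sep | port | row

/-- All bit strings of length `n` in lexicographic order. -/
def allBits : ℕ → List (List Bool)
  | 0 => [[]]
  | n + 1 => (allBits n).map (List.cons false) ++ (allBits n).map (List.cons true)

/-- The description of a crisp gate: the labels of its input variables in unary, its number of
outputs in unary, and all pairs `(v, w)` with `tab v w = 1`. -/
def Gate.encode (G : Gate Bool) : List Tok :=
  [.gate] ++ (G.ins.flatMap fun i => List.replicate i .tick ++ [.sep]) ++
    List.replicate G.outs .port ++
    (allBits G.ins.length).flatMap fun v =>
      ((allBits G.outs).filter (G.tab v)).flatMap fun w => .row :: (v ++ w).map .bit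

/-- The description of a crisp circuit with crisp constant `z`. -/
def Circuit.encode (C : Circuit Bool) (z : List Bool) : List Tok :=
  z.map .bit ++ List.replicate C.cells .cell ++
    C.levels.flatMap fun l => .level :: l.flatMap Gate.encode

open Classical in
/-- The `r`-cut of a fuzzy circuit: an entry of a gate is `1` iff its degree is at least `r`. -/
def Circuit.cut (C : Circuit Deg) (r : Deg) : Circuit Bool where
  consts := C.consts
  cells := C.cells
  levels := C.levels.map fun l => l.map fun G =>
    { ins := G.ins, outs := G.outs, tab := fun v w => decide (r ≤ G.tab v w) }

/-- The description of the fuzzy circuit `C` with fuzzy constant `e` as a fuzzy string, by resolving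
the fuzzy gates into their cuts: the string that describes the `r`-cut of `C` with the crisp
constant `z` has degree `min(r, e(z))` (the largest such value, if several `r` give the same
cut). -/
def Circuit.describe (C : Circuit Deg) (e : FuzzySet (List Bool)) : FuzzySet (List Tok) :=
  fun u => ⨆ (r : Deg) (z : List Bool) (_ : u = (C.cut r).encode z), r ⊓ e z

/-- `C` is a fuzzy circuit and `e` is a fuzzy constant for it. -/
def IsFuzzyCircuit (C : Circuit Deg) (e : FuzzySet (List Bool)) : Prop :=
  C.WellFormed ∧ IsFuzzyString e ∧ ∀ z ∈ supp e, z.length = C.consts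

/-- Fuzzy-Circuit-SAT with respect to `Θ`. The instances are the descriptions of fuzzy circuits;
the output has `b(1) = sup_{φ ∈ Θ} C(φ)(1)` and `b(0) = inf_{φ ∈ Θ} C(φ)(0)`. (A description
determines these values, so that the suprema over the circuits with a given description are
taken over one value only.) -/
def fuzzyCircuitSAT (J : Deg → Deg → Deg) (Θ : Set (FuzzySet (List Bool))) :
    FuzzyProblem Tok Bool where
  dom := {c | ∃ C e, IsFuzzyCircuit C e ∧ c = C.describe e}
  cod := decisions
  val c := decision
    (⨆ (C : Circuit Deg) (e : FuzzySet (List Bool)) (_ : IsFuzzyCircuit C e ∧ c = C.describe e),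
      ⨆ φ ∈ Θ, C.outcome J e φ [true])
    (⨆ (C : Circuit Deg) (e : FuzzySet (List Bool)) (_ : IsFuzzyCircuit C e ∧ c = C.describe e),
      ⨅ φ ∈ Θ, C.outcome J e φ [false])
  maps_to _ _ := ⟨_, _, rfl⟩

/-- Every proof in `Θ` has nonempty core, and every string that is possible in some proof in `Θ`
is, as a crisp proof, itself in `Θ`. -/
def CrispGenerated (Θ : Set (FuzzySet (List Bool))) : Prop :=
  ∀ φ ∈ Θ, (core φ).Nonempty ∧ ∀ y ∈ supp φ, crisp y ∈ Θ

end FuzzyComputation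

end

open FuzzyComputation

/-!
Fuzzy-Circuit-SAT is complete for Fuzzy-NPA(1): a fuzzy version of the Cook–Levin theorem.

*Backward evaluation.* Degrees form a complete distributive lattice, so the output of a fuzzy
machine can be computed backwards: `FuzzyMachine.output_eq` expresses it as the supremum over the
crisp inputs `x` and proofs `y` of `J (s x) (φ y) ⊓ M.value _ (M.init x y) w`, where `value` belongs
to a single initial configuration. `Circuit.outcome_eq` does the same for circuits with `circVal`.
What remains to be compared are values for crisp `x` and `y`. For `J = min` this is sufficient
since `⊓` distributes over suprema. For the product, `Admissible.proofValue_congr` shows that the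
supremum and the infimum over `Θ` only depend on the values at crisp proofs: a fuzzy proof is not
better than the best string in its support and not worse than a string in its core.

*Programs.* All machines are obtained from pointer programs (`Prog`): finitely many pointers run in
nested loops through the cells that carry the auxiliary string, and elementary actions are performed
at pointers. A pointer is stored on the work tape by flags in the cells before it, so a pointer
program compiles to a fuzzy machine that needs polynomial time (`Prog.exists_haltsIn`) and whose
output is given by a compositional semantics (`Prog.output_eq`).

*Membership.* The description of a fuzzy circuit is the fuzzy set of the descriptions of its cuts,
and the value of a circuit is the largest `r` such that the cut at `r` can reach the output
(`circVal_eq_iSup`). A crisp program therefore suffices: `evalProg` reads a description from left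
to right, guesses the output values of each gate, and checks that the list of input and output
values of the gate is one of the rows that follow. The values live in memory slots on the tape;
in terms of lists, the program is an automaton (`EvalState.step`), which accepts the description of
a cut iff the cut can reach the output (`accepts_encode_cut`).

*Hardness.* The computation of a verifier `M` is simulated by a layered circuit (`simCircuit`). The
blocks of variables of a level hold the tapes *relative to the heads*: block `0` holds the state,
the symbols at the heads and the action chosen next, and block `j` the symbols at distance `j` on
both sides. Thus all blocks learn the chosen action from block `0`, there is one fuzzy gate in a
level, and all other gates are crisp functions of at most four blocks. Each step takes two levels,
one that chooses an action with its degree and one that performs it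
(`circVal_replicate_mainLevel`). The input and the auxiliary string form the fuzzy constant of the
circuit. With `(n + 2) ^ (k + 1)` blocks and levels, the numbers of blocks are represented by `k + 1`
pointers, and a pointer program guesses a degree `r` and prints the `r`-cut of the circuit
(`describeMachine_result`). The second function of the reduction returns the outcome of the circuit.
-/

open FuzzyComputation

noncomputable section

namespace FuzzyComputation

/-! ### Backward evaluation of fuzzy machines -/

namespace FuzzyMachine

variable {A P B : Type} (M : FuzzyMachine A P B)

/-- One step of a machine, backwards: the best value of `κ` that can be reached from `c` in one
step. -/
def back (n : ℕ) (κ : M.Cfg → Deg) : M.Cfg → Deg := fun c =>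
  ⨆ (a : Action M.Q A M.W B) (_ : c.state ∉ M.halting), c.degree n a ⊓ κ (c.apply a)

open Classical in
/-- The crisp set of the halted configurations with output `w`. -/
def final (w : List B) (c : M.Cfg) : Deg := if c.state ∈ M.halting ∧ c.out = w then 1 else 0

/-- The degree with which `w` is output when the machine is started in the configuration `c`. -/
def value (n : ℕ) (c : M.Cfg) (w : List B) : Deg := ⨆ i : ℕ, (M.back n)^[i] (M.final w) c

/-- The machine stops within `t` steps when it is started in the configuration `c`. -/
def StopsIn (n : ℕ) (c : M.Cfg) (t : ℕ) : Prop :=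
  ∀ i, t < i → ∀ κ, (M.back n)^[i] κ c = 0

variable {M} {n : ℕ}

/-- Forward and backward evaluation agree. -/
theorem iSup_conf_inf (J : Deg → Deg → Deg) (s : FuzzySet (List A)) (φ : FuzzySet (List P))
    (i : ℕ) (κ : M.Cfg → Deg) :
    ⨆ c, M.conf J s φ i c ⊓ κ c =
      ⨆ (x : List A) (y : List P), J (s x) (φ y) ⊓ (M.back (len s))^[i] κ (M.init x y) := by
  induction i generalizing κ with
  | zero =>
    simp only [conf, Function.iterate_zero, id, iSup_inf_eq]
    apply le_antisymm
    · refine iSup_le fun c => iSup_le fun x => iSup_le fun y => iSup_le fun h => ?_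
      subst h
      exact le_iSup₂_of_le x y le_rfl
    · refine iSup₂_le fun x y => ?_
      exact le_iSup_of_le (M.init x y) (le_iSup₂_of_le x y (le_iSup_of_le rfl le_rfl))
  | succ i ih =>
    rw [Function.iterate_succ]
    simp only [Function.comp]
    rw [← ih]
    simp only [conf, back, iSup_inf_eq, inf_iSup_eq]
    apply le_antisymm
    · refine iSup_le fun c' => iSup_le fun c => iSup_le fun a => iSup_le fun h => ?_
      obtain ⟨h, rfl⟩ := h
      exact le_iSup₂_of_le c a (le_iSup_of_le h (by rw [inf_assoc]))
    · refine iSup_le fun c => iSup_le fun a => iSup_le fun h => ?_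
      exact le_iSup_of_le (c.apply a) (le_iSup₂_of_le c a (le_iSup_of_le ⟨h, rfl⟩
        (by rw [inf_assoc])))

theorem output_eq (J : Deg → Deg → Deg) (s : FuzzySet (List A)) (φ : FuzzySet (List P))
    (w : List B) :
    M.output J s φ w =
      ⨆ (x : List A) (y : List P), J (s x) (φ y) ⊓ M.value (len s) (M.init x y) w := by
  have h : M.output J s φ w = ⨆ i : ℕ, ⨆ c, M.conf J s φ i c ⊓ M.final w c := by
    unfold output
    congr 1; ext1 i; congr 1; ext1 c
    by_cases h : c.state ∈ M.halting ∧ c.out = w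
    · rw [iSup_pos h, final, if_pos h]; exact (inf_top_eq _).symm
    · rw [iSup_neg h, final, if_neg h]; exact (inf_bot_eq _).symm
  simp only [h, iSup_conf_inf, value, inf_iSup_eq]
  rw [iSup_comm]; congr 1; ext1 x
  rw [iSup_comm]

theorem haltsIn_of_stopsIn {J : Deg → Deg → Deg} {s : FuzzySet (List A)} {φ : FuzzySet (List P)}
    {t : ℕ} (h : ∀ x y, M.StopsIn (len s) (M.init x y) t) : M.HaltsIn J s φ t := by
  intro i hi c
  have := iSup_conf_inf (M := M) J s φ i (fun _ => 1)
  have h0 : ⨆ c, M.conf J s φ i c ⊓ 1 = (⊥ : Deg) := by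
    rw [this]
    simp only [h _ _ i hi]
    simp only [iSup_eq_bot]
    intro x y; exact inf_bot_eq _
  rw [iSup_eq_bot] at h0
  have := h0 c
  rwa [show (1 : Deg) = ⊤ from rfl, inf_top_eq] at this

/-- A bound on the running time on a fuzzy input holds for all initial configurations that are
possible. -/
theorem HaltsIn.stopsIn {J : Deg → Deg → Deg} {s : FuzzySet (List A)} {φ : FuzzySet (List P)}
    {t : ℕ} (h : M.HaltsIn J s φ t) {x : List A} {y : List P} (hxy : J (s x) (φ y) ≠ 0) :
    M.StopsIn (len s) (M.init x y) t := by
  intro i hi κ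
  have := iSup_conf_inf (M := M) J s φ i κ
  simp only [h i hi] at this
  have h0 : ⨆ c : M.Cfg, (0 : Deg) ⊓ κ c = ⊥ := by
    simp only [iSup_eq_bot]; intro c; exact bot_inf_eq _
  rw [h0, eq_comm] at this
  simp only [iSup_eq_bot] at this
  rcases min_eq_bot.1 (this x y) with h1 | h1
  · exact absurd h1 hxy
  · exact h1

theorem StopsIn.mono {c : M.Cfg} {t t' : ℕ} (h : M.StopsIn n c t) (htt : t ≤ t') :
    M.StopsIn n c t' := fun i hi => h i (htt.trans_lt hi)

theorem back_of_halting (κ : M.Cfg → Deg) {c : M.Cfg} (h : c.state ∈ M.halting) :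
    M.back n κ c = 0 := by
  simp only [back, h, not_true_eq_false, iSup_false, iSup_bot]; rfl

theorem back_of_not_halting (κ : M.Cfg → Deg) {c : M.Cfg} (h : c.state ∉ M.halting) :
    M.back n κ c = ⨆ a, c.degree n a ⊓ κ (c.apply a) := by
  simp only [back, h, not_false_eq_true, iSup_true]

open Classical in
theorem value_of_halting {c : M.Cfg} (h : c.state ∈ M.halting) (w : List B) :
    M.value n c w = if c.out = w then 1 else 0 := by
  apply le_antisymm
  · refine iSup_le fun i => ?_
    cases i with
    | zero => simp [final, h]
    | succ i => rw [Function.iterate_succ_apply', back_of_halting _ h]; exact bot_le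
  · exact le_iSup_of_le 0 (by simp [final, h])

theorem value_of_not_halting {c : M.Cfg} (h : c.state ∉ M.halting) (w : List B) :
    M.value n c w = ⨆ a, c.degree n a ⊓ M.value n (c.apply a) w := by
  simp only [value, inf_iSup_eq]
  rw [iSup_comm]
  apply le_antisymm
  · refine iSup_le fun i => ?_
    cases i with
    | zero => simp only [Function.iterate_zero, id, final, h, false_and, if_false]; exact bot_le
    | succ i =>
      rw [Function.iterate_succ_apply', back_of_not_halting _ h]
      exact le_iSup_of_le i le_rfl
  · refine iSup_le fun i => le_iSup_of_le (i + 1) ?_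
    rw [Function.iterate_succ_apply', back_of_not_halting _ h]

theorem stopsIn_of_halting {c : M.Cfg} (h : c.state ∈ M.halting) (t : ℕ) : M.StopsIn n c t := by
  intro i hi κ
  obtain ⟨i, rfl⟩ : ∃ j, i = j + 1 := ⟨i - 1, by omega⟩
  rw [Function.iterate_succ_apply', back_of_halting _ h]

theorem StopsIn.degree_eq_zero {c : M.Cfg} (h : M.StopsIn n c 0) (hc : c.state ∉ M.halting)
    (a : Action M.Q A M.W B) : c.degree n a = 0 := by
  have := h 1 one_pos (fun _ => 1)
  rw [Function.iterate_one, back_of_not_halting _ hc, ← show (⊥ : Deg) = 0 from rfl,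
    iSup_eq_bot] at this
  have := this a
  rwa [show (1 : Deg) = ⊤ from rfl, inf_top_eq] at this

theorem StopsIn.apply {c : M.Cfg} {t : ℕ} (h : M.StopsIn n c (t + 1)) (hc : c.state ∉ M.halting)
    {a : Action M.Q A M.W B} (ha : c.degree n a ≠ 0) : M.StopsIn n (c.apply a) t := by
  intro i hi κ
  have := h (i + 1) (by omega) κ
  rw [Function.iterate_succ_apply', back_of_not_halting _ hc, ← show (⊥ : Deg) = 0 from rfl,
    iSup_eq_bot] at this
  rcases min_eq_bot.1 (this a) with h1 | h1
  · exact absurd h1 ha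
  · exact h1

/-- From the configuration `c` the machine stops within `t` steps and outputs `V`. -/
structure Yields (n : ℕ) (c : M.Cfg) (t : ℕ) (V : List B → Deg) : Prop where
  stops : M.StopsIn n c t
  value : ∀ w, M.value n c w = V w

theorem Yields.mono {c : M.Cfg} {t t' : ℕ} {V : List B → Deg} (h : M.Yields n c t V)
    (htt : t ≤ t') : M.Yields n c t' V := ⟨h.stops.mono htt, h.value⟩

/-- A step whose possible actions are indexed by a type `ι`. -/
theorem Yields.step {ι : Type} {c : M.Cfg} {t : ℕ} (hc : c.state ∉ M.halting)
    (d : ι → Deg) (act : ι → Action M.Q A M.W B) (V : ι → List B → Deg)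
    (hd : ∀ a, c.degree n a = ⨆ (j : ι) (_ : a = act j), d j)
    (h : ∀ j, M.Yields n (c.apply (act j)) t (V j)) :
    M.Yields n c (t + 1) (fun w => ⨆ j, d j ⊓ V j w) := by
  have key : ∀ κ : M.Cfg → Deg, ⨆ a, c.degree n a ⊓ κ (c.apply a) =
      ⨆ j, d j ⊓ κ (c.apply (act j)) := by
    intro κ
    simp only [hd, iSup_inf_eq]
    rw [iSup_comm]
    congr 1; ext1 j
    apply le_antisymm
    · refine iSup₂_le fun a ha => ?_
      subst ha; exact le_rfl
    · exact le_iSup₂_of_le (act j) rfl le_rfl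
  constructor
  · intro i hi κ
    obtain ⟨i, rfl⟩ : ∃ j, i = j + 1 := ⟨i - 1, by omega⟩
    rw [Function.iterate_succ_apply', back_of_not_halting _ hc, key,
      ← show (⊥ : Deg) = 0 from rfl, iSup_eq_bot]
    intro j
    rw [(h j).stops i (by omega)]
    exact inf_bot_eq _
  · intro w
    rw [value_of_not_halting hc, key (fun c => M.value n c w)]
    simp only [(h _).value]

end FuzzyMachine

/-! ### Pointer programs -/

/-- What a pointer program sees at a pointer: the input symbol, the auxiliary symbol, the current
proof symbol, the annotation of the cell, and the pointers that are further to the right. -/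
structure Info (A P X K : Type) where
  sym : WorkSym A Empty
  aux : AuxSym
  prf : Option P
  ann : X
  gt : K → Bool

/-- The effect of an elementary action: the new register, the new annotation of the cell, the
emitted symbol (if any), and whether the proof head advances. -/
structure Eff (R X B : Type) where
  reg : R
  ann : X
  emit : Option B
  adv : Bool

/-- Pointer programs, with registers in `R`, annotations of the cells in `X` and pointers in `K`.
The pointers range over the cells that carry the auxiliary string and its endmarkers. `act` is a
fuzzy elementary action at a pointer, `look` a branching on what is seen at a pointer, and `loop`
lets a pointer run through all cells from left to right. -/
inductive Prog (A P B R X K : Type) : Type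
  | nop
  | act (a : K) (F : R → Info A P X K → Eff R X B → Deg)
  | seq (p q : Prog A P B R X K)
  | look (a : K) (F : R → Info A P X K → Prog A P B R X K)
  | loop (a : K) (p : Prog A P B R X K)

/-- The states of a pointer program. -/
structure Store (R X B : Type) where
  reg : R
  ann : ℕ → X
  pos : ℕ
  out : List B

variable {A P B R X K : Type}

/-- The state after an elementary action at the cell `i`. -/
def Store.app (st : Store R X B) (i : ℕ) (e : Eff R X B) : Store R X B where
  reg := e.reg
  ann := Function.update st.ann i e.ann
  pos := if e.adv then st.pos + 1 else st.pos
  out := st.out ++ e.emit.toList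

/-- The data that a run of a pointer program depends on: the input, the proof, and the length of
the auxiliary string. -/
structure Ctx (A P : Type) where
  x : List A
  y : List P
  n : ℕ

open FuzzyMachine in
/-- What is seen at the pointer `a`. -/
def Ctx.info (C : Ctx A P) (env : K → ℕ) (st : Store R X B) (a : K) : Info A P X K where
  sym := inputTape C.x (env a)
  aux := auxTape C.n (env a)
  prf := proofTape C.y st.pos
  ann := st.ann (env a)
  gt b := decide (env a < env b)

/-- The weighted semantics of pointer programs, in continuation-passing style: `p.den C env κ st` is
the best value of `κ` that can be reached by running `p` from the state `st` with pointers `env`. -/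
def Prog.den [DecidableEq K] (C : Ctx A P) :
    Prog A P B R X K → (K → ℕ) → (Store R X B → Deg) → Store R X B → Deg
  | .nop, _, κ, st => κ st
  | .act a F, env, κ, st => ⨆ e, F st.reg (C.info env st a) e ⊓ κ (st.app (env a) e)
  | .seq p q, env, κ, st => p.den C env (q.den C env κ) st
  | .look a F, env, κ, st => (F st.reg (C.info env st a)).den C env κ st
  | .loop a p, env, κ, st =>
    (List.range (C.n + 2)).foldr (fun i κ' => p.den C (Function.update env a i) κ') κ st

/-- Only pointers from `U` are moved by loops, and nested loops move different pointers. -/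
def Prog.Scoped : Set K → Prog A P B R X K → Prop
  | _, .nop => True
  | _, .act _ _ => True
  | U, .seq p q => p.Scoped U ∧ q.Scoped U
  | U, .look _ F => ∀ r c, (F r c).Scoped U
  | U, .loop a p => a ∈ U ∧ p.Scoped (U \ {a})

/-! ### Compilation of pointer programs -/

/-- The items of the control stack: programs still to be run, and loops to be continued. -/
inductive Task (A P B R X K : Type) : Type
  | run (p : Prog A P B R X K)
  | next (a : K) (p : Prog A P B R X K)

/-- The control stacks that occur while `p` is run on top of the control stack `k`. -/
def Prog.conts : Prog A P B R X K → List (Task A P B R X K) → Set (List (Task A P B R X K))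
  | .nop, k => {.run .nop :: k}
  | .act a F, k => {.run (.act a F) :: k}
  | .seq p q, k => insert (.run (.seq p q) :: k) (p.conts (.run q :: k) ∪ q.conts k)
  | .look a F, k => insert (.run (.look a F) :: k) (⋃ r, ⋃ c, (F r c).conts k)
  | .loop a p, k => insert (.run (.loop a p) :: k)
      (insert (.next a p :: k) (p.conts (.next a p :: k)))

theorem Prog.mem_conts (p : Prog A P B R X K) (k : List (Task A P B R X K)) :
    .run p :: k ∈ p.conts k := by
  cases p <;> simp [conts]

/-- Whether the machine executes the top of its control stack, or moves its heads back to the first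
cell; in the second case it may delete the flags of one pointer on its way. -/
inductive Mode (K : Type) : Type
  | exec
  | ret (o : Option K)

/-- The work symbols of the compiled machine: each cell holds its input symbol, its annotation, and
one flag for each pointer that is further to the right. -/
abbrev CellSym (A X K : Type) : Type := WorkSym A Empty × X × (K → Bool)

/-- The contents of a cell; cells that have not been visited carry the annotation `x₀` and no flags. -/
def readCell (x₀ : X) : WorkSym A (CellSym A X K) → CellSym A X K
  | .blank => (.blank, x₀, fun _ => false)
  | .left => (.left, x₀, fun _ => false)
  | .right => (.right, x₀, fun _ => false)
  | .inp a => (.inp a, x₀, fun _ => false)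
  | .wrk w => w

/-- The states of the compiled machine: mode, control stack and register. -/
abbrev CState (A P B R X K : Type) : Type := Mode K × List (Task A P B R X K) × R

/-- The actions of the compiled machine. -/
abbrev CAction (A P B R X K : Type) : Type :=
  Action (CState A P B R X K) A (CellSym A X K) B

open Classical in
/-- The transition table of the compiled machine: for each effect, a degree and an action.
Deterministic transitions do not depend on the effect. -/
def compiledStep [DecidableEq K] (q : CState A P B R X K) (c : CellSym A X K) (aux : AuxSym)
    (prf : Option P) (e : Eff R X B) : Deg × CAction A P B R X K :=
  let stay (m : Mode K) (k : List (Task A P B R X K)) (c' : CellSym A X K) :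
    CAction A P B R X K := ⟨(m, k, q.2.2), .wrk c', none, .stay, .stay, .stay⟩
  let forth : CAction A P B R X K := ⟨q, .wrk c, none, .fwd, .fwd, .stay⟩
  match q with
  | (.ret o, k, r) =>
    let c' : CellSym A X K := (c.1, c.2.1, fun b => if o = some b then false else c.2.2 b)
    (1, if aux = .left then ⟨(.exec, k, r), .wrk c', none, .stay, .stay, .stay⟩
      else ⟨(.ret o, k, r), .wrk c', none, .bwd, .bwd, .stay⟩)
  | (.exec, [], _) => (1, stay .exec [] c)
  | (.exec, .run .nop :: k, _) => (1, stay .exec k c)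
  | (.exec, .run (.seq p q) :: k, _) => (1, stay .exec (.run p :: .run q :: k) c)
  | (.exec, .run (.loop a p) :: k, _) => (1, stay .exec (.run p :: .next a p :: k) c)
  | (.exec, .run (.act a F) :: k, r) =>
    if c.2.2 a then (1, forth) else
      (F r ⟨c.1, aux, prf, c.2.1, c.2.2⟩ e, ⟨(.ret none, k, e.reg), .wrk (c.1, e.ann, c.2.2), e.emit,
        .stay, .stay, if e.adv then .fwd else .stay⟩)
  | (.exec, .run (.look a F) :: k, r) =>
    if c.2.2 a then (1, forth) else
      (1, stay (.ret none) (.run (F r ⟨c.1, aux, prf, c.2.1, c.2.2⟩) :: k) c)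
  | (.exec, .next a p :: k, _) =>
    if c.2.2 a then (1, forth) else
      if aux = .right then (1, stay (.ret (some a)) k c) else
        (1, stay (.ret none) (.run p :: .next a p :: k)
          (c.1, c.2.1, fun b => if b = a then true else c.2.2 b))

instance [Finite K] : Finite (Mode K) :=
  Finite.of_injective (β := Option (Option K))
    (fun | .exec => none | .ret o => some o) (by rintro (_ | _) (_ | _) h <;> simp_all)

instance {A W : Type} [Finite A] [Finite W] : Finite (WorkSym A W) :=
  Finite.of_injective (β := Fin 3 ⊕ A ⊕ W)
    (fun | .blank => .inl 0 | .left => .inl 1 | .right => .inl 2 | .inp a => .inr (.inl a)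
         | .wrk a => .inr (.inr a)) (by rintro (_ | _ | _ | _ | _) (_ | _ | _ | _ | _) h <;> simp_all)

instance : Finite AuxSym :=
  Finite.of_injective (β := Fin 4)
    (fun | .blank => 0 | .left => 1 | .right => 2 | .one => 3) (by
      rintro (_ | _ | _ | _) (_ | _ | _ | _) h <;> simp_all)

instance [Finite A] [Finite P] [Finite X] [Finite K] : Finite (Info A P X K) :=
  Finite.of_injective (β := WorkSym A Empty × AuxSym × Option P × X × (K → Bool))
    (fun c => (c.sym, c.aux, c.prf, c.ann, c.gt)) (by
      rintro ⟨⟩ ⟨⟩ h; simp_all)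

/-- Loops return to the control stack below them, so that finitely many stacks suffice. -/
theorem Prog.finite_conts [Finite A] [Finite P] [Finite X] [Finite K] [Finite R]
    (p : Prog A P B R X K) (k : List (Task A P B R X K)) : (p.conts k).Finite := by
  induction p generalizing k with
  | nop => exact Set.finite_singleton _
  | act a F => exact Set.finite_singleton _
  | seq p q hp hq => exact ((hp _).union (hq _)).insert _
  | look a F h => exact (Set.finite_iUnion fun r => Set.finite_iUnion fun c => h r c k).insert _
  | loop a p h => exact ((h _).insert _).insert _

/-- The compiled machine, for a finite set `S` of control stacks. -/
def compiled [DecidableEq K] [Finite A] [Finite X] [Finite K] [Finite R]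
    (S : Set (List (Task A P B R X K))) (hS : S.Finite) (k₀ : S) (x₀ : X) (r₀ : R) : FuzzyMachine A P B where
  Q := Mode K × S × R
  W := CellSym A X K
  finQ := by
    have := hS.to_subtype
    infer_instance
  finW := inferInstance
  start := (.exec, k₀, r₀)
  halting := {q | q.1 = .exec ∧ q.2.1.1 = []}
  δ q c aux prf a := ⨆ (e : Eff R X B)
    (_ : (⟨(a.next.1, a.next.2.1.1, a.next.2.2), a.write, a.emit, a.workMove, a.auxMove, a.proofMove⟩
      : CAction A P B R X K) =
        (compiledStep (q.1, q.2.1.1, q.2.2) (readCell x₀ c) aux prf e).2),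
    (compiledStep (q.1, q.2.1.1, q.2.2) (readCell x₀ c) aux prf e).1

end FuzzyComputation

namespace FuzzyComputation

/-! ### Correctness of the compilation -/

variable {A P B R X K : Type}

section Compiled

variable [DecidableEq K] [Finite A] [Finite X] [Finite K] [Finite R]
  {S : Set (List (Task A P B R X K))} {hS : S.Finite} {k₀ : S} {x₀ : X} {r₀ : R}

open FuzzyMachine in
/-- The configuration `c` of the compiled machine is in mode `m` with control stack `k`, has its
heads at the cell `h`, flags `fl`, and otherwise represents the state `st` of the program. -/
structure Represents (C : Ctx A P) (c : (compiled S hS k₀ x₀ r₀).Cfg) (m : Mode K)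
    (k : List (Task A P B R X K)) (h : ℕ) (fl : ℕ → K → Bool) (st : Store R X B) : Prop where
  mode : c.state.1 = m
  stack : c.state.2.1.1 = k
  reg : c.state.2.2 = st.reg
  workHead : c.workHead = h
  auxHead : c.auxHead = h
  proof : c.proof = C.y
  proofHead : c.proofHead = st.pos
  out : c.out = st.out
  cell : ∀ i : ℕ, i ≤ C.n + 1 → readCell x₀ (c.work i) = (inputTape C.x i, st.ann i, fl i)

omit [DecidableEq K] [Finite A] [Finite X] [Finite K] [Finite R] in
theorem action_lift_eq_iff (a : Action (Mode K × S × R) A (CellSym A X K) B) {m : Mode K}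
    {k : List (Task A P B R X K)} (hk : k ∈ S) {r : R} {w : WorkSym A (CellSym A X K)}
    {em : Option B} {mv₁ mv₂ mv₃ : Move} :
    (⟨(a.next.1, a.next.2.1.1, a.next.2.2), a.write, a.emit, a.workMove, a.auxMove, a.proofMove⟩
      : CAction A P B R X K) = ⟨(m, k, r), w, em, mv₁, mv₂, mv₃⟩ ↔
    a = ⟨(m, ⟨k, hk⟩, r), w, em, mv₁, mv₂, mv₃⟩ := by
  obtain ⟨⟨a1, a2, a3⟩, a4, a5, a6, a7, a8⟩ := a
  simp only [Action.mk.injEq, Prod.mk.injEq, Subtype.ext_iff]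

variable (hS k₀ x₀ r₀) in
/-- All configurations that represent the given data stop within `t` steps and output `V`. -/
def Runs (C : Ctx A P) (m : Mode K) (k : List (Task A P B R X K)) (h : ℕ) (fl : ℕ → K → Bool)
    (st : Store R X B) (t : ℕ) (V : List B → Deg) : Prop :=
  ∀ c : (compiled S hS k₀ x₀ r₀).Cfg, Represents C c m k h fl st →
    (compiled S hS k₀ x₀ r₀).Yields C.n c t V

variable {C : Ctx A P} {m : Mode K} {k : List (Task A P B R X K)} {h : ℕ} {fl : ℕ → K → Bool}
  {st : Store R X B} {t : ℕ}

theorem Runs.mono {t' : ℕ} {V : List B → Deg} (hR : Runs hS k₀ x₀ r₀ C m k h fl st t V)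
    (htt : t ≤ t') : Runs hS k₀ x₀ r₀ C m k h fl st t' V := fun c hc => (hR c hc).mono htt

theorem Runs.congr {fl' : ℕ → K → Bool} {V : List B → Deg}
    (hR : Runs hS k₀ x₀ r₀ C m k h fl' st t V) (hfl : ∀ i ≤ C.n + 1, fl i = fl' i) :
    Runs hS k₀ x₀ r₀ C m k h fl st t V := fun c hc =>
  hR c { hc with cell := fun i hi => by rw [hc.cell i hi, hfl i hi] }

open FuzzyMachine in
/-- One step of the compiled machine. The effect `e` has the degree `d e` and leads to the data with
index `e`. -/
theorem Runs.step (hh : h ≤ C.n + 1) (hne : ¬ (m = .exec ∧ k = []))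
    (d : Eff R X B → Deg) (m' : Eff R X B → Mode K) (k' : Eff R X B → List (Task A P B R X K))
    (r' : Eff R X B → R) (x' : Eff R X B → X) (f' : Eff R X B → K → Bool)
    (em : Eff R X B → Option B) (mv : Eff R X B → Move) (adv : Eff R X B → Bool)
    (heq : ∀ e, compiledStep (m, k, st.reg) (inputTape C.x h, st.ann h, fl h) (auxTape C.n h)
      (proofTape C.y st.pos) e = (d e, ⟨(m' e, k' e, r' e), .wrk (inputTape C.x h, x' e, f' e),
        em e, mv e, mv e, if adv e then .fwd else .stay⟩))
    (hk : ∀ e, k' e ∈ S) (h' : Eff R X B → ℕ) (hh' : ∀ e, (h' e : ℤ) = h + (mv e).shift)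
    (V : Eff R X B → List B → Deg)
    (hR : ∀ e, Runs hS k₀ x₀ r₀ C (m' e) (k' e) (h' e) (Function.update fl h (f' e))
      ⟨r' e, Function.update st.ann h (x' e), if adv e then st.pos + 1 else st.pos,
        st.out ++ (em e).toList⟩ t (V e)) :
    Runs hS k₀ x₀ r₀ C m k h fl st (t + 1) (fun w => ⨆ e, d e ⊓ V e w) := by
  intro c hc
  refine Yields.step (ι := Eff R X B) ?_ d
    (fun e => ⟨(m' e, ⟨k' e, hk e⟩, r' e), .wrk (inputTape C.x h, x' e, f' e),
        em e, mv e, mv e, if adv e then .fwd else .stay⟩) V ?_ ?_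
  · intro hc'
    exact hne ⟨hc.mode.symm.trans hc'.1, hc.stack.symm.trans hc'.2⟩
  · intro a
    show (⨆ (e : Eff R X B) (_ : _ = (compiledStep (c.state.1, c.state.2.1.1, c.state.2.2)
      (readCell x₀ (c.work c.workHead)) (auxTape C.n c.auxHead) (proofTape c.proof c.proofHead)
        e).2), _) = _
    simp only [hc.mode, hc.stack, hc.reg, hc.workHead, hc.auxHead, hc.proof, hc.proofHead,
      hc.cell h hh, heq]
    congr 1; ext1 e
    exact iSup_congr_Prop (action_lift_eq_iff a (hk e)) (fun _ => rfl)
  · intro e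
    apply hR e
    constructor
    · rfl
    · rfl
    · rfl
    · simp [Cfg.apply, hc.workHead, hh']
    · simp [Cfg.apply, hc.auxHead, hh']
    · exact hc.proof
    · simp only [Cfg.apply, hc.proofHead]
      cases adv e <;> simp [Move.shift]
    · simp [Cfg.apply, hc.out]
    · intro i hi
      simp only [Cfg.apply, hc.workHead]
      by_cases hih : i = h
      · subst hih; simp [readCell]
      · have : (i : ℤ) ≠ (h : ℤ) := by exact_mod_cast hih
        simp [Function.update_of_ne, hih, this, hc.cell i hi]

open FuzzyMachine in
/-- One step of the compiled machine that does not depend on an effect. -/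
theorem Runs.det (hh : h ≤ C.n + 1) (hne : ¬ (m = .exec ∧ k = []))
    (m' : Mode K) (k' : List (Task A P B R X K)) (f' : K → Bool) (mv : Move)
    (heq : ∀ e, compiledStep (m, k, st.reg) (inputTape C.x h, st.ann h, fl h) (auxTape C.n h)
      (proofTape C.y st.pos) e = (1, ⟨(m', k', st.reg), .wrk (inputTape C.x h, st.ann h, f'),
        none, mv, mv, .stay⟩))
    (hk : k' ∈ S) (h' : ℕ) (hh' : (h' : ℤ) = h + mv.shift)
    {V : List B → Deg}
    (hR : Runs hS k₀ x₀ r₀ C m' k' h' (Function.update fl h f') st t V) :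
    Runs hS k₀ x₀ r₀ C m k h fl st (t + 1) V := by
  have := Runs.step (hS := hS) (k₀ := k₀) (x₀ := x₀) (r₀ := r₀) (t := t) hh hne (fun _ => 1)
    (fun _ => m') (fun _ => k') (fun _ => st.reg) (fun _ => st.ann h) (fun _ => f')
    (fun _ => none) (fun _ => mv) (fun _ => false) (by intro e; rw [heq e]; rfl) (fun _ => hk)
    (fun _ => h') (fun _ => hh') (fun _ => V) (by
      intro e
      simpa using hR)
  have hne : Nonempty (Eff R X B) := ⟨⟨r₀, x₀, none, false⟩⟩
  simpa [show (1 : Deg) = ⊤ from rfl] using this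

open FuzzyMachine in
theorem auxTape_eq_left {n i : ℕ} : auxTape n i = .left ↔ i = 0 := by
  cases i with
  | zero => simp [auxTape]
  | succ i =>
    show (if i < n then AuxSym.one else if i = n then .right else .blank) = .left ↔ _
    split_ifs <;> simp

open FuzzyMachine in
theorem auxTape_eq_right {n i : ℕ} : auxTape n i = .right ↔ i = n + 1 := by
  cases i with
  | zero => simp [auxTape]
  | succ i =>
    show (if i < n then AuxSym.one else if i = n then .right else .blank) = .right ↔ _
    split_ifs <;> simp <;> omega

/-- The heads move back to the first cell, and the flags of the pointer `o` are deleted. -/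
theorem Runs.ret {o : Option K} {V : List B → Deg} (hk : k ∈ S) (hh : h ≤ C.n + 1)
    (hR : Runs hS k₀ x₀ r₀ C .exec k 0 (fun i b => if i ≤ h ∧ o = some b then false else fl i b)
      st t V) : Runs hS k₀ x₀ r₀ C (.ret o) k h fl st (t + h + 1) V := by
  induction h generalizing fl with
  | zero =>
    refine Runs.det (h := 0) hh (by simp) .exec k (fun b => if o = some b then false else fl 0 b)
      .stay ?_ hk 0 (by simp [Move.shift]) ?_
    · intro e
      simp [compiledStep, FuzzyMachine.auxTape]
    · refine hR.congr fun i hi => ?_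
      funext b
      by_cases hi : i = 0
      · subst hi; simp
      · simp [hi]
  | succ h ih =>
    refine Runs.det hh (by simp) (.ret o) k (fun b => if o = some b then false else fl (h + 1) b)
      .bwd ?_ hk h (by simp [Move.shift]) ?_
    · intro e
      have : ¬ FuzzyMachine.auxTape C.n ((h + 1 : ℕ) : ℤ) = .left := by
        rw [auxTape_eq_left]; omega
      simp only [compiledStep, if_neg this]
    · apply ih (by omega)
      refine hR.congr fun i hi => ?_
      funext b
      by_cases hi : i = h + 1
      · subst hi; simp
      · simp [hi, Nat.le_succ_iff]

/-- The pointer at which an item of the control stack is executed. -/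
inductive Task.At (a : K) : Task A P B R X K → Prop
  | act (F) : Task.At a (.run (.act a F))
  | look (F) : Task.At a (.run (.look a F))
  | next (p) : Task.At a (.next a p)

/-- The heads move forward along the flags of the pointer `a`. -/
theorem Runs.seek {a : K} {T : Task A P B R X K} (hT : T.At a) {V : List B → Deg}
    (hk : T :: k ∈ S) {j : ℕ} (hj : h + j ≤ C.n + 1) (hfl : ∀ i, h ≤ i → i < h + j → fl i a = true)
    (hR : Runs hS k₀ x₀ r₀ C .exec (T :: k) (h + j) fl st t V) :
    Runs hS k₀ x₀ r₀ C .exec (T :: k) h fl st (t + j) V := by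
  induction j generalizing h with
  | zero => exact hR
  | succ j ih =>
    have hfl' := hfl h le_rfl (by omega)
    refine Runs.det (t := t + j) (by omega) (by simp) .exec (T :: k) (fl h) .fwd ?_ hk (h + 1)
      (by simp [Move.shift]) ?_
    · intro e
      cases hT <;> simp [compiledStep, hfl']
    · rw [Function.update_eq_self]
      apply ih (by omega) (fun i h1 h2 => hfl i (by omega) (by omega))
      rwa [show h + 1 + j = h + (j + 1) by omega]

/-- The flags that represent the pointers. -/
def flags (env : K → ℕ) (i : ℕ) (b : K) : Bool := decide (i < env b)

/-- The compiled machine runs `p` within polynomial time and then continues with its control stack.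
The pointers in `U`, which loops in `p` may move, have to be in the first cell at the start; they are
there again at the end. -/
theorem Runs.program (p : Prog A P B R X K) [Finite P] :
    ∃ q : Polynomial ℕ, ∀ (U : Set K) (_ : p.Scoped U) (C : Ctx A P)
      (k : List (Task A P B R X K)) (env : K → ℕ) (st : Store R X B) (t : ℕ)
      (κ : Store R X B → List B → Deg), p.conts k ⊆ S → k ∈ S → (∀ b, env b ≤ C.n + 1) →
      (∀ b ∈ U, env b = 0) →
      (∀ st', Runs hS k₀ x₀ r₀ C .exec k 0 (flags env) st' t (κ st')) →
      Runs hS k₀ x₀ r₀ C .exec (.run p :: k) 0 (flags env) st (t + q.eval C.n)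
        (fun w => p.den C env (fun st' => κ st' w) st) := by
  induction p with
  | nop =>
    refine ⟨1, fun U hU C k env st t κ hp hk henv h0 hR => ?_⟩
    simp only [Polynomial.eval_one]
    refine Runs.det (by omega) (by simp) .exec k (flags env 0) .stay ?_ hk 0
      (by simp [Move.shift]) ?_
    · intro e; simp [compiledStep]
    · rw [Function.update_eq_self]; exact hR st
  | act a F =>
    refine ⟨2 * Polynomial.X + 4, fun U hU C k env st t κ hp hk henv h0 hR => ?_⟩
    have ha := henv a
    have : Runs hS k₀ x₀ r₀ C .exec (.run (.act a F) :: k) (env a) (flags env) st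
        (t + env a + 1 + 1) (fun w => (Prog.act a F).den C env (fun st' => κ st' w) st) := by
      refine Runs.step ha (by simp) (fun e => F st.reg (C.info env st a) e) (fun e => .ret none)
        (fun e => k) (fun e => e.reg) (fun e => e.ann) (fun e => flags env (env a))
        (fun e => e.emit) (fun e => .stay) (fun e => e.adv) ?_ (fun _ => hk) (fun _ => env a)
        (by simp [Move.shift]) (fun e w => κ (st.app (env a) e) w) ?_
      · intro e
        simp [compiledStep, flags, Ctx.info]
        rfl
      · intro e
        rw [Function.update_eq_self]
        refine Runs.ret hk ha ?_
        exact (hR (st.app (env a) e)).congr fun i _ => by funext b; simp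
    have := Runs.seek (h := 0) (j := env a) (C := C) (fl := flags env) (Task.At.act F)
      (hp (Prog.mem_conts _ k)) (by omega) (by simp [flags]) (by simpa using this)
    refine this.mono ?_
    simp; omega
  | seq p q hp hq =>
    obtain ⟨Q₁, h₁⟩ := hp
    obtain ⟨Q₂, h₂⟩ := hq
    refine ⟨Q₁ + Q₂ + 1, fun U hU C k env st t κ hp hk henv h0 hR => ?_⟩
    have hc : p.conts (.run q :: k) ⊆ S := fun l hl => hp (by simp [Prog.conts, hl])
    have hc' : q.conts k ⊆ S := fun l hl => hp (by simp [Prog.conts, hl])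
    have := h₁ U hU.1 C (.run q :: k) env st (t + Q₂.eval C.n)
      (fun st w => q.den C env (fun st' => κ st' w) st) hc (hc' (q.mem_conts k)) henv h0
      (fun st' => h₂ U hU.2 C k env st' t κ hc' hk henv h0 hR)
    refine (Runs.det (V := fun w => (Prog.seq p q).den C env (fun st' => κ st' w) st)
      (Nat.zero_le _) (by simp) .exec (.run p :: .run q :: k) (flags env 0) .stay ?_
      (hc (p.mem_conts _)) 0 (by simp [Move.shift]) (by rw [Function.update_eq_self]; exact this)).mono
      ?_
    · intro e; simp [compiledStep]
    · simp; omega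
  | look a F hF =>
    choose Q hQ using hF
    have : Fintype (R × Info A P X K) := Fintype.ofFinite _
    refine ⟨(∑ rc : R × Info A P X K, Q rc.1 rc.2) + 2 * Polynomial.X + 4,
      fun U hU C k env st t κ hp hk henv h0 hR => ?_⟩
    have ha := henv a
    set c := C.info env st a with hc
    have hc' : (F st.reg c).conts k ⊆ S := fun l hl => hp (by
      simp only [Prog.conts, Set.mem_insert_iff, Set.mem_iUnion]; exact .inr ⟨_, _, hl⟩)
    have h1 := hQ st.reg c U (hU _ _) C k env st t κ hc' hk henv h0 hR
    have h2 : Runs hS k₀ x₀ r₀ C .exec (.run (.look a F) :: k) (env a) (flags env) st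
        (t + (Q st.reg c).eval C.n + env a + 1 + 1)
        (fun w => (Prog.look a F).den C env (fun st' => κ st' w) st) := by
      refine Runs.det ha (by simp) (.ret none) (.run (F st.reg c) :: k)
        (flags env (env a)) .stay ?_ (hc' (Prog.mem_conts _ _)) (env a) (by simp [Move.shift]) ?_
      · intro e
        simp [compiledStep, flags, hc, Ctx.info]
        rfl
      · rw [Function.update_eq_self]
        refine Runs.ret (hc' (Prog.mem_conts _ _)) ha ?_
        exact h1.congr fun i _ => by funext b; simp
    have := Runs.seek (h := 0) (j := env a) (C := C) (fl := flags env) (Task.At.look F)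
      (hp (Prog.mem_conts _ k)) (by omega) (by simp [flags]) (by simpa using h2)
    refine this.mono ?_
    have h3 : (Q st.reg c).eval C.n ≤ ∑ rc : R × Info A P X K, (Q rc.1 rc.2).eval C.n :=
      Finset.single_le_sum (f := fun rc : R × Info A P X K => (Q rc.1 rc.2).eval C.n)
        (fun _ _ => Nat.zero_le _) (Finset.mem_univ (st.reg, c))
    simp [Polynomial.eval_finsetSum]; omega
  | loop a p hp =>
    obtain ⟨Q, hQ⟩ := hp
    refine ⟨(Polynomial.X + 2) * (Q + 2 * Polynomial.X + 4) + 1,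
      fun U hU C k env st t κ hp hk henv h0 hR => ?_⟩
    have hc : p.conts (.next a p :: k) ⊆ S := fun l hl => hp (by simp [Prog.conts, hl])
    have hn : .next a p :: k ∈ S := hp (by simp [Prog.conts])
    have ha0 : env a = 0 := h0 a hU.1
    set N := Q.eval C.n with hN
    have hu : ∀ i, i ≤ C.n + 1 → ∀ b, Function.update env a i b ≤ C.n + 1 := by
      intro i hi b
      by_cases hb : b = a
      · subst hb; simpa using hi
      · simpa [hb] using henv b
    have hu0 : ∀ i, ∀ b ∈ U \ {a}, Function.update env a i b = 0 := by
      intro i b hb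
      rw [Function.update_of_ne hb.2]; exact h0 b hb.1
    -- `d` is the number of the rounds of the loop that are still to be made when the pointer is at `i`
    have key : ∀ d i st, d + i = C.n + 1 →
        Runs hS k₀ x₀ r₀ C .exec (.next a p :: k) 0 (flags (Function.update env a i)) st
          (t + d * (N + 2 * C.n + 4) + 2 * C.n + 4)
          (fun w => (List.range' (i + 1) d).foldr
            (fun i κ' => p.den C (Function.update env a i) κ') (fun st' => κ st' w) st) := by
      intro d
      induction d with
      | zero =>
        intro i st hi
        simp only [zero_add] at hi
        have h1 : Runs hS k₀ x₀ r₀ C .exec (.next a p :: k) i (flags (Function.update env a i)) st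
            (t + i + 1 + 1) (κ st) := by
          refine Runs.det hi.le (by simp) (.ret (some a)) k (flags (Function.update env a i) i)
            .stay ?_ hk i (by simp [Move.shift]) ?_
          · intro e
            simp [compiledStep, auxTape_eq_right.2 hi, flags]
          · rw [Function.update_eq_self]
            refine Runs.ret hk hi.le ((hR st).congr fun j hj => ?_)
            funext b
            by_cases hb : b = a
            · subst hb; simp [hi, hj, flags, ha0]
            · simp [flags, hb, Ne.symm hb]
        refine (Runs.seek (h := 0) (j := i) (Task.At.next p) hn (by omega)
          (by simp [flags]) (by simpa using h1)).mono ?_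
        omega
      | succ d ih =>
        intro i st hi
        have h2 := hQ _ hU.2 C (.next a p :: k) (Function.update env a (i + 1)) st _
          (fun st w => (List.range' (i + 2) d).foldr
            (fun i κ' => p.den C (Function.update env a i) κ') (fun st' => κ st' w) st) hc hn
          (hu _ (by omega)) (hu0 _) (fun st' => ih (i + 1) st' (by omega))
        have h1 : Runs hS k₀ x₀ r₀ C .exec (.next a p :: k) i (flags (Function.update env a i)) st
            (t + d * (N + 2 * C.n + 4) + 2 * C.n + 4 + N + i + 1 + 1)
            (fun w => (List.range' (i + 1) (d + 1)).foldr
            (fun i κ' => p.den C (Function.update env a i) κ') (fun st' => κ st' w) st) := by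
          refine Runs.det (by omega) (by simp) (.ret none) (.run p :: .next a p :: k)
            (fun b => if b = a then true else flags (Function.update env a i) i b)
            .stay ?_ (hc (p.mem_conts _)) i (by simp [Move.shift]) ?_
          · intro e
            have : ¬ FuzzyMachine.auxTape C.n (i : ℤ) = .right := by
              rw [auxTape_eq_right]; omega
            simp [compiledStep, this, flags]
          · refine Runs.ret (hc (p.mem_conts _)) (by omega) (h2.congr fun j hj => ?_)
            funext b
            by_cases hb : b = a
            · subst hb
              by_cases hji : j = i
              · subst hji; simp [flags]
              · simp [flags, hji]; omega
            · by_cases hji : j = i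
              · subst hji; simp [flags, hb]
              · simp [flags, hji, hb]
        refine (Runs.seek (h := 0) (j := i) (Task.At.next p) hn (by omega)
          (by simp [flags]) (by simpa using h1)).mono ?_
        have : (d + 1) * (N + 2 * C.n + 4) = d * (N + 2 * C.n + 4) + (N + 2 * C.n + 4) := by ring
        omega
    have hupd : Function.update env a 0 = env := by rw [← ha0, Function.update_eq_self]
    have h2 := hQ _ hU.2 C (.next a p :: k) (Function.update env a 0) st _ _ hc hn
          (hu _ (by omega)) (hu0 _) (fun st' => key (C.n + 1) 0 st' (by omega))
    rw [hupd] at h2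
    refine (Runs.det (V := fun w => (Prog.loop a p).den C env (fun st' => κ st' w) st)
      (Nat.zero_le _) (by simp) .exec (.run p :: .next a p :: k) (flags env 0) .stay ?_
      (hc (p.mem_conts _)) 0 (by simp [Move.shift]) ?_).mono
      (t := t + (C.n + 1) * (N + 2 * C.n + 4) + 2 * C.n + 4 + N + 1) ?_
    · intro e; simp [compiledStep]
    · rw [Function.update_eq_self]
      have : List.range (C.n + 2) = 0 :: List.range' 1 (C.n + 1) := by
        rw [List.range_eq_range', List.range'_succ]
      simp only [Prog.den, this, List.foldr_cons, hupd]
      exact h2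
    · simp only [Polynomial.eval_add, Polynomial.eval_mul, Polynomial.eval_X, Polynomial.eval_one,
        Polynomial.eval_ofNat, ← hN]
      have : (C.n + 2) * (N + 2 * C.n + 4) = (C.n + 1) * (N + 2 * C.n + 4) + (N + 2 * C.n + 4) := by
        ring
      omega

end Compiled

variable [DecidableEq K] [Finite A] [Finite P] [Finite X] [Finite K] [Finite R]

/-- The machine that runs the program `p`. -/
def Prog.machine (p : Prog A P B R X K) (x₀ : X) (r₀ : R) : FuzzyMachine A P B :=
  compiled (insert [] (p.conts [])) ((p.finite_conts []).insert _)
    ⟨[.run p], .inr (p.mem_conts [])⟩ x₀ r₀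

open Classical in
/-- The degree with which a program outputs `w`. -/
def Prog.result (p : Prog A P B R X K) (x₀ : X) (r₀ : R) (C : Ctx A P) (w : List B) : Deg :=
  p.den C (fun _ => 0) (fun st => if st.out = w then 1 else 0) ⟨r₀, fun _ => x₀, 0, []⟩

omit [DecidableEq K] [Finite A] [Finite P] [Finite X] [Finite K] [Finite R] in
open FuzzyMachine in
theorem readCell_inputTape (x₀ : X) (x : List A) (i : ℕ) :
    readCell (K := K) x₀ (inputTape x i) = (inputTape x i, x₀, fun _ => false) := by
  cases i with
  | zero => rfl
  | succ i =>
    show readCell (K := K) x₀ (if h : i < x.length then .inp x[i] else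
      if i = x.length then .right else .blank) = (if h : i < x.length then .inp x[i] else
      if i = x.length then .right else .blank, x₀, fun _ => false)
    split_ifs <;> rfl

open FuzzyMachine in
/-- The compiled machine computes the semantics of its program within polynomial time. -/
theorem Prog.exists_yields (p : Prog A P B R X K) (hp : p.Scoped Set.univ) (x₀ : X) (r₀ : R) :
    ∃ q : Polynomial ℕ, ∀ (x : List A) (y : List P) (n : ℕ),
      (p.machine x₀ r₀).Yields n ((p.machine x₀ r₀).init x y) (q.eval n)
        (p.result x₀ r₀ ⟨x, y, n⟩) := by
  classical
  obtain ⟨q, hq⟩ := Runs.program (S := insert [] (p.conts []))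
    (hS := (p.finite_conts []).insert _) (k₀ := ⟨[.run p], .inr (p.mem_conts [])⟩)
    (x₀ := x₀) (r₀ := r₀) p
  refine ⟨q, fun x y n => ?_⟩
  have := hq Set.univ hp ⟨x, y, n⟩ [] (fun _ => 0) ⟨r₀, fun _ => x₀, 0, []⟩ 0
    (fun st w => if st.out = w then 1 else 0) (Set.subset_insert _ _) (Set.mem_insert _ _)
    (by simp) (by simp) ?_
  · rw [zero_add] at this
    refine this _ ⟨rfl, rfl, rfl, rfl, rfl, rfl, rfl, rfl, ?_⟩
    intro i hi
    refine (readCell_inputTape x₀ x i).trans ?_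
    simp
    rfl
  · intro st' c hc
    have hh : c.state ∈ (p.machine x₀ r₀).halting := ⟨hc.mode, hc.stack⟩
    exact ⟨stopsIn_of_halting hh _, fun w => by
      rw [← hc.out]; exact value_of_halting hh w⟩

theorem Prog.exists_haltsIn (p : Prog A P B R X K) (hp : p.Scoped Set.univ) (x₀ : X) (r₀ : R) :
    ∃ q : Polynomial ℕ, ∀ (J : Deg → Deg → Deg) (s : FuzzySet (List A)) (φ : FuzzySet (List P)),
      (p.machine x₀ r₀).HaltsIn J s φ (q.eval (len s)) := by
  obtain ⟨q, hq⟩ := p.exists_yields hp x₀ r₀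
  exact ⟨q, fun J s φ => FuzzyMachine.haltsIn_of_stopsIn fun x y => (hq x y _).stops⟩

theorem Prog.output_eq (p : Prog A P B R X K) (hp : p.Scoped Set.univ) (x₀ : X) (r₀ : R)
    (J : Deg → Deg → Deg) (s : FuzzySet (List A)) (φ : FuzzySet (List P)) (w : List B) :
    (p.machine x₀ r₀).output J s φ w =
      ⨆ (x : List A) (y : List P), J (s x) (φ y) ⊓ p.result x₀ r₀ ⟨x, y, len s⟩ w := by
  obtain ⟨q, hq⟩ := p.exists_yields hp x₀ r₀
  rw [FuzzyMachine.output_eq]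
  simp only [(hq _ _ _).value]

end FuzzyComputation

namespace FuzzyComputation

/-! ### Values and cuts of fuzzy circuits -/

/-- The degree with which the levels `ls` turn the configuration `v` into `w`. -/
def circVal : List (List (Gate Deg)) → List Bool → List Bool → Deg
  | [], v, w => if v = w then 1 else 0
  | l :: ls, v, w => ⨆ v', levelDegree l v v' ⊓ circVal ls v' w

/-- The outcome of a circuit, evaluated from the last level to the first one. -/
theorem foldl_nextConf (ls : List (List (Gate Deg))) (κ : FuzzySet (List Bool)) (w : List Bool) :
    ls.foldl nextConf κ w = ⨆ v, κ v ⊓ circVal ls v w := by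
  induction ls generalizing κ with
  | nil =>
    simp only [List.foldl_nil, circVal]
    apply le_antisymm
    · exact le_iSup_of_le w (by rw [if_pos rfl]; exact (inf_top_eq _).ge)
    · refine iSup_le fun v => ?_
      split_ifs with h
      · subst h; exact inf_le_left
      · exact inf_le_right.trans bot_le
  | cons l ls ih =>
    rw [List.foldl_cons, ih]
    simp only [nextConf, circVal, iSup_inf_eq, inf_iSup_eq]
    rw [iSup_comm]
    simp only [inf_assoc]

theorem Circuit.outcome_eq (C : Circuit Deg) (J : Deg → Deg → Deg) (e φ : FuzzySet (List Bool))
    (w : List Bool) :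
    C.outcome J e φ w = ⨆ (z : List Bool) (y : List Bool),
      J (e z) (φ y) ⊓ circVal C.levels (z ++ window C.cells y) w := by
  rw [Circuit.outcome, foldl_nextConf]
  simp only [iSup_inf_eq]
  apply le_antisymm
  · refine iSup_le fun v => iSup_le fun z => iSup_le fun y => iSup_le fun h => ?_
    subst h
    exact le_iSup₂_of_le z y le_rfl
  · refine iSup₂_le fun z y => ?_
    exact le_iSup_of_le _ (le_iSup₂_of_le z y (le_iSup_of_le rfl le_rfl))

/-- The levels `ls` can turn `v` into `w`, when only entries of degree at least `r` are used. -/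
def CutReach (r : Deg) : List (List (Gate Deg)) → List Bool → List Bool → Prop
  | [], v, w => v = w
  | l :: ls, v, w => ∃ v', r ≤ levelDegree l v v' ∧ CutReach r ls v' w

theorem CutReach.mono {r r' : Deg} (h : r' ≤ r) {ls : List (List (Gate Deg))} {v w : List Bool}
    (H : CutReach r ls v w) : CutReach r' ls v w := by
  induction ls generalizing v with
  | nil => exact H
  | cons l ls ih =>
    obtain ⟨v', h1, h2⟩ := H
    exact ⟨v', h.trans h1, ih h2⟩

/-- The value of a circuit is determined by its cuts. -/
theorem circVal_eq_iSup (ls : List (List (Gate Deg))) (v w : List Bool) :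
    circVal ls v w = ⨆ (r : Deg) (_ : CutReach r ls v w), r := by
  apply le_antisymm
  · induction ls generalizing v with
    | nil =>
      unfold circVal
      split_ifs with h
      · exact le_iSup₂_of_le 1 h le_rfl
      · exact bot_le
    | cons l ls ih =>
      refine iSup_le fun v' => (inf_le_inf_left _ (ih v')).trans ?_
      simp only [inf_iSup_eq]
      refine iSup₂_le fun r hr => ?_
      exact le_iSup₂_of_le (levelDegree l v v' ⊓ r) ⟨v', inf_le_left, hr.mono inf_le_right⟩ le_rfl
  · refine iSup₂_le fun r hr => ?_
    induction ls generalizing v with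
    | nil => rw [circVal, if_pos (show v = w from hr)]; exact unitInterval.le_one'
    | cons l ls ih =>
      obtain ⟨v', h1, h2⟩ := hr
      exact le_iSup_of_le v' (le_inf h1 (ih v' h2))

theorem mem_allBits {n : ℕ} {v : List Bool} : v ∈ allBits n ↔ v.length = n := by
  induction n generalizing v with
  | zero => simp [allBits]
  | succ n ih =>
    cases v with
    | nil => simp [allBits]
    | cons b v => cases b <;> simp [allBits, ih]

/-- `D` contains `1` and all degrees of entries of `C`. -/
structure Circuit.DegreesIn (C : Circuit Deg) (D : Set Deg) : Prop where
  one_mem : 1 ∈ D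
  tab_mem : ∀ l ∈ C.levels, ∀ G ∈ l, ∀ v w, v.length = G.ins.length → w.length = G.outs →
    G.tab v w ∈ D

theorem Circuit.exists_finite_degrees (C : Circuit Deg) :
    ∃ D : Set Deg, D.Finite ∧ C.DegreesIn D := by
  refine ⟨insert 1 (⋃ l ∈ {l | l ∈ C.levels}, ⋃ G ∈ {G | G ∈ l},
    ⋃ v ∈ {v | v ∈ allBits G.ins.length},
    ⋃ w ∈ {w | w ∈ allBits G.outs}, {G.tab v w}), ?_, Set.mem_insert _ _, ?_⟩
  · refine Set.Finite.insert _ ((List.finite_toSet _).biUnion fun l _ =>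
      (List.finite_toSet _).biUnion fun G _ => (List.finite_toSet _).biUnion fun v _ =>
      (List.finite_toSet _).biUnion fun w _ => Set.finite_singleton _)
  · intro l hl G hG v w hv hw
    refine Set.mem_insert_of_mem _ ?_
    simp only [Set.mem_iUnion, Set.mem_ofPred_eq, Set.mem_singleton_iff]
    exact ⟨l, hl, G, hG, v, mem_allBits.2 hv, w, mem_allBits.2 hw, rfl⟩

/-- A circuit has only finitely many cuts: up to its description, each cut is one at a degree
from `D`. -/
theorem Circuit.DegreesIn.exists_cut {C : Circuit Deg} {D : Set Deg} (hD : C.DegreesIn D)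
    (hfin : D.Finite) (r : Deg) :
    ∃ r' ∈ D, r ≤ r' ∧ (C.cut r).encode = (C.cut r').encode := by
  classical
  obtain ⟨r', ⟨h1, h2⟩, h3⟩ := Set.exists_min_image {d ∈ D | r ≤ d} id (hfin.sep _)
    ⟨1, hD.one_mem, unitInterval.le_one'⟩
  refine ⟨r', h1, h2, ?_⟩
  have key : ∀ d ∈ D, (r ≤ d ↔ r' ≤ d) := fun d hd => ⟨fun h => h3 d ⟨hd, h⟩, fun h => h2.trans h⟩
  funext z
  simp only [encode, cut, List.flatMap_map]
  congr 1
  refine List.flatMap_congr fun l hl => ?_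
  congr 1
  refine List.flatMap_congr fun G hG => ?_
  simp only [Gate.encode]
  congr 1
  refine List.flatMap_congr fun v hv => ?_
  congr 1
  refine List.filter_congr fun w hw => ?_
  exact decide_eq_decide.2 (key _ (hD.tab_mem l hl G hG v w (mem_allBits.1 hv) (mem_allBits.1 hw)))

theorem Circuit.DegreesIn.describe_eq {C : Circuit Deg} {D : Set Deg} (hD : C.DegreesIn D)
    (hfin : D.Finite) (e : FuzzySet (List Bool)) (u : List Tok) :
    C.describe e u = ⨆ (r : D) (z : List Bool) (_ : u = (C.cut r).encode z), (r : Deg) ⊓ e z := by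
  apply le_antisymm
  · refine iSup_le fun r => iSup_le fun z => iSup_le fun h => ?_
    obtain ⟨r', h1, h2, h3⟩ := hD.exists_cut hfin r
    exact le_iSup₂_of_le ⟨r', h1⟩ z (le_iSup_of_le (by rw [h, h3]) (inf_le_inf_right _ h2))
  · refine iSup_le fun r => iSup_le fun z => iSup_le fun h => ?_
    exact le_iSup₂_of_le (r : Deg) z (le_iSup_of_le h le_rfl)

theorem iSup_eq_one_of_finite {ι : Type} [Finite ι] {f : ι → Deg} (h : ⨆ i, f i = 1) :
    ∃ i, f i = 1 := by
  by_cases hι : Nonempty ι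
  · obtain ⟨i, hi⟩ := exists_eq_ciSup_of_finite (f := f)
    exact ⟨i, hi.trans h⟩
  · rw [not_nonempty_iff] at hι
    rw [iSup_of_empty] at h
    exact absurd h (show (0 : Deg) ≠ 1 from zero_ne_one)

theorem describe_isFuzzyString {C : Circuit Deg} {e : FuzzySet (List Bool)}
    (he : IsFuzzyString e) : IsFuzzyString (C.describe e) := by
  obtain ⟨D, hfin, hD⟩ := C.exists_finite_degrees
  obtain ⟨hs, z₀, hz₀⟩ := he
  have : Finite D := hfin
  have : Finite (supp e) := hs
  have hz : e z₀ = 1 := by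
    have : z₀ ∈ core e := by rw [hz₀]; rfl
    exact this
  have key : ∀ u, C.describe e u =
      ⨆ p : D × supp e, ⨆ (_ : u = (C.cut p.1).encode p.2), (p.1 : Deg) ⊓ e p.2 := by
    intro u
    rw [hD.describe_eq hfin]
    apply le_antisymm
    · refine iSup_le fun r => iSup_le fun z => iSup_le fun h => ?_
      by_cases hz : e z = 0
      · rw [hz]; exact inf_le_right.trans bot_le
      · exact le_iSup₂_of_le (r, ⟨z, hz⟩) h le_rfl
    · refine iSup₂_le fun p h => ?_
      exact le_iSup₂_of_le p.1 p.2.1 (le_iSup_of_le h le_rfl)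
  constructor
  · refine (Set.finite_range (fun p : D × supp e => (C.cut p.1).encode p.2)).subset ?_
    intro u hu
    by_contra hc
    apply hu
    rw [key]
    refine (iSup_eq_bot.2 fun p => ?_)
    rw [iSup_neg]
    exact fun h => hc ⟨p, h.symm⟩
  · refine ⟨(C.cut 1).encode z₀, ?_⟩
    ext u
    simp only [core, Set.mem_ofPred_eq, Set.mem_singleton_iff]
    constructor
    · intro hu
      rw [key] at hu
      obtain ⟨⟨⟨r, hr⟩, ⟨z, hze⟩⟩, hp⟩ := iSup_eq_one_of_finite hu
      by_cases h : u = (C.cut r).encode z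
      swap
      · rw [iSup_neg h] at hp
        exact absurd hp (show (0 : Deg) ≠ 1 from zero_ne_one)
      rw [iSup_pos h] at hp
      have h1 : r = 1 := le_antisymm unitInterval.le_one' (hp ▸ inf_le_left)
      have h2 : e z = 1 := le_antisymm unitInterval.le_one' (hp ▸ inf_le_right)
      have h3 : z ∈ core e := h2
      rw [hz₀] at h3
      rw [h, h1, h3]
    · rintro rfl
      refine le_antisymm unitInterval.le_one' ?_
      exact le_iSup₂_of_le 1 z₀ (le_iSup_of_le rfl (by rw [hz]; exact (inf_idem _).ge))

theorem len_bound {A : Type} {s : FuzzySet (List A)} (hs : (supp s).Finite) {x : List A}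
    (hx : s x ≠ 0) : x.length ≤ len s :=
  le_csSup (hs.image _).bddAbove ⟨x, hx, rfl⟩

/-! ### Programs that only read and emit -/

section Text

variable {A P B R X K : Type} [DecidableEq K] (C : Ctx A P)

/-- When the register holds `r`, the cells have annotations `ann` and the proof head is at `pos`,
`p` emits the word `f env` and changes nothing else. -/
def Prog.Emits (r : R) (ann : ℕ → X) (pos : ℕ) (p : Prog A P B R X K)
    (f : (K → ℕ) → List B) : Prop :=
  ∀ env κ out, p.den C env κ ⟨r, ann, pos, out⟩ = κ ⟨r, ann, pos, out ++ f env⟩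

variable {C} {r : R} {ann : ℕ → X} {pos : ℕ}

theorem Prog.Emits.seq {p q : Prog A P B R X K} {f g : (K → ℕ) → List B}
    (hp : p.Emits C r ann pos f) (hq : q.Emits C r ann pos g) :
    (Prog.seq p q).Emits C r ann pos (fun env => f env ++ g env) := by
  intro env κ out
  rw [Prog.den, hp, hq, List.append_assoc]

theorem Prog.emits_nop : (Prog.nop : Prog A P B R X K).Emits C r ann pos (fun _ => []) := by
  intro env κ out
  rw [Prog.den, List.append_nil]

theorem Prog.emits_look {a : K} {F : R → Info A P X K → Prog A P B R X K}
    {f : Info A P X K → (K → ℕ) → List B} (h : ∀ c, (F r c).Emits C r ann pos (f c)) :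
    (Prog.look a F).Emits C r ann pos
      (fun env => f (C.info env (⟨r, ann, pos, []⟩ : Store R X B) a) env) := by
  intro env κ out
  rw [Prog.den, h]
  rfl

theorem Prog.Emits.loop {a : K} {p : Prog A P B R X K} {f : (K → ℕ) → List B}
    (hp : p.Emits C r ann pos f) :
    (Prog.loop a p).Emits C r ann pos
      (fun env => (List.range (C.n + 2)).flatMap fun i => f (Function.update env a i)) := by
  intro env κ out
  rw [Prog.den]
  generalize List.range (C.n + 2) = l
  induction l generalizing out with
  | nil => simp
  | cons i l ih => rw [List.foldr_cons, hp, ih]; simp only [List.flatMap_cons, List.append_assoc]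

open Classical in
/-- The program that emits one symbol. -/
def Prog.put (a : K) (b : B) : Prog A P B R X K :=
  .act a fun r c e => if e = ⟨r, c.ann, some b, false⟩ then 1 else 0

theorem iSup_ite_inf {ι : Type} [DecidableEq ι] (j : ι) (f : ι → Deg) :
    ⨆ i, (if i = j then 1 else 0) ⊓ f i = f j := by
  apply le_antisymm
  · refine iSup_le fun i => ?_
    split_ifs with h
    · subst h; exact inf_le_right
    · exact inf_le_left.trans bot_le
  · exact le_iSup_of_le j (by rw [if_pos rfl]; exact (top_inf_eq _).ge)

theorem Prog.emits_put (a : K) (b : B) :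
    (Prog.put a b : Prog A P B R X K).Emits C r ann pos (fun _ => [b]) := by
  classical
  intro env κ out
  rw [Prog.put, Prog.den, iSup_ite_inf]
  simp [Store.app, Ctx.info]

/-- The program that emits a word. -/
def Prog.puts (a : K) : List B → Prog A P B R X K
  | [] => .nop
  | b :: w => .seq (.put a b) (puts a w)

theorem Prog.emits_puts (a : K) (w : List B) :
    (Prog.puts a w : Prog A P B R X K).Emits C r ann pos (fun _ => w) := by
  induction w with
  | nil => exact emits_nop
  | cons b w ih => exact (emits_put a b).seq ih

omit [DecidableEq K] in
theorem Prog.scoped_puts (U : Set K) (a : K) (w : List B) :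
    (Prog.puts a w : Prog A P B R X K).Scoped U := by
  induction w with
  | nil => trivial
  | cons b w ih => exact ⟨trivial, ih⟩

theorem Prog.Emits.congr {p : Prog A P B R X K} {f g : (K → ℕ) → List B}
    (hp : p.Emits C r ann pos f) (h : f = g) : p.Emits C r ann pos g := h ▸ hp

end Text

end FuzzyComputation

namespace FuzzyComputation

/-! ### The memory of the circuit evaluator -/

/-- A memory slot of the circuit evaluator. It may hold a value of a variable of the level under
construction (`cur`), a value of a variable of the level below (`prev`), and a value of an input or
output variable of the gate under consideration (`gate`). The marks tell which variables of the
level below, respectively of the gate, have been passed by a cursor. -/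
structure Slot where
  cur : Option Bool
  prev : Option Bool
  gate : Option Bool
  markP : Bool
  markG : Bool

/-- The slot that holds nothing. -/
def Slot.empty : Slot := ⟨none, none, none, false, false⟩

/-- The passes over the memory: advance the cursor of the level below; read at this cursor and
reset both cursors; reset the cursor of the gate; read at the cursor of the gate and advance it;
forget the gate; forget the level below and turn to a new level; read the first variable of the
current level; do nothing. -/
inductive Pass : Type
  | advance | read | reset | compare | clear | shift | first | idle

/-- A pass at one slot; the register `f` holds the value that has been read. -/
def Slot.pass : Pass → Option Bool → Slot → Option Bool × Slot
  | .advance, none, ⟨c, some b, g, false, mg⟩ => (some b, ⟨c, some b, g, true, mg⟩)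
  | .advance, f, s => (f, s)
  | .read, none, ⟨c, some b, g, false, _⟩ => (some b, ⟨c, some b, g, false, false⟩)
  | .read, f, ⟨c, p, g, _, _⟩ => (f, ⟨c, p, g, false, false⟩)
  | .reset, f, ⟨c, p, g, mp, _⟩ => (f, ⟨c, p, g, mp, false⟩)
  | .compare, none, ⟨c, p, some b, mp, false⟩ => (some b, ⟨c, p, some b, mp, true⟩)
  | .compare, f, s => (f, s)
  | .clear, f, ⟨c, p, _, mp, _⟩ => (f, ⟨c, p, none, mp, false⟩)
  | .shift, f, ⟨c, _, _, _, _⟩ => (f, ⟨none, c, none, false, false⟩)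
  | .first, none, s => (s.cur, s)
  | .first, f, s => (f, s)
  | .idle, f, s => (f, s)

/-- A pass over a list of slots. -/
def passList (o : Pass) : Option Bool → List Slot → Option Bool × List Slot
  | f, [] => (f, [])
  | f, s :: l =>
    ((passList o (s.pass o f).1 l).1, (s.pass o f).2 :: (passList o (s.pass o f).1 l).2)

/-- Exactly the first `c` slots that hold a value `key` are marked. -/
def Marked (key : Slot → Option Bool) (mark : Slot → Bool) : ℕ → List Slot → Prop
  | _, [] => True
  | c, s :: l =>
    match key s with
    | some _ => mark s = decide (0 < c) ∧ Marked key mark (c - 1) l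
    | none => mark s = false ∧ Marked key mark c l

/-- The slots `l` hold the given lists, with cursors `cp` and `cg`. -/
structure Holds (l : List Slot) (cur prev gate : List Bool) (cp cg : ℕ) : Prop where
  cur : l.filterMap Slot.cur = cur
  prev : l.filterMap Slot.prev = prev
  gate : l.filterMap Slot.gate = gate
  markP : Marked Slot.prev Slot.markP cp l
  markG : Marked Slot.gate Slot.markG cg l

theorem marked_zero_iff {key : Slot → Option Bool} {mark : Slot → Bool} {l : List Slot} :
    Marked key mark 0 l ↔ ∀ s ∈ l, mark s = false := by
  induction l with
  | nil => simp [Marked]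
  | cons s l ih => cases h : key s <;> simp [Marked, h, ih]

theorem passList_advance_some (b : Bool) (l : List Slot) :
    passList .advance (some b) l = (some b, l) := by
  induction l with
  | nil => rfl
  | cons s l ih => simp [passList, Slot.pass, ih]

theorem passList_compare_some (b : Bool) (l : List Slot) :
    passList .compare (some b) l = (some b, l) := by
  induction l with
  | nil => rfl
  | cons s l ih => simp [passList, Slot.pass, ih]

theorem Holds.cons {s : Slot} {l : List Slot} {cur prev gate : List Bool} {cp cg : ℕ} :
    Holds (s :: l) cur prev gate cp cg ↔
      ∃ cur' prev' gate', cur = s.cur.toList ++ cur' ∧ prev = s.prev.toList ++ prev' ∧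
        gate = s.gate.toList ++ gate' ∧
        (if s.prev.isSome then s.markP = decide (0 < cp) else s.markP = false) ∧
        (if s.gate.isSome then s.markG = decide (0 < cg) else s.markG = false) ∧
        Holds l cur' prev' gate' (if s.prev.isSome then cp - 1 else cp)
          (if s.gate.isSome then cg - 1 else cg) := by
  obtain ⟨c, p, g, mp, mg⟩ := s
  constructor
  · rintro ⟨h1, h2, h3, h4, h5⟩
    refine ⟨l.filterMap Slot.cur, l.filterMap Slot.prev, l.filterMap Slot.gate, ?_, ?_, ?_, ?_, ?_,
      rfl, rfl, rfl, ?_, ?_⟩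
    · cases c <;> simp [← h1]
    · cases p <;> simp [← h2]
    · cases g <;> simp [← h3]
    · cases p <;> simp_all [Marked]
    · cases g <;> simp_all [Marked]
    · cases p <;> simp_all [Marked]
    · cases g <;> simp_all [Marked]
  · rintro ⟨c', p', g', rfl, rfl, rfl, h4, h5, h⟩
    refine ⟨?_, ?_, ?_, ?_, ?_⟩
    · cases c <;> simp [h.cur]
    · cases p <;> simp [h.prev]
    · cases g <;> simp [h.gate]
    · cases p <;> simp_all [Marked]
      · exact h.markP
      · exact h.markP
    · cases g <;> simp_all [Marked]
      · exact h.markG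
      · exact h.markG

theorem Holds.advance {l : List Slot} {cur prev gate : List Bool} {cp cg : ℕ}
    (h : Holds l cur prev gate cp cg) :
    Holds (passList .advance none l).2 cur prev gate (cp + 1) cg := by
  induction l generalizing cur prev gate cp cg with
  | nil => exact ⟨h.1, h.2, h.3, trivial, trivial⟩
  | cons s l ih =>
    obtain ⟨c', p', g', rfl, rfl, rfl, h4, h5, h⟩ := Holds.cons.1 h
    obtain ⟨c, p, g, mp, mg⟩ := s
    rcases p with _ | b
    · exact Holds.cons.2 ⟨c', p', g', rfl, rfl, rfl, h4, h5, ih h⟩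
    · simp only [Option.isSome_some, if_true] at h4
      subst h4
      rcases cp with _ | cp
      · simp only [passList, Slot.pass, lt_self_iff_false, decide_false, passList_advance_some]
        exact Holds.cons.2 ⟨c', p', g', rfl, rfl, rfl, by simp, h5, h⟩
      · simp only [passList, Slot.pass, Nat.zero_lt_succ, decide_true]
        exact Holds.cons.2 ⟨c', p', g', rfl, rfl, rfl, by simp, h5, ih h⟩

theorem passList_read_some (b : Bool) (l : List Slot) :
    (passList .read (some b) l).1 = some b := by
  induction l with
  | nil => rfl
  | cons s l ih => simp [passList, Slot.pass, ih]

/-- After reading, both cursors are back at the start. -/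
theorem Holds.read_snd {l : List Slot} {cur prev gate : List Bool} {cp cg : ℕ} (f : Option Bool)
    (h : Holds l cur prev gate cp cg) :
    Holds (passList .read f l).2 cur prev gate 0 0 := by
  induction l generalizing cur prev gate cp cg f with
  | nil => exact ⟨h.1, h.2, h.3, trivial, trivial⟩
  | cons s l ih =>
    obtain ⟨c', p', g', rfl, rfl, rfl, h4, h5, h⟩ := Holds.cons.1 h
    obtain ⟨c, p, g, mp, mg⟩ := s
    have key : ∃ f', passList .read f (⟨c, p, g, mp, mg⟩ :: l) =
        ((passList .read f' l).1, ⟨c, p, g, false, false⟩ :: (passList .read f' l).2) := by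
      rcases f with _ | f <;> rcases p with _ | b <;> cases mp <;>
        simp only [passList, Slot.pass] <;> exact ⟨_, rfl⟩
    obtain ⟨f', hf'⟩ := key
    rw [hf']
    exact Holds.cons.2 ⟨c', p', g', rfl, rfl, rfl, by simp, by simp, by simpa using ih f' h⟩

/-- The value that is read is the first one that has not been passed by the cursor. -/
theorem Holds.read_fst {l : List Slot} {cur prev gate : List Bool} {cp cg : ℕ}
    (h : Holds l cur prev gate cp cg) : (passList .read none l).1 = prev[cp]? := by
  induction l generalizing cur prev gate cp cg with
  | nil => rw [← h.prev]; simp [passList]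
  | cons s l ih =>
    obtain ⟨c', p', g', rfl, rfl, rfl, h4, h5, h⟩ := Holds.cons.1 h
    obtain ⟨c, p, g, mp, mg⟩ := s
    rcases p with _ | b
    · simpa [passList, Slot.pass] using ih h
    · simp only [Option.isSome_some, if_true] at h4
      subst h4
      rcases cp with _ | cp
      · simp [passList, Slot.pass, passList_read_some]
      · simpa [passList, Slot.pass] using ih h

theorem Holds.compare {l : List Slot} {cur prev gate : List Bool} {cp cg : ℕ}
    (h : Holds l cur prev gate cp cg) :
    (passList .compare none l).1 = gate[cg]? ∧
      Holds (passList .compare none l).2 cur prev gate cp (cg + 1) := by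
  induction l generalizing cur prev gate cp cg with
  | nil => exact ⟨by rw [← h.gate]; simp [passList], h.1, h.2, h.3, trivial, trivial⟩
  | cons s l ih =>
    obtain ⟨c', p', g', rfl, rfl, rfl, h4, h5, h⟩ := Holds.cons.1 h
    obtain ⟨c, p, g, mp, mg⟩ := s
    rcases g with _ | b
    · exact ⟨by simpa [passList, Slot.pass] using (ih h).1,
        Holds.cons.2 ⟨c', p', g', rfl, rfl, rfl, h4, h5, (ih h).2⟩⟩
    · simp only [Option.isSome_some, if_true] at h5
      subst h5
      rcases cg with _ | cg
      · simp only [passList, Slot.pass, lt_self_iff_false, decide_false, passList_compare_some]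
        exact ⟨by simp, Holds.cons.2 ⟨c', p', g', rfl, rfl, rfl, h4, by simp, h⟩⟩
      · simp only [passList, Slot.pass, Nat.zero_lt_succ, decide_true]
        exact ⟨by simpa using (ih h).1,
          Holds.cons.2 ⟨c', p', g', rfl, rfl, rfl, h4, by simp, (ih h).2⟩⟩

theorem Holds.reset {l : List Slot} {cur prev gate : List Bool} {cp cg : ℕ} {f : Option Bool}
    (h : Holds l cur prev gate cp cg) :
    Holds (passList .reset f l).2 cur prev gate cp 0 := by
  induction l generalizing cur prev gate cp cg with
  | nil => exact ⟨h.1, h.2, h.3, trivial, trivial⟩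
  | cons s l ih =>
    obtain ⟨c', p', g', rfl, rfl, rfl, h4, h5, h⟩ := Holds.cons.1 h
    obtain ⟨c, p, g, mp, mg⟩ := s
    exact Holds.cons.2 ⟨c', p', g', rfl, rfl, rfl, h4, by simp [Slot.pass],
      by cases p <;> simpa [Slot.pass] using ih h⟩

theorem Holds.clear {l : List Slot} {cur prev gate : List Bool} {cp cg : ℕ} {f : Option Bool}
    (h : Holds l cur prev gate cp cg) :
    Holds (passList .clear f l).2 cur prev [] cp 0 := by
  induction l generalizing cur prev gate cp cg with
  | nil => exact ⟨h.1, h.2, rfl, trivial, trivial⟩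
  | cons s l ih =>
    obtain ⟨c', p', g', rfl, rfl, rfl, h4, h5, h⟩ := Holds.cons.1 h
    exact Holds.cons.2 ⟨c', p', [], rfl, rfl, rfl, h4, by simp [Slot.pass], ih h⟩

theorem Holds.shift {l : List Slot} {cur prev gate : List Bool} {cp cg : ℕ} {f : Option Bool}
    (h : Holds l cur prev gate cp cg) :
    Holds (passList .shift f l).2 [] cur [] 0 0 := by
  induction l generalizing cur prev gate cp cg with
  | nil => exact ⟨rfl, h.1, rfl, trivial, trivial⟩
  | cons s l ih =>
    obtain ⟨c', p', g', rfl, rfl, rfl, h4, h5, h⟩ := Holds.cons.1 h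
    obtain ⟨c, p, g, mp, mg⟩ := s
    exact Holds.cons.2 ⟨[], c', [], rfl, rfl, rfl, by simp [Slot.pass], by simp [Slot.pass],
      by simpa [Slot.pass] using ih h⟩

theorem passList_first_some (b : Bool) (l : List Slot) :
    (passList .first (some b) l).1 = some b := by
  induction l with
  | nil => rfl
  | cons s l ih => simp [passList, Slot.pass, ih]

theorem passList_first (l : List Slot) :
    (passList .first none l).1 = (l.filterMap Slot.cur).head? := by
  induction l with
  | nil => rfl
  | cons s l ih =>
    obtain ⟨_ | b, p, g, mp, mg⟩ := s
    · simpa [passList, Slot.pass] using ih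
    · simp [passList, Slot.pass, passList_first_some]

theorem passList_idle (f : Option Bool) (l : List Slot) : passList .idle f l = (f, l) := by
  induction l with
  | nil => rfl
  | cons s l ih => simp [passList, Slot.pass, ih]

theorem pass_empty (o : Pass) (f : Option Bool) :
    (Slot.empty.pass o f).1 = f ∧ (Slot.empty.pass o f).2 = Slot.empty := by
  cases o <;> rcases f with _ | f <;> simp [Slot.pass, Slot.empty]

/-- Each cell of the tape provides two slots. -/
def slots (ann : ℕ → Slot × Slot) (l : List ℕ) : List Slot :=
  l.flatMap fun i => [(ann i).1, (ann i).2]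

theorem slots_congr {ann ann' : ℕ → Slot × Slot} {l : List ℕ} (h : ∀ i ∈ l, ann i = ann' i) :
    slots ann l = slots ann' l :=
  List.flatMap_congr fun i hi => by rw [h i hi]

/-- Values are written into the cell `i`, behind all cells in use. -/
theorem Holds.write {ann : ℕ → Slot × Slot} {n i : ℕ} {cur prev gate : List Bool} {cp : ℕ}
    (h : Holds (slots ann (List.range n)) cur prev gate cp 0) (hi : i < n)
    (he : ∀ j, i ≤ j → ann j = (.empty, .empty)) (c₁ c₂ g : Option Bool) :
    Holds (slots (Function.update ann i
      (⟨c₁, none, g, false, false⟩, ⟨c₂, none, none, false, false⟩)) (List.range n)) (cur ++ c₁.toList ++ c₂.toList) prev (gate ++ g.toList) cp 0 := by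
  have hn : List.range n = List.range i ++ i :: List.range' (i + 1) (n - i - 1) := by
    rw [List.range_eq_range', List.range_eq_range', ← List.range'_succ,
      show n - i - 1 + 1 = n - i by omega]
    have := List.range'_append (s := 0) (m := i) (n := n - i) (step := 1)
    simp only [zero_add, one_mul] at this
    rw [this, show i + (n - i) = n by omega]
  have hm : ∀ (key : Slot → Option Bool) (mark : Slot → Bool) (c : ℕ) (l l' : List Slot),
      (∀ s ∈ l', key s = none ∧ mark s = false) → (Marked key mark c (l ++ l') ↔ Marked key mark c l)
      := by
    intro key mark c l l' hl'
    induction l generalizing c with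
    | nil =>
      simp only [List.nil_append, Marked, iff_true]
      induction l' generalizing c with
      | nil => trivial
      | cons s l' ih =>
        obtain ⟨h1, h2⟩ := hl' s (by simp)
        simp only [Marked, h1, h2, true_and]
        exact ih (fun s hs => hl' s (by simp [hs])) c
    | cons s l ih => cases hs : key s <;> simp [Marked, hs, ih]
  set E : List Slot := slots ann (List.range' (i + 1) (n - i - 1)) with hE
  have hE' : ∀ s ∈ E, s = Slot.empty := by
    intro s hs
    simp only [hE, slots, List.mem_flatMap, List.mem_range'_1] at hs
    obtain ⟨j, hj, hs⟩ := hs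
    rw [he j (by omega)] at hs
    simpa using hs
  have hEf : ∀ key : Slot → Option Bool, key .empty = none → E.filterMap key = [] := by
    intro key hk
    rw [List.filterMap_eq_nil_iff]
    intro s hs; rw [hE' s hs, hk]
  set D : List Slot := slots ann (List.range i)
  have h1 : slots ann (List.range n) = D ++ (.empty :: .empty :: E) := by
    rw [hn]; simp [slots, D, hE, he i le_rfl]
  have h2 : slots (Function.update ann i
      (⟨c₁, none, g, false, false⟩, ⟨c₂, none, none, false, false⟩)) (List.range n) = D ++ (⟨c₁, none, g, false, false⟩ :: ⟨c₂, none, none, false, false⟩ :: E) := by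
    have h3 : D = slots (Function.update ann i
        (⟨c₁, none, g, false, false⟩, ⟨c₂, none, none, false, false⟩)) (List.range i) :=
      slots_congr fun j hj => by
        rw [Function.update_of_ne]; rw [List.mem_range] at hj; omega
    have h4 : E = slots (Function.update ann i
        (⟨c₁, none, g, false, false⟩, ⟨c₂, none, none, false, false⟩))
        (List.range' (i + 1) (n - i - 1)) :=
      slots_congr fun j hj => by
        rw [Function.update_of_ne]; rw [List.mem_range'_1] at hj; omega
    rw [hn, h3, h4]; simp [slots]
  rw [h1] at h
  rw [h2]
  obtain ⟨a1, a2, a3, a4, a5⟩ := h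
  simp only [List.filterMap_append, List.filterMap_cons, hEf Slot.cur rfl, hEf Slot.prev rfl,
    hEf Slot.gate rfl] at a1 a2 a3
  refine ⟨?_, ?_, ?_, ?_, ?_⟩
  · simp only [List.filterMap_append, List.filterMap_cons, hEf Slot.cur rfl]
    rw [← a1]
    cases c₁ <;> cases c₂ <;> simp [Slot.empty]
  · simp only [List.filterMap_append, List.filterMap_cons, hEf Slot.prev rfl]
    rw [← a2]; simp [Slot.empty]
  · simp only [List.filterMap_append, List.filterMap_cons, hEf Slot.gate rfl]
    rw [← a3]; cases g <;> simp [Slot.empty]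
  · rw [hm] at a4 ⊢
    · exact a4
    · intro s hs
      simp only [List.mem_cons] at hs
      rcases hs with rfl | rfl | hs
      · simp
      · simp
      · rw [hE' s hs]; simp [Slot.empty]
    · intro s hs
      simp only [List.mem_cons] at hs
      rcases hs with rfl | rfl | hs
      · simp [Slot.empty]
      · simp [Slot.empty]
      · rw [hE' s hs]; simp [Slot.empty]
  · rw [marked_zero_iff] at a5 ⊢
    intro s hs
    simp only [List.mem_append, List.mem_cons] at hs
    rcases hs with hs | rfl | rfl | hs
    · exact a5 s (by simp [hs])
    · rfl
    · rfl
    · rw [hE' s hs]; rfl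

end FuzzyComputation

namespace FuzzyComputation

/-! ### The circuit evaluator -/

instance : Finite Tok :=
  Finite.of_injective (β := Bool ⊕ Fin 7)
    (fun | .bit b => .inl b | .cell => .inr 0 | .level => .inr 1 | .gate => .inr 2
         | .tick => .inr 3 | .sep => .inr 4 | .port => .inr 5 | .row => .inr 6)
    (by rintro (_ | _ | _ | _ | _ | _ | _ | _) (_ | _ | _ | _ | _ | _ | _ | _) h <;> simp_all)

instance : Finite Slot :=
  Finite.of_injective (β := Option Bool × Option Bool × Option Bool × Bool × Bool)
    (fun s => (s.cur, s.prev, s.gate, s.markP, s.markG)) (by rintro ⟨⟩ ⟨⟩ h; simp_all)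

/-- The registers of the circuit evaluator: whether no level has begun, whether a row of the current
gate has been chosen, whether the current row is the chosen one, and the last value read. -/
structure EvalReg where
  lev0 : Bool
  chosen : Bool
  inrow : Bool
  found : Option Bool

instance : Finite EvalReg :=
  Finite.of_injective (β := Bool × Bool × Bool × Option Bool)
    (fun r => (r.lev0, r.chosen, r.inrow, r.found)) (by rintro ⟨⟩ ⟨⟩ h; simp_all)

/-- The pass that is made over the memory when a symbol of the description is treated. -/
def passOf : WorkSym Tok Empty → EvalReg → Pass
  | .inp (.bit _), r => if r.inrow then .compare else .reset
  | .inp .cell, _ => .reset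
  | .inp .level, _ => .shift
  | .inp .gate, _ => .clear
  | .inp .tick, _ => .advance
  | .inp .sep, _ => .read
  | .inp .port, _ => .reset
  | .inp .row, _ => .reset
  | .right, _ => .first
  | _, _ => .idle

/-- What happens at a symbol of the description after the pass over the memory. Output values of
gates and the rows of gates are guessed. -/
def effects (r : EvalReg) (c : Info Tok Bool (Slot × Slot) Bool) :
    List (Eff EvalReg (Slot × Slot) Bool) :=
  let r' : EvalReg := { r with found := none }
  let write (c₁ c₂ g : Option Bool) : Slot × Slot :=
    (⟨c₁, none, g, false, false⟩, ⟨c₂, none, none, false, false⟩)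
  match c.sym with
  | .inp (.bit b) =>
    if r.inrow then if r.found = some b then [⟨r', c.ann, none, false⟩] else []
    else if r.lev0 then [⟨r', write (some b) none none, none, false⟩]
    else [⟨r', c.ann, none, false⟩]
  | .inp .cell =>
    [⟨r', write (some c.prf.isSome) (some (c.prf.getD false)) none, none, true⟩]
  | .inp .level => if r.chosen then [⟨⟨false, true, false, none⟩, c.ann, none, false⟩] else []
  | .inp .gate => if r.chosen then [⟨⟨r.lev0, false, false, none⟩, c.ann, none, false⟩] else []
  | .inp .tick => [⟨r', c.ann, none, false⟩]
  | .inp .sep => [⟨r', write none none (some (r.found.getD false)), none, false⟩]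
  | .inp .port => [false, true].map fun b => ⟨r', write (some b) none (some b), none, false⟩
  | .inp .row => ⟨⟨r.lev0, r.chosen, false, none⟩, c.ann, none, false⟩ ::
      if r.chosen then [] else [⟨⟨r.lev0, true, true, none⟩, c.ann, none, false⟩]
  | .right => if r.chosen then [⟨r', c.ann, some (r.found.getD false), false⟩] else []
  | _ => [⟨r', c.ann, none, false⟩]

/-- Programs for the circuit evaluator. The pointer `false` runs through the description and the
pointer `true` through the memory; the cell of a symbol of the description provides the slots for the
values that this symbol creates. -/
abbrev EvalProg : Type := Prog Tok Bool Bool EvalReg (Slot × Slot) Bool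

abbrev EvalStore : Type := Store EvalReg (Slot × Slot) Bool

open Classical in
/-- A pass over the memory. -/
def sweep (o : Pass) : EvalProg :=
  .loop true (.act true fun r c e =>
    if e = ⟨{ r with found := (c.ann.2.pass o (c.ann.1.pass o r.found).1).1 },
      ((c.ann.1.pass o r.found).2, (c.ann.2.pass o (c.ann.1.pass o r.found).1).2), none, false⟩
    then 1 else 0)

open Classical in
/-- What is done at one symbol of the description. -/
def evalBody : EvalProg :=
  .seq (.look false fun r c => sweep (passOf c.sym r))
    (.act false fun r c e => if e ∈ effects r c then 1 else 0)

/-- The circuit evaluator: one run through the description from left to right. -/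
def evalProg : EvalProg := .loop false evalBody

theorem evalProg_scoped : evalProg.Scoped Set.univ := by
  refine ⟨trivial, fun r c => ⟨⟨trivial, by simp⟩, trivial⟩, trivial⟩

/-- The loop of a pass treats the slots one after the other. -/
theorem exists_sweep (C : Ctx Tok Bool) (o : Pass) (env : Bool → ℕ) (st : EvalStore) :
    ∃ ann' : ℕ → Slot × Slot,
      (∀ κ, (sweep o).den C env κ st =
        κ ⟨{ st.reg with found := (passList o st.reg.found (slots st.ann (List.range (C.n + 2)))).1 },
          ann', st.pos, st.out⟩) ∧
      slots ann' (List.range (C.n + 2)) =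
        (passList o st.reg.found (slots st.ann (List.range (C.n + 2)))).2 ∧
      ∀ j, st.ann j = (.empty, .empty) → ann' j = (.empty, .empty) := by
  classical
  suffices h : ∀ (l : List ℕ) (st : EvalStore), l.Nodup → ∃ ann' : ℕ → Slot × Slot,
      (∀ κ, l.foldr (fun i κ' => (Prog.act true fun r c e =>
    if e = ⟨{ r with found := (c.ann.2.pass o (c.ann.1.pass o r.found).1).1 },
      ((c.ann.1.pass o r.found).2, (c.ann.2.pass o (c.ann.1.pass o r.found).1).2), none, false⟩
    then 1 else 0 : EvalProg).den C (Function.update env true i) κ') κ st =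
        κ ⟨{ st.reg with found := (passList o st.reg.found (slots st.ann l)).1 },
          ann', st.pos, st.out⟩) ∧
      slots ann' l = (passList o st.reg.found (slots st.ann l)).2 ∧
      (∀ j, st.ann j = (.empty, .empty) → ann' j = (.empty, .empty)) ∧
      ∀ j, j ∉ l → ann' j = st.ann j by
    obtain ⟨ann', h1, h2, h3, _⟩ := h (List.range (C.n + 2)) st List.nodup_range
    exact ⟨ann', h1, h2, h3⟩
  intro l
  induction l with
  | nil => intro st _; exact ⟨st.ann, fun κ => rfl, rfl, fun j h => h, fun _ _ => rfl⟩
  | cons i l ih =>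
    intro st hl
    rw [List.nodup_cons] at hl
    set f := st.reg.found
    set p₁ := (st.ann i).1.pass o f with hp₁
    set p₂ := (st.ann i).2.pass o p₁.1 with hp₂
    obtain ⟨ann', h1, h2, h3, h4⟩ := ih ⟨{ st.reg with found := p₂.1 },
      Function.update st.ann i (p₁.2, p₂.2), st.pos, st.out⟩ hl.2
    have hs : slots (Function.update st.ann i (p₁.2, p₂.2)) l = slots st.ann l :=
      slots_congr fun j hj => by
        rw [Function.update_of_ne]; rintro rfl; exact hl.1 hj
    simp only [hs] at h1 h2
    refine ⟨ann', fun κ => ?_, ?_, fun j hj => ?_, fun j hj => ?_⟩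
    · rw [List.foldr_cons, Prog.den, iSup_ite_inf]
      simp only [Store.app, Ctx.info, Function.update_self, Option.toList, List.append_nil,
        Bool.false_eq_true, if_false]
      rw [h1]
      rfl
    · have hi := h4 i hl.1
      simp only [Function.update_self] at hi
      have : slots ann' (i :: l) = p₁.2 :: p₂.2 :: slots ann' l := by
        simp [slots, hi]
      rw [this, h2]
      rfl
    · apply h3
      by_cases hji : j = i
      · subst hji
        have e1 := pass_empty o f
        simp only [hj] at hp₁ hp₂
        simp [hp₁, hp₂, e1]
      · simp only [Function.update_of_ne hji]; exact hj
    · simp only [List.mem_cons, not_or] at hj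
      exact (h4 j hj.2).trans (Function.update_of_ne hj.1 _ _)

/-! ### The evaluator as an automaton with lists -/

/-- The state of the evaluator in terms of lists: the values of the variables of the current level
and of the level below, the values of the variables of the current gate, and two cursors. -/
structure EvalState where
  lev0 : Bool
  chosen : Bool
  inrow : Bool
  cur : List Bool
  prev : List Bool
  gate : List Bool
  cp : ℕ
  cg : ℕ

/-- The possible successors when a symbol is treated; `p` is the current proof symbol. -/
def EvalState.step (a : EvalState) (p : Option Bool) : Tok → List EvalState
  | .bit b =>
    if a.inrow then if a.gate[a.cg]? = some b then [{ a with cg := a.cg + 1 }] else []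
    else if a.lev0 then [{ a with cur := a.cur ++ [b], cg := 0 }] else [{ a with cg := 0 }]
  | .cell => [{ a with cur := a.cur ++ [p.isSome, p.getD false], cg := 0 }]
  | .level =>
    if a.chosen then [⟨false, true, false, [], a.cur, [], 0, 0⟩] else []
  | .gate =>
    if a.chosen then [⟨a.lev0, false, false, a.cur, a.prev, [], a.cp, 0⟩] else []
  | .tick => [{ a with cp := a.cp + 1 }]
  | .sep => [{ a with gate := a.gate ++ [a.prev.getD a.cp false], cp := 0, cg := 0 }]
  | .port =>
    [false, true].map fun b => { a with cur := a.cur ++ [b], gate := a.gate ++ [b], cg := 0 }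
  | .row => { a with inrow := false, cg := 0 } ::
      if a.chosen then [] else [{ a with chosen := true, inrow := true, cg := 0 }]

/-- Whether a symbol of the description consumes a proof symbol. -/
def Tok.adv : Tok → Bool
  | .cell => true
  | _ => false

/-- Some run of the evaluator through `ts` ends with the value `b`. -/
def EvalState.Accepts (y : List Bool) (b : Bool) : List Tok → EvalState → ℕ → Prop
  | [], a, _ => a.chosen = true ∧ a.cur.head?.getD false = b
  | τ :: ts, a, pos =>
    ∃ a' ∈ a.step y[pos]? τ, Accepts y b ts a' (if τ.adv then pos + 1 else pos)

/-- The store `st` represents the evaluator state `a`, and the cells from `i` on are not in use. -/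
structure EvalState.Rep (n i : ℕ) (a : EvalState) (st : EvalStore) : Prop where
  lev0 : st.reg.lev0 = a.lev0
  chosen : st.reg.chosen = a.chosen
  inrow : st.reg.inrow = a.inrow
  found : st.reg.found = none
  holds : Holds (slots st.ann (List.range (n + 2))) a.cur a.prev a.gate a.cp a.cg
  empty : ∀ j, i ≤ j → st.ann j = (.empty, .empty)

theorem iSup_mem_effects (l : List (Eff EvalReg (Slot × Slot) Bool)) [DecidablePred (· ∈ l)]
    (f : Eff EvalReg (Slot × Slot) Bool → Deg) :
    ⨆ e, (if e ∈ l then 1 else 0) ⊓ f e = ⨆ e ∈ l, f e := by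
  congr 1; ext1 e
  by_cases h : e ∈ l
  · rw [if_pos h, iSup_pos h]; exact top_inf_eq _
  · rw [if_neg h, iSup_neg h]; exact bot_inf_eq _

theorem iSup_mem_eq_of_forall₂ {α β : Type} {l : List α} {l' : List β} {f : α → Deg} {g : β → Deg}
    (h : List.Forall₂ (fun a b => f a = g b) l l') : ⨆ a ∈ l, f a = ⨆ b ∈ l', g b := by
  induction h with
  | nil => simp
  | cons h1 _ ih => simp [iSup_or, iSup_sup_eq, h1, ih]

/-- One symbol of the description, in terms of evaluator states. -/
theorem exists_evalBody (C : Ctx Tok Bool) {a : EvalState} {st : EvalStore} {i : ℕ}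
    (h : a.Rep C.n i st) (hi : i < C.n + 2) (env : Bool → ℕ) (henv : env false = i)
    {τ : Tok} (hτ : FuzzyMachine.inputTape (W := Empty) C.x i = .inp τ) :
    ∃ L : List EvalStore, (∀ κ, evalBody.den C env κ st = ⨆ st' ∈ L, κ st') ∧
      List.Forall₂ (fun st' a' => a'.Rep C.n (i + 1) st' ∧
        st'.pos = (if τ.adv then st.pos + 1 else st.pos) ∧ st'.out = st.out) L
        (a.step C.y[st.pos]? τ) := by
  classical
  obtain ⟨ann', h1, h2, h3⟩ := exists_sweep C (passOf (.inp τ) st.reg) env st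
  obtain ⟨⟨r1, r2, r3, r4⟩, ann, pos, out⟩ := st
  obtain ⟨e1, e2, e3, e4, hh, he⟩ := h
  simp only at e1 e2 e3 e4 hh he h1 h2 h3
  subst e1 e2 e3 e4
  set s := passList (passOf (.inp τ) ⟨a.lev0, a.chosen, a.inrow, none⟩) none
    (slots ann (List.range (C.n + 2))) with hs
  have he' : ∀ j, i ≤ j → ann' j = (.empty, .empty) := fun j hj => h3 j (he j hj)
  have hpf : FuzzyMachine.proofTape C.y (pos : ℤ) = C.y[pos]? := rfl
  have key : ∀ κ, evalBody.den C env κ ⟨⟨a.lev0, a.chosen, a.inrow, none⟩, ann, pos, out⟩ =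
      ⨆ e ∈ effects ⟨a.lev0, a.chosen, a.inrow, s.1⟩
        ⟨.inp τ, FuzzyMachine.auxTape C.n i, C.y[pos]?, (.empty, .empty), fun b => decide (i < env b)⟩,
        κ (Store.app ⟨⟨a.lev0, a.chosen, a.inrow, s.1⟩, ann', pos, out⟩ i e) := by
    intro κ
    rw [evalBody, Prog.den, Prog.den]
    simp only [Ctx.info, henv, hτ]
    rw [h1, Prog.den, iSup_mem_effects]
    simp only [Ctx.info, henv, hτ, hpf, he' i le_rfl]
  -- the store after an effect that leaves the cell empty
  have hupd : Function.update ann' i (Slot.empty, Slot.empty) = ann' := by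
    rw [← he' i le_rfl, Function.update_eq_self]
  have hu : ∀ (v : Slot × Slot) (j : ℕ), i + 1 ≤ j →
      Function.update ann' i v j = (.empty, .empty) := fun v j hj => by
    rw [Function.update_of_ne (by omega)]; exact he' j (by omega)
  have he'' : ∀ j, i + 1 ≤ j → ann' j = (.empty, .empty) := fun j hj => he' j (by omega)
  refine ⟨(effects ⟨a.lev0, a.chosen, a.inrow, s.1⟩
        ⟨.inp τ, FuzzyMachine.auxTape C.n i, C.y[pos]?, (.empty, .empty),
          fun b => decide (i < env b)⟩).map
        (Store.app ⟨⟨a.lev0, a.chosen, a.inrow, s.1⟩, ann', pos, out⟩ i), fun κ => ?_, ?_⟩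
  · rw [key]
    apply iSup_mem_eq_of_forall₂
    rw [List.forall₂_map_right_iff]
    exact List.forall₂_same.2 fun _ _ => rfl
  obtain ⟨l0, ch, ir, cur, prev, gt, cp, cg⟩ := a
  cases τ with
  | bit b =>
    cases ir with
    | true =>
      simp only [passOf, if_true] at hs
      have hc := hh.compare
      rw [← hs, ← h2] at hc
      simp only [effects, if_true, EvalState.step, hc.1]
      by_cases hb : gt[cg]? = some b <;> simp only [hb, if_true, if_false]
      · refine .cons ⟨⟨rfl, rfl, rfl, rfl, ?_, ?_⟩, rfl, ?_⟩ .nil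
        · simpa [Store.app, hupd] using hc.2
        · simpa [Store.app, hupd] using he''
        · simp [Store.app]
      · exact .nil
    | false =>
      simp only [passOf, Bool.false_eq_true, if_false] at hs
      have hc := hh.reset (f := none)
      rw [← hs, ← h2] at hc
      simp only [effects, EvalState.step, Bool.false_eq_true, if_false]
      cases l0 <;> simp only [Bool.false_eq_true, if_true, if_false]
      rotate_left
      · refine .cons ⟨⟨rfl, rfl, rfl, rfl, ?_, ?_⟩, rfl, ?_⟩ .nil
        · simpa [Store.app] using hc.write hi he' (some b) none none
        · simpa [Store.app] using hu _
        · simp [Store.app]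
      · refine .cons ⟨⟨rfl, rfl, rfl, rfl, ?_, ?_⟩, rfl, ?_⟩ .nil
        · simpa [Store.app, hupd] using hc
        · simpa [Store.app, hupd] using he''
        · simp [Store.app]
  | cell =>
    simp only [passOf] at hs
    have hc := hh.reset (f := none)
    rw [← hs, ← h2] at hc
    simp only [effects, EvalState.step]
    refine .cons ⟨⟨rfl, rfl, rfl, rfl, ?_, ?_⟩, rfl, ?_⟩ .nil
    · simpa [Store.app] using hc.write hi he' (some _) (some _) none
    · simpa [Store.app] using hu _
    · simp [Store.app]
  | level =>
    simp only [passOf] at hs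
    have hc := hh.shift (f := none)
    rw [← hs, ← h2] at hc
    simp only [effects, EvalState.step]
    cases ch <;> simp only [Bool.false_eq_true, if_true, if_false]
    rotate_left
    · refine .cons ⟨⟨rfl, rfl, rfl, rfl, ?_, ?_⟩, rfl, ?_⟩ .nil
      · simpa [Store.app, hupd] using hc
      · simpa [Store.app, hupd] using he''
      · simp [Store.app]
    · exact .nil
  | gate =>
    simp only [passOf] at hs
    have hc := hh.clear (f := none)
    rw [← hs, ← h2] at hc
    simp only [effects, EvalState.step]
    cases ch <;> simp only [Bool.false_eq_true, if_true, if_false]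
    rotate_left
    · refine .cons ⟨⟨rfl, rfl, rfl, rfl, ?_, ?_⟩, rfl, ?_⟩ .nil
      · simpa [Store.app, hupd] using hc
      · simpa [Store.app, hupd] using he''
      · simp [Store.app]
    · exact .nil
  | tick =>
    simp only [passOf] at hs
    have hc := hh.advance
    rw [← hs, ← h2] at hc
    simp only [effects, EvalState.step]
    refine .cons ⟨⟨rfl, rfl, rfl, rfl, ?_, ?_⟩, rfl, ?_⟩ .nil
    · simpa [Store.app, hupd] using hc
    · simpa [Store.app, hupd] using he''
    · simp [Store.app]
  | sep =>
    simp only [passOf] at hs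
    have hf := hh.read_fst
    have hc := hh.read_snd none
    rw [← hs] at hf
    rw [← hs, ← h2] at hc
    simp only [effects, EvalState.step, hf]
    refine .cons ⟨⟨rfl, rfl, rfl, rfl, ?_, ?_⟩, rfl, ?_⟩ .nil
    · simpa [Store.app, List.getD_eq_getElem?_getD] using
        hc.write hi he' none none (some (prev.getD cp false))
    · simpa [Store.app] using hu _
    · simp [Store.app]
  | port =>
    simp only [passOf] at hs
    have hc := hh.reset (f := none)
    rw [← hs, ← h2] at hc
    simp only [effects, EvalState.step]
    refine .cons ⟨⟨rfl, rfl, rfl, rfl, ?_, ?_⟩, rfl, ?_⟩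
      (.cons ⟨⟨rfl, rfl, rfl, rfl, ?_, ?_⟩, rfl, ?_⟩ .nil)
    · simpa [Store.app] using hc.write hi he' (some false) none (some false)
    · simpa [Store.app] using hu _
    · simp [Store.app]
    · simpa [Store.app] using hc.write hi he' (some true) none (some true)
    · simpa [Store.app] using hu _
    · simp [Store.app]
  | row =>
    simp only [passOf] at hs
    have hc := hh.reset (f := none)
    rw [← hs, ← h2] at hc
    simp only [effects, EvalState.step]
    refine .cons ⟨⟨rfl, rfl, rfl, rfl, ?_, ?_⟩, rfl, ?_⟩ ?_
    · simpa [Store.app, hupd] using hc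
    · simpa [Store.app, hupd] using he''
    · simp [Store.app]
    · cases ch with
      | true => exact .nil
      | false =>
        refine .cons ⟨⟨rfl, rfl, rfl, rfl, ?_, ?_⟩, rfl, ?_⟩ .nil
        · simpa [Store.app, hupd] using hc
        · simpa [Store.app, hupd] using he''
        · simp [Store.app]

end FuzzyComputation

namespace FuzzyComputation

theorem inputTape_succ {A W : Type} (x : List A) (i : ℕ) :
    FuzzyMachine.inputTape (W := W) x ((i + 1 : ℕ) : ℤ) =
      if h : i < x.length then .inp x[i] else if i = x.length then .right else .blank := rfl

theorem inputTape_zero {A W : Type} (x : List A) :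
    FuzzyMachine.inputTape (W := W) x ((0 : ℕ) : ℤ) = .left := rfl

/-- At the left endmarker and at blanks the evaluator does nothing. -/
theorem evalBody_idle (C : Ctx Tok Bool) (st : EvalStore) (env : Bool → ℕ)
    (hτ : FuzzyMachine.inputTape (W := Empty) C.x (env false) = .left ∨
      FuzzyMachine.inputTape (W := Empty) C.x (env false) = .blank) :
    ∃ st' : EvalStore, (∀ κ, evalBody.den C env κ st = κ st') ∧ st'.out = st.out ∧
      st'.pos = st.pos ∧ ∀ (a : EvalState) (i : ℕ), a.Rep C.n i st → a.Rep C.n i st' := by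
  classical
  obtain ⟨ann', h1, h2, h3⟩ := exists_sweep C .idle env st
  rw [passList_idle] at h1 h2
  refine ⟨⟨{ st.reg with found := none }, ann', st.pos, st.out⟩, fun κ => ?_, rfl, rfl,
    fun a i h => ⟨h.lev0, h.chosen, h.inrow, rfl, h2 ▸ h.holds, fun j hj => h3 j (h.empty j hj)⟩⟩
  rw [evalBody, Prog.den, Prog.den]
  rcases hτ with hτ | hτ <;>
  · simp only [Ctx.info, hτ, passOf]
    rw [h1, Prog.den, iSup_mem_effects]
    simp only [Ctx.info, hτ, effects, List.mem_singleton, iSup_iSup_eq_left]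
    simp [Store.app]

/-- At the end of the description the evaluator outputs the first variable of the last level, unless
the last gate has no row for the guessed values. -/
theorem evalBody_right (C : Ctx Tok Bool) {a : EvalState} {st : EvalStore} {i : ℕ}
    (h : a.Rep C.n i st) (env : Bool → ℕ)
    (hτ : FuzzyMachine.inputTape (W := Empty) C.x (env false) = .right) :
    ∃ st' : EvalStore, (∀ κ, evalBody.den C env κ st = ⨆ (_ : a.chosen = true), κ st') ∧
      st'.out = st.out ++ [a.cur.head?.getD false] := by
  classical
  obtain ⟨ann', h1, h2, h3⟩ := exists_sweep C .first env st
  rw [h.found, passList_first, h.holds.cur] at h1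
  refine ⟨Store.app ⟨{ st.reg with found := a.cur.head? }, ann', st.pos, st.out⟩ (env false)
    ⟨{ st.reg with found := none }, ann' (env false), some (a.cur.head?.getD false), false⟩,
    fun κ => ?_, ?_⟩
  · rw [evalBody, Prog.den, Prog.den]
    simp only [Ctx.info, hτ, passOf]
    rw [h1, Prog.den, iSup_mem_effects]
    simp only [Ctx.info, hτ, effects, h.chosen]
    cases a.chosen <;> simp
  · simp [Store.app]

open Classical in
theorem evalProg_blanks (C : Ctx Tok Bool) (w : List Bool) (l : List ℕ) (env : Bool → ℕ)
    (hl : ∀ i ∈ l, FuzzyMachine.inputTape (W := Empty) C.x (i : ℕ) = .blank) (st : EvalStore) :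
    l.foldr (fun i κ' => evalBody.den C (Function.update env false i) κ')
      (fun st => if st.out = w then 1 else 0) st = if st.out = w then 1 else 0 := by
  induction l generalizing st with
  | nil => rfl
  | cons i l ih =>
    rw [List.foldr_cons]
    obtain ⟨st', h1, h2, _⟩ := evalBody_idle C st (Function.update env false i) (.inr (by
      simpa using hl i (by simp)))
    rw [h1, ih (fun j hj => hl j (by simp [hj])), h2]

open Classical in
theorem foldr_evalBody (x : List Tok) (y : List Bool) (n : ℕ) (hx : x.length ≤ n) (w : List Bool)
    (env : Bool → ℕ) (ts : List Tok) (i : ℕ) (hts : ts = x.drop i) (hi : i ≤ x.length)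
    (a : EvalState) (st : EvalStore) (h : a.Rep n (i + 1) st) (hout : st.out = []) :
    (List.range' (i + 1) (n + 1 - i)).foldr
      (fun i κ' => evalBody.den ⟨x, y, n⟩ (Function.update env false i) κ')
      (fun st => if st.out = w then 1 else 0) st =
    ⨆ (b : Bool) (_ : a.Accepts y b ts st.pos ∧ w = [b]), (1 : Deg) := by
  induction ts generalizing i a st with
  | nil =>
    have hi' : i = x.length := by
      have := congrArg List.length hts
      simp at this; omega
    subst hi'
    rw [show n + 1 - x.length = (n - x.length) + 1 by omega, List.range'_succ, List.foldr_cons]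
    obtain ⟨st', h1, h2⟩ := evalBody_right ⟨x, y, n⟩ h (Function.update env false (x.length + 1))
      (by rw [Function.update_self, inputTape_succ]; simp)
    rw [h1, evalProg_blanks, h2, hout]
    · by_cases hc : a.chosen = true
      · simp only [hc, iSup_pos, EvalState.Accepts, true_and, List.nil_append]
        by_cases hw : w = [a.cur.head?.getD false]
        · subst hw
          rw [if_pos rfl]
          exact le_antisymm (le_iSup₂_of_le _ ⟨rfl, rfl⟩ le_rfl) unitInterval.le_one'
        · rw [if_neg (fun h => hw h.symm)]
          symm
          refine iSup₂_eq_bot.2 ?_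
          rintro b ⟨rfl, h⟩
          exact absurd h hw
      · simp [hc, EvalState.Accepts]
    · intro j hj
      rw [List.mem_range'_1] at hj
      obtain ⟨j, rfl⟩ : ∃ k, j = k + 1 := ⟨j - 1, by omega⟩
      rw [inputTape_succ, dif_neg, if_neg] <;> simp <;> omega
  | cons τ ts ih =>
    have hi' : i < x.length := by
      have := congrArg List.length hts
      simp at this; omega
    rw [List.drop_eq_getElem_cons hi', List.cons.injEq] at hts
    rw [show n + 1 - i = (n + 1 - (i + 1)) + 1 by omega, List.range'_succ, List.foldr_cons]
    obtain ⟨L, h1, h2⟩ := exists_evalBody ⟨x, y, n⟩ h (show i + 1 < n + 2 by omega)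
      (Function.update env false (i + 1)) (by simp) (τ := τ) (by
        rw [inputTape_succ, dif_pos hi', hts.1])
    rw [h1]
    simp only [EvalState.Accepts]
    have h3 : ⨆ st' ∈ L, (List.range' (i + 1 + 1) (n + 1 - (i + 1))).foldr
        (fun i κ' => evalBody.den ⟨x, y, n⟩ (Function.update env false i) κ')
        (fun st => if st.out = w then 1 else 0) st' =
        ⨆ a' ∈ a.step y[st.pos]? τ, ⨆ (b : Bool) (_ : a'.Accepts y b ts
          (if τ.adv then st.pos + 1 else st.pos) ∧ w = [b]), (1 : Deg) := by
      apply iSup_mem_eq_of_forall₂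
      refine h2.imp fun st' a' h => ?_
      rw [ih (i + 1) hts.2 (by omega) a' st' h.1 (h.2.2.trans hout), h.2.1]
    rw [h3]
    apply le_antisymm
    · refine iSup₂_le fun a' ha => iSup₂_le fun b hb => ?_
      exact le_iSup₂_of_le b ⟨⟨a', ha, hb.1⟩, hb.2⟩ le_rfl
    · refine iSup₂_le fun b hb => ?_
      obtain ⟨⟨a', ha, hb⟩, hw⟩ := hb
      exact le_iSup₂_of_le a' ha (le_iSup₂_of_le b ⟨hb, hw⟩ le_rfl)

/-- The initial state of the evaluator. -/
def EvalState.init : EvalState := ⟨true, true, false, [], [], [], 0, 0⟩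

/-- The output of the evaluator, in terms of evaluator states. -/
theorem evalProg_result (x : List Tok) (y : List Bool) (n : ℕ) (hx : x.length ≤ n)
    (w : List Bool) :
    evalProg.result (.empty, .empty) ⟨true, true, false, none⟩ ⟨x, y, n⟩ w =
      ⨆ (b : Bool) (_ : EvalState.init.Accepts y b x 0 ∧ w = [b]), (1 : Deg) := by
  classical
  rw [Prog.result, evalProg, Prog.den]
  simp only
  rw [List.range_eq_range', List.range'_succ, List.foldr_cons]
  have hrep : EvalState.init.Rep n 1 ⟨⟨true, true, false, none⟩,
      fun _ => (Slot.empty, Slot.empty), 0, []⟩ := by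
    refine ⟨rfl, rfl, rfl, rfl, ?_, fun _ _ => rfl⟩
    have hs : ∀ s ∈ slots (fun _ => (Slot.empty, Slot.empty)) (List.range (n + 2)),
        s = Slot.empty := by
      intro s hs
      simp only [slots, List.mem_flatMap] at hs
      obtain ⟨_, _, hs⟩ := hs
      simpa using hs
    refine ⟨?_, ?_, ?_, ?_, ?_⟩
    · exact List.filterMap_eq_nil_iff.2 fun s h => by rw [hs s h]; rfl
    · exact List.filterMap_eq_nil_iff.2 fun s h => by rw [hs s h]; rfl
    · exact List.filterMap_eq_nil_iff.2 fun s h => by rw [hs s h]; rfl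
    · exact marked_zero_iff.2 fun s h => by rw [hs s h]; rfl
    · exact marked_zero_iff.2 fun s h => by rw [hs s h]; rfl
  obtain ⟨st', h1, h3, h4, h2⟩ := evalBody_idle ⟨x, y, n⟩ ⟨⟨true, true, false, none⟩,
      fun _ => (Slot.empty, Slot.empty), 0, []⟩
    (Function.update (fun _ => 0) false 0) (.inl (by simpa using inputTape_zero (W := Empty) x))
  rw [h1]
  have := foldr_evalBody x y n hx w (fun _ => 0) x 0 rfl (Nat.zero_le _) _ st'
    (h2 _ _ hrep) h3
  rw [h4, Nat.sub_zero] at this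
  convert this

/-! ### Correctness of the evaluator -/

section Accepts

variable {y : List Bool} {b : Bool} {ts : List Tok} {a : EvalState} {pos : ℕ}

theorem accepts_cons {τ : Tok} : a.Accepts y b (τ :: ts) pos ↔
    ∃ a' ∈ a.step y[pos]? τ, a'.Accepts y b ts (if τ.adv then pos + 1 else pos) := Iff.rfl

theorem accepts_ticks (i : ℕ) : a.Accepts y b (List.replicate i .tick ++ ts) pos ↔
    EvalState.Accepts y b ts { a with cp := a.cp + i } pos := by
  induction i generalizing a with
  | zero => simp
  | succ i ih =>
    rw [List.replicate_succ, List.cons_append, accepts_cons]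
    simp [EvalState.step, Tok.adv, ih, Nat.add_assoc, Nat.add_comm 1 i]

/-- Input labels, in unary, move a cursor through the level below. -/
theorem accepts_ins (ins : List ℕ) (h : a.cp = 0) (hcg : a.cg = 0) :
    a.Accepts y b ((ins.flatMap fun i => List.replicate i .tick ++ [.sep]) ++ ts) pos ↔
    EvalState.Accepts y b ts
      { a with gate := a.gate ++ ins.map fun i => a.prev.getD i false } pos := by
  induction ins generalizing a with
  | nil => simp
  | cons i ins ih =>
    rw [List.flatMap_cons, List.append_assoc, List.append_assoc, accepts_ticks, List.singleton_append,
      accepts_cons]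
    simp only [EvalState.step, Tok.adv, List.mem_singleton, exists_eq_left, Bool.false_eq_true,
      if_false]
    rw [ih rfl rfl]
    simp [h, hcg]

/-- The output values of a gate are guessed. -/
theorem accepts_ports (k : ℕ) (hcg : a.cg = 0) :
    a.Accepts y b (List.replicate k .port ++ ts) pos ↔ ∃ w : List Bool, w.length = k ∧
      EvalState.Accepts y b ts { a with cur := a.cur ++ w, gate := a.gate ++ w } pos := by
  induction k generalizing a with
  | zero => simp
  | succ k ih =>
    rw [List.replicate_succ, List.cons_append, accepts_cons]
    simp only [EvalState.step, Tok.adv, List.map_cons, List.map_nil, Bool.false_eq_true, if_false]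
    constructor
    · rintro ⟨a', ha', h⟩
      rw [List.mem_pair] at ha'
      rcases ha' with rfl | rfl
      · rw [ih rfl] at h
        obtain ⟨w, hw, h⟩ := h
        exact ⟨false :: w, by simp [hw], by simpa [hcg] using h⟩
      · rw [ih rfl] at h
        obtain ⟨w, hw, h⟩ := h
        exact ⟨true :: w, by simp [hw], by simpa [hcg] using h⟩
    · rintro ⟨w, hw, h⟩
      obtain ⟨c, w, rfl⟩ := List.exists_cons_of_length_eq_add_one hw
      refine ⟨{ a with cur := a.cur ++ [c], gate := a.gate ++ [c], cg := 0 }, ?_, ?_⟩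
      · cases c <;> simp
      · rw [ih rfl]
        exact ⟨w, by simpa using hw, by simpa [hcg] using h⟩

/-- The symbols after which the chosen row of a gate does not matter any more. -/
def Boundary : List Tok → Prop
  | [] => True
  | .gate :: _ => True
  | .level :: _ => True
  | _ => False

theorem Boundary.accepts_iff (hts : Boundary ts) {a' : EvalState} (h1 : a'.lev0 = a.lev0)
    (h2 : a'.chosen = a.chosen) (h3 : a'.cur = a.cur) (h4 : a'.prev = a.prev) (h5 : a'.cp = a.cp) :
    a.Accepts y b ts pos ↔ a'.Accepts y b ts pos := by
  obtain ⟨l0, ch, ir, cu, pr, ga, cp, cg⟩ := a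
  obtain ⟨l0', ch', ir', cu', pr', ga', cp', cg'⟩ := a'
  simp only at h1 h2 h3 h4 h5
  subst h1 h2 h3 h4 h5
  match ts, hts with
  | [], _ => rfl
  | .gate :: _, _ => rfl
  | .level :: _, _ => rfl

theorem Boundary.not_accepts (hts : Boundary ts) (h : a.chosen = false) :
    ¬ a.Accepts y b ts pos := by
  match ts, hts with
  | [], _ => simp [EvalState.Accepts, h]
  | .gate :: _, _ => simp [EvalState.Accepts, EvalState.step, h]
  | .level :: _, _ => simp [EvalState.Accepts, EvalState.step, h]

theorem accepts_skip (u : List Bool) (hl : a.lev0 = false) (hr : a.inrow = false) (hcg : a.cg = 0) :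
    a.Accepts y b (u.map .bit ++ ts) pos ↔ a.Accepts y b ts pos := by
  induction u with
  | nil => simp
  | cons c u ih =>
    rw [List.map_cons, List.cons_append, accepts_cons]
    simp only [EvalState.step, hr, hl, Tok.adv, List.mem_singleton, exists_eq_left,
      Bool.false_eq_true, if_false]
    rw [← ih]
    obtain ⟨l0, ch, ir, cu, pr, ga, cp, cg⟩ := a
    simp only at hcg hl hr
    subst hcg hl hr
    rfl

/-- The chosen row has to agree with the values of the variables of the gate. -/
theorem accepts_compare (u : List Bool) (hr : a.inrow = true) (hcg : a.cg ≤ a.gate.length)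
    (hu : u.length = (a.gate.drop a.cg).length) :
    a.Accepts y b (u.map .bit ++ ts) pos ↔ u = a.gate.drop a.cg ∧
      EvalState.Accepts y b ts { a with cg := a.gate.length } pos := by
  induction u generalizing a with
  | nil =>
    have h1 : a.gate.drop a.cg = [] := List.eq_nil_of_length_eq_zero hu.symm
    have h2 : a.gate.length = a.cg := by simp at hu; omega
    simp [h1, h2]
  | cons c u ih =>
    rw [List.map_cons, List.cons_append, accepts_cons]
    simp only [EvalState.step, hr, Tok.adv, if_true, Bool.false_eq_true, if_false]
    have hlt : a.cg < a.gate.length := by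
      simp at hu; omega
    rw [List.drop_eq_getElem_cons hlt, List.getElem?_eq_getElem hlt, List.cons.injEq]
    simp only [Option.some.injEq]
    by_cases h : a.gate[a.cg] = c
    · rw [if_pos h]
      simp only [List.mem_singleton, exists_eq_left]
      refine (ih (a := ⟨a.lev0, a.chosen, true, a.cur, a.prev, a.gate, a.cp, a.cg + 1⟩) rfl hlt
        (by simp at hu ⊢; omega)).trans ?_
      simp [h]
    · rw [if_neg h]
      simp [Ne.symm h]

/-- Descriptions of rows. -/
def rowToks (us : List (List Bool)) : List Tok := us.flatMap fun u => .row :: u.map .bit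

/-- If a row of the gate has been chosen already, the remaining rows are skipped. -/
theorem accepts_rows_chosen (us : List (List Bool)) (hts : Boundary ts) (hl : a.lev0 = false)
    (hc : a.chosen = true) :
    a.Accepts y b (rowToks us ++ ts) pos ↔ a.Accepts y b ts pos := by
  induction us generalizing a with
  | nil => rfl
  | cons u us ih =>
    rw [rowToks, List.flatMap_cons, List.cons_append, List.cons_append, List.append_assoc,
      accepts_cons]
    simp only [EvalState.step, hc, Tok.adv, if_true, Bool.false_eq_true, if_false,
      List.mem_singleton, exists_eq_left]
    rw [accepts_skip u (by exact hl) rfl rfl]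
    refine (ih (a := ⟨a.lev0, true, false, a.cur, a.prev, a.gate, a.cp, 0⟩) hl rfl).trans ?_
    exact hts.accepts_iff rfl hc rfl rfl rfl

theorem accepts_rows (us : List (List Bool)) (hts : Boundary ts) (hl : a.lev0 = false)
    (hc : a.chosen = false) (hu : ∀ u ∈ us, u.length = a.gate.length) :
    a.Accepts y b (rowToks us ++ ts) pos ↔
      a.gate ∈ us ∧ EvalState.Accepts y b ts { a with chosen := true } pos := by
  induction us generalizing a with
  | nil => simpa [rowToks] using hts.not_accepts hc
  | cons u us ih =>
    rw [rowToks, List.flatMap_cons, List.cons_append, List.cons_append, List.append_assoc,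
      accepts_cons]
    simp only [EvalState.step, hc, Tok.adv, Bool.false_eq_true, if_false, List.mem_cons,
      List.not_mem_nil, or_false, exists_eq_or_imp, exists_eq_left]
    rw [accepts_skip u (by exact hl) rfl rfl, accepts_compare u rfl (by simp) (by simp [hu])]
    have h1 := ih (a := ⟨a.lev0, false, false, a.cur, a.prev, a.gate, a.cp, 0⟩) hl rfl
      (fun u hu' => hu u (by simp [hu']))
    have h2 := accepts_rows_chosen (y := y) (b := b) (pos := pos)
      (a := ⟨a.lev0, true, true, a.cur, a.prev, a.gate, a.cp, a.gate.length⟩) us hts hl rfl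
    rw [rowToks] at h1 h2
    rw [h1, h2, hts.accepts_iff (a := ⟨a.lev0, true, false, a.cur, a.prev, a.gate, a.cp, 0⟩)
      (a' := { a with chosen := true }) rfl rfl rfl rfl rfl,
      hts.accepts_iff (a := ⟨a.lev0, true, true, a.cur, a.prev, a.gate, a.cp, a.gate.length⟩)
      (a' := { a with chosen := true }) rfl rfl rfl rfl rfl, List.drop_zero, eq_comm (a := u)]
    tauto

/-- A gate is passed iff one of its rows fits to the guessed output values. -/
theorem accepts_gate (G : Gate Bool) (hts : Boundary ts) (hl : a.lev0 = false) (hcp : a.cp = 0) :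
    a.Accepts y b (G.encode ++ ts) pos ↔ a.chosen = true ∧ ∃ w : List Bool, w.length = G.outs ∧
      G.tab (G.ins.map fun i => a.prev.getD i false) w = true ∧
      EvalState.Accepts y b ts { a with cur := a.cur ++ w, chosen := true } pos := by
  have hrows : ((allBits G.ins.length).flatMap fun v =>
      ((allBits G.outs).filter (G.tab v)).flatMap fun w => .row :: (v ++ w).map .bit) =
      rowToks ((allBits G.ins.length).flatMap fun v =>
        ((allBits G.outs).filter (G.tab v)).map (v ++ ·)) := by
    simp [rowToks, List.flatMap_assoc, List.flatMap_map]
  rw [Gate.encode, hrows, List.append_assoc, List.append_assoc, List.append_assoc,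
    List.singleton_append, accepts_cons]
  by_cases hch : a.chosen = true
  · simp only [EvalState.step, hch, if_true, Tok.adv, Bool.false_eq_true, if_false,
      List.mem_singleton, exists_eq_left, true_and]
    rw [accepts_ins _ (by exact hcp) rfl, accepts_ports _ rfl]
    refine exists_congr fun w => and_congr_right fun hw => ?_
    rw [accepts_rows _ hts (by exact hl) rfl]
    · refine and_congr ?_ (hts.accepts_iff rfl rfl rfl rfl rfl)
      simp only [List.nil_append, List.mem_flatMap, List.mem_map, List.mem_filter, mem_allBits]
      constructor
      · rintro ⟨v, hv, w', ⟨hw', ht⟩, h⟩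
        obtain ⟨rfl, rfl⟩ := List.append_inj h (by simp [hv])
        exact ht
      · intro ht
        exact ⟨_, by simp, w, ⟨hw, ht⟩, rfl⟩
    · intro u hu
      simp only [List.mem_flatMap, List.mem_map, List.mem_filter, mem_allBits] at hu
      obtain ⟨v, hv, w', ⟨hw', ht⟩, rfl⟩ := hu
      simp [hv, hw, hw']
  · simp [EvalState.step, hch]

theorem le_levelDegree_iff {r : Deg} (hr : r ≠ 0) (gs : List (Gate Deg)) (v w : List Bool) :
    r ≤ levelDegree gs v w ↔ match gs with
      | [] => w = []
      | G :: gs => ∃ w₁ w₂, w = w₁ ++ w₂ ∧ w₁.length = G.outs ∧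
        r ≤ G.tab (G.ins.map fun i => v.getD i false) w₁ ∧ r ≤ levelDegree gs v w₂ := by
  have h0 : ¬ r ≤ 0 := fun h => hr (le_antisymm h bot_le)
  cases gs with
  | nil =>
    simp only [levelDegree]
    split_ifs with h
    · simp [h, unitInterval.le_one']
    · simp [h, h0]
  | cons G gs =>
    simp only [levelDegree]
    split_ifs with h
    · simp only [h0, false_iff]
      rintro ⟨w₁, w₂, rfl, h1, _⟩
      simp [h1] at h
    · rw [le_inf_iff]
      constructor
      · rintro ⟨h1, h2⟩
        exact ⟨w.take G.outs, w.drop G.outs, by simp, by simp; omega, h1, h2⟩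
      · rintro ⟨w₁, w₂, rfl, h1, h2, h3⟩
        rw [← h1, List.take_left, List.drop_left]
        exact ⟨h2, h3⟩

theorem accepts_level {r : Deg} (hr : r ≠ 0) (l : List (Gate Deg)) (hts : Boundary ts)
    (hl : a.lev0 = false) (hcp : a.cp = 0) (hc : a.chosen = true) (D : ∀ d : Deg, Decidable (r ≤ d)) :
    a.Accepts y b ((l.flatMap fun G => Gate.encode
        { ins := G.ins, outs := G.outs, tab := fun v w => decide (r ≤ G.tab v w) }) ++ ts) pos ↔
      ∃ w : List Bool, r ≤ levelDegree l a.prev w ∧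
        EvalState.Accepts y b ts { a with cur := a.cur ++ w } pos := by
  induction l generalizing a with
  | nil =>
    simp only [le_levelDegree_iff hr, List.flatMap_nil, List.nil_append, exists_eq_left,
      List.append_nil]
  | cons G l ih =>
    have hb : Boundary ((l.flatMap fun G => Gate.encode
        { ins := G.ins, outs := G.outs, tab := fun v w => decide (r ≤ G.tab v w) }) ++ ts) := by
      cases l with
      | nil => exact hts
      | cons G' l => trivial
    rw [List.flatMap_cons, List.append_assoc, accepts_gate _ hb hl hcp]
    simp only [hc, true_and, le_levelDegree_iff hr (G :: l), decide_eq_true_eq]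
    constructor
    · rintro ⟨w, h1, h2, h3⟩
      rw [ih (by exact hl) (by exact hcp) rfl] at h3
      obtain ⟨w', h4, h5⟩ := h3
      refine ⟨w ++ w', ⟨w, w', rfl, h1, h2, h4⟩, ?_⟩
      simpa [hc] using h5
    · rintro ⟨_, ⟨w, w', rfl, h1, h2, h4⟩, h5⟩
      refine ⟨w, h1, h2, ?_⟩
      rw [ih (by exact hl) (by exact hcp) rfl]
      exact ⟨w', h4, by simpa [hc] using h5⟩

theorem accepts_levels {r : Deg} (hr : r ≠ 0) (ls : List (List (Gate Deg)))
    (hc : a.chosen = true) (D : ∀ d : Deg, Decidable (r ≤ d)) :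
    a.Accepts y b (ls.flatMap fun l => .level :: l.flatMap fun G => Gate.encode
        { ins := G.ins, outs := G.outs, tab := fun v w => decide (r ≤ G.tab v w) }) pos ↔
      ∃ w : List Bool, CutReach r ls a.cur w ∧ w.head?.getD false = b := by
  induction ls generalizing a with
  | nil => simp [EvalState.Accepts, CutReach, hc]
  | cons l ls ih =>
    rw [List.flatMap_cons, List.cons_append, accepts_cons]
    simp only [EvalState.step, hc, if_true, Tok.adv, Bool.false_eq_true, if_false,
      List.mem_singleton, exists_eq_left]
    rw [accepts_level hr l _ rfl rfl rfl D]
    · constructor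
      · rintro ⟨w, h1, h2⟩
        rw [ih rfl] at h2
        obtain ⟨w', h2, h3⟩ := h2
        exact ⟨w', ⟨w, h1, h2⟩, h3⟩
      · rintro ⟨w', ⟨w, h1, h2⟩, h3⟩
        refine ⟨w, h1, ?_⟩
        rw [ih rfl]
        exact ⟨w', h2, h3⟩
    · cases ls <;> trivial

theorem accepts_consts (z : List Bool) (hl : a.lev0 = true) (hr : a.inrow = false) (hcg : a.cg = 0) :
    a.Accepts y b (z.map .bit ++ ts) pos ↔
      EvalState.Accepts y b ts { a with cur := a.cur ++ z } pos := by
  induction z generalizing a with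
  | nil => simp
  | cons c u ih =>
    rw [List.map_cons, List.cons_append, accepts_cons]
    simp only [EvalState.step, hr, hl, Tok.adv, List.mem_singleton, exists_eq_left,
      Bool.false_eq_true, if_false, if_true]
    rw [ih rfl rfl rfl]
    simp [hcg]

theorem window_eq (m : ℕ) (y : List Bool) :
    window m y = (List.range m).flatMap fun i => [y[i]?.isSome, y[i]?.getD false] := by
  refine List.flatMap_congr fun i _ => ?_
  cases y[i]? <;> rfl

theorem accepts_cells (m : ℕ) (hcg : a.cg = 0) :
    a.Accepts y b (List.replicate m .cell ++ ts) pos ↔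
      EvalState.Accepts y b ts { a with cur := a.cur ++
        ((List.range' pos m).flatMap fun i => [y[i]?.isSome, y[i]?.getD false]) } (pos + m) := by
  induction m generalizing a pos with
  | zero => simp
  | succ m ih =>
    rw [List.replicate_succ, List.cons_append, accepts_cons]
    simp only [EvalState.step, Tok.adv, List.mem_singleton, exists_eq_left, if_true]
    rw [ih rfl, List.range'_succ]
    simp [hcg, Nat.add_assoc, Nat.add_comm 1 m]

end Accepts

theorem length_window (m : ℕ) (y : List Bool) : (window m y).length = 2 * m := by
  rw [window_eq]
  simp [List.length_flatMap, Nat.mul_comm]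

theorem length_of_le_levelDegree {r : Deg} (hr : r ≠ 0) (l : List (Gate Deg)) (v w : List Bool)
    (h : r ≤ levelDegree l v w) : w.length = (l.map Gate.outs).sum := by
  induction l generalizing w with
  | nil => rw [le_levelDegree_iff hr] at h; simp [h]
  | cons G l ih =>
    rw [le_levelDegree_iff hr] at h
    obtain ⟨w₁, w₂, rfl, h1, _, h3⟩ := h
    simp [h1, ih w₂ h3]

theorem CutReach.length_eq {r : Deg} (hr : r ≠ 0) {ls : List (List (Gate Deg))} {v w : List Bool}
    {c : ℕ} (h : CutReach r ls v w) (hv : v.length = c) (hls : WellFormedLevels c ls) :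
    w.length = 1 := by
  induction ls generalizing v c with
  | nil => rw [← show v = w from h, hv]; exact hls
  | cons l ls ih =>
    obtain ⟨v', h1, h2⟩ := h
    exact ih h2 (length_of_le_levelDegree hr l v v' h1) hls.2.2

/-- The evaluator computes the values of the cuts of a circuit. -/
theorem accepts_encode_cut {C : Circuit Deg} (hC : C.WellFormed) {r : Deg} (hr : r ≠ 0)
    {z : List Bool} (hz : z.length = C.consts) (y : List Bool) (b : Bool) :
    EvalState.init.Accepts y b ((C.cut r).encode z) 0 ↔
      CutReach r C.levels (z ++ window C.cells y) [b] := by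
  rw [Circuit.encode, List.append_assoc, accepts_consts _ rfl rfl rfl, accepts_cells _ rfl]
  simp only [Circuit.cut, List.flatMap_map]
  rw [accepts_levels hr _ rfl, ← List.range_eq_range', ← window_eq]
  simp only [EvalState.init, List.nil_append]
  constructor
  · rintro ⟨w, h1, h2⟩
    have := h1.length_eq hr (by simp [hz, length_window]) hC
    obtain ⟨c, rfl⟩ := List.length_eq_one_iff.1 this
    simp only [List.head?_cons, Option.getD_some] at h2
    rwa [← h2]
  · intro h
    exact ⟨_, h, rfl⟩

end FuzzyComputation

namespace FuzzyComputation

/-! ### Fuzzy proofs and crisp proofs -/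

/-- The two cases in which the operation `J` and the set `Θ` of fuzzy proofs fit together. -/
def Admissible (J : Deg → Deg → Deg) (Θ : Set (FuzzySet (List Bool))) : Prop :=
  (∀ a b, J a b = a ⊓ b) ∨ ((∀ a b, J a b = a * b) ∧ CrispGenerated Θ)

theorem Admissible.eq_zero_iff {J : Deg → Deg → Deg} {Θ : Set (FuzzySet (List Bool))}
    (hJ : Admissible J Θ) {a b : Deg} : J a b = 0 ↔ a = 0 ∨ b = 0 := by
  rcases hJ with hJ | ⟨hJ, _⟩
  · rw [hJ]; exact min_eq_bot
  · rw [hJ]; exact mul_eq_zero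

/-- The value of a fuzzy proof `φ`, when a guess `i` of degree `a i` and a crisp proof `y` are given
the degree `t i y`. -/
def proofValue {ι : Type} (J : Deg → Deg → Deg) (a : ι → Deg) (t : ι → List Bool → Deg)
    (φ : FuzzySet (List Bool)) : Deg := ⨆ (i : ι) (y : List Bool), J (a i) (φ y) ⊓ t i y

theorem proofValue_min {ι : Type} {J : Deg → Deg → Deg} (hJ : ∀ a b, J a b = a ⊓ b) (a : ι → Deg)
    (t : ι → List Bool → Deg) (φ : FuzzySet (List Bool)) :
    proofValue J a t φ = ⨆ y, φ y ⊓ ⨆ i, a i ⊓ t i y := by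
  simp only [proofValue, hJ, inf_iSup_eq]
  rw [iSup_comm]
  refine iSup_congr fun y => iSup_congr fun i => ?_
  rw [inf_comm (a i), inf_assoc]

section Mul

variable {ι : Type} {J : Deg → Deg → Deg} (hJ : ∀ a b, J a b = a * b) {Θ : Set (FuzzySet (List Bool))}
  (hΘ : CrispGenerated Θ) (a : ι → Deg) (t : ι → List Bool → Deg)

include hJ in
theorem proofValue_mul_le (φ : FuzzySet (List Bool)) :
    proofValue J a t φ ≤ ⨆ (y : List Bool) (_ : φ y ≠ 0), ⨆ i, a i ⊓ t i y := by
  refine iSup₂_le fun i y => ?_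
  rw [hJ]
  by_cases h : φ y = 0
  · rw [h, mul_zero]; exact inf_le_left.trans bot_le
  · exact le_iSup₂_of_le y h (le_iSup_of_le i (inf_le_inf_right _ unitInterval.mul_le_left))

include hJ in
theorem le_proofValue_mul {φ : FuzzySet (List Bool)} {y : List Bool} (h : φ y = 1) :
    ⨆ i, a i ⊓ t i y ≤ proofValue J a t φ := by
  refine iSup_le fun i => le_iSup₂_of_le i y ?_
  rw [hJ, h, mul_one]

include hJ hΘ in
theorem iSup_proofValue_mul : ⨆ φ ∈ Θ, proofValue J a t φ =
    ⨆ φ ∈ Θ, ⨆ (y : List Bool) (_ : φ y ≠ 0), ⨆ i, a i ⊓ t i y := by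
  apply le_antisymm
  · exact iSup₂_mono fun φ _ => proofValue_mul_le hJ a t φ
  · refine iSup₂_le fun φ hφ => iSup₂_le fun y hy => ?_
    exact le_iSup₂_of_le (crisp y) ((hΘ φ hφ).2 y hy) (le_proofValue_mul hJ a t (if_pos rfl))

include hJ hΘ in
theorem iInf_proofValue_mul : ⨅ φ ∈ Θ, proofValue J a t φ =
    ⨅ (y : List Bool) (_ : crisp y ∈ Θ), ⨆ i, a i ⊓ t i y := by
  apply le_antisymm
  · refine le_iInf₂ fun y hy => iInf₂_le_of_le _ hy ((proofValue_mul_le hJ a t _).trans ?_)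
    refine iSup₂_le fun y' hy' => ?_
    rw [show y' = y by by_contra h; exact hy' (if_neg h)]
  · refine le_iInf₂ fun φ hφ => ?_
    obtain ⟨⟨y, hy⟩, h⟩ := hΘ φ hφ
    refine iInf₂_le_of_le y (h y ?_) (le_proofValue_mul hJ a t hy)
    change φ y ≠ 0
    rw [show φ y = 1 from hy]
    exact one_ne_zero

end Mul

/-- The best and the worst value of a fuzzy proof depend only on the values of crisp proofs. For
`J = min` this holds for each fuzzy proof; for the product it rests on the closure of `Θ` under
passing to crisp proofs. -/
theorem Admissible.proofValue_congr {J : Deg → Deg → Deg} {Θ : Set (FuzzySet (List Bool))}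
    (hJ : Admissible J Θ) {ι κ : Type} {a : ι → Deg} {t : ι → List Bool → Deg} {a' : κ → Deg}
    {t' : κ → List Bool → Deg}
    (h : ∀ φ ∈ Θ, ∀ y, φ y ≠ 0 → ⨆ i, a i ⊓ t i y = ⨆ j, a' j ⊓ t' j y) :
    ⨆ φ ∈ Θ, proofValue J a t φ = ⨆ φ ∈ Θ, proofValue J a' t' φ ∧
    ⨅ φ ∈ Θ, proofValue J a t φ = ⨅ φ ∈ Θ, proofValue J a' t' φ := by
  rcases hJ with hJ | ⟨hJ, hΘ⟩
  · have key : ∀ φ ∈ Θ, proofValue J a t φ = proofValue J a' t' φ := by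
      intro φ hφ
      rw [proofValue_min hJ, proofValue_min hJ]
      refine iSup_congr fun y => ?_
      by_cases hy : φ y = 0
      · rw [hy]; exact (bot_inf_eq _).trans (bot_inf_eq _).symm
      · rw [h φ hφ y hy]
    exact ⟨biSup_congr key, biInf_congr key⟩
  · rw [iSup_proofValue_mul hJ hΘ, iSup_proofValue_mul hJ hΘ, iInf_proofValue_mul hJ hΘ,
      iInf_proofValue_mul hJ hΘ]
    refine ⟨biSup_congr fun φ hφ => biSup_congr fun y hy => h φ hφ y hy,
      biInf_congr fun y hy => h _ hy y ?_⟩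
    rw [crisp, if_pos rfl]
    exact one_ne_zero

theorem approximates_one_iff {B : Type} {F G : FuzzySet (List B)} :
    Approximates (fun _ => 1) F G ↔ F = G := by
  constructor
  · intro h
    funext x
    have := h x
    simp only [div_one, one_mul] at this
    exact le_antisymm this.1 this.2
  · rintro rfl x
    simp

theorem mem_decisions {t : FuzzySet (List Bool)} (h : ∀ w, (∀ b, w ≠ [b]) → t w = 0) :
    t ∈ decisions := by
  refine ⟨t [true], t [false], ?_⟩
  funext w
  rw [decision]
  split_ifs with h1 h2
  · rw [h1]
  · rw [h2]
  · exact h w fun b => by cases b <;> assumption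

/-! ### Fuzzy-Circuit-SAT is in Fuzzy-NPA -/

/-- The machine that evaluates a circuit on a proof. -/
def satVerifier : Verifier Tok := evalProg.machine (.empty, .empty) ⟨true, true, false, none⟩

variable {J : Deg → Deg → Deg} {Θ : Set (FuzzySet (List Bool))}

theorem satVerifier_output (hJ : Admissible J Θ) {c : FuzzySet (List Tok)} (hc : (supp c).Finite)
    (φ : FuzzySet (List Bool)) (w : List Bool) :
    satVerifier.output J c φ w = proofValue J c
      (fun x y => ⨆ (b : Bool) (_ : EvalState.init.Accepts y b x 0 ∧ w = [b]), (1 : Deg)) φ := by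
  rw [satVerifier, Prog.output_eq _ evalProg_scoped, proofValue]
  refine iSup_congr fun x => iSup_congr fun y => ?_
  by_cases hx : c x = 0
  · rw [hJ.eq_zero_iff.2 (.inl hx)]; exact (bot_inf_eq _).trans (bot_inf_eq _).symm
  · rw [evalProg_result x y _ (len_bound hc hx)]

/-- The value of a circuit on a crisp proof, as a supremum over its cuts. -/
theorem iSup_describe_accepts {C : Circuit Deg} {e : FuzzySet (List Bool)}
    (h : IsFuzzyCircuit C e) (y : List Bool) (b : Bool) :
    ⨆ x, C.describe e x ⊓
      (⨆ (b' : Bool) (_ : EvalState.init.Accepts y b' x 0 ∧ [b] = [b']), (1 : Deg)) =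
    ⨆ z, e z ⊓ circVal C.levels (z ++ window C.cells y) [b] := by
  apply le_antisymm
  · refine iSup_le fun x => ?_
    simp only [Circuit.describe, iSup_inf_eq]
    refine iSup_le fun r => iSup_le fun z => iSup_le fun hx => ?_
    by_cases hr : r = 0
    · rw [hr]; exact (inf_le_left.trans inf_le_left).trans bot_le
    by_cases hz : e z = 0
    · rw [hz]; exact (inf_le_left.trans inf_le_right).trans bot_le
    simp only [inf_iSup_eq]
    refine iSup_le fun b' => iSup_le fun hb => ?_
    obtain ⟨hb, hb'⟩ := hb
    obtain rfl : b = b' := by simpa using hb'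
    rw [hx, accepts_encode_cut h.1 hr (h.2.2 z hz)] at hb
    refine le_iSup_of_le z (inf_le_left.trans ?_)
    rw [inf_comm, circVal_eq_iSup]
    exact inf_le_inf_left _ (le_iSup₂_of_le r hb le_rfl)
  · refine iSup_le fun z => ?_
    rw [circVal_eq_iSup]
    simp only [inf_iSup_eq]
    refine iSup₂_le fun r hr' => ?_
    by_cases hr : r = 0
    · rw [hr]; exact inf_le_right.trans bot_le
    by_cases hz : e z = 0
    · rw [hz]; exact inf_le_left.trans bot_le
    refine le_iSup_of_le ((C.cut r).encode z) ?_
    refine le_iSup₂_of_le b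
      ⟨(accepts_encode_cut h.1 hr (h.2.2 z hz) y b).2 hr', rfl⟩ ?_
    exact le_min (le_iSup₂_of_le r z (le_iSup_of_le rfl (inf_comm (e z) r).le))
      unitInterval.le_one'

/-- The outcome of the evaluator on the description of a circuit. -/
theorem satVerifier_outcome (hJ : Admissible J Θ) {C : Circuit Deg} {e : FuzzySet (List Bool)}
    (h : IsFuzzyCircuit C e) :
    satVerifier.outcome J Θ (C.describe e) =
      decision (⨆ φ ∈ Θ, C.outcome J e φ [true]) (⨅ φ ∈ Θ, C.outcome J e φ [false]) := by
  have hfin := (describe_isFuzzyString (C := C) h.2.1).1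
  have key := fun b => hJ.proofValue_congr (Θ := Θ) (a := C.describe e) (a' := e)
    (fun _ _ y _ => iSup_describe_accepts h y b)
  rw [Verifier.outcome]
  simp only [satVerifier_output hJ hfin, Circuit.outcome_eq]
  exact congrArg₂ decision (key true).1 (key false).2

theorem fuzzyCircuitSAT_val (hJ : Admissible J Θ) {C : Circuit Deg} {e : FuzzySet (List Bool)}
    (h : IsFuzzyCircuit C e) :
    (fuzzyCircuitSAT J Θ).val (C.describe e) =
      decision (⨆ φ ∈ Θ, C.outcome J e φ [true]) (⨅ φ ∈ Θ, C.outcome J e φ [false]) := by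
  have key : ∀ C' e', IsFuzzyCircuit C' e' ∧ C.describe e = C'.describe e' →
      ⨆ φ ∈ Θ, C'.outcome J e' φ [true] = ⨆ φ ∈ Θ, C.outcome J e φ [true] ∧
      ⨅ φ ∈ Θ, C'.outcome J e' φ [false] = ⨅ φ ∈ Θ, C.outcome J e φ [false] := by
    rintro C' e' ⟨h', he⟩
    have h1 := satVerifier_outcome hJ h'
    rw [← he, satVerifier_outcome hJ h] at h1
    have h2 := congrFun h1 [true]
    have h3 := congrFun h1 [false]
    simp only [decision, if_true, List.cons.injEq, Bool.false_eq_true, false_and, if_false] at h2 h3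
    exact ⟨h2.symm, h3.symm⟩
  refine congrArg₂ decision ?_ ?_
  · apply le_antisymm
    · exact iSup_le fun C' => iSup_le fun e' => iSup_le fun h' => (key C' e' h').1.le
    · exact le_iSup₂_of_le C e (le_iSup_of_le ⟨h, rfl⟩ le_rfl)
  · apply le_antisymm
    · exact iSup_le fun C' => iSup_le fun e' => iSup_le fun h' => (key C' e' h').2.le
    · exact le_iSup₂_of_le C e (le_iSup_of_le ⟨h, rfl⟩ le_rfl)

theorem fuzzyCircuitSAT_mem (hJ : Admissible J Θ) :
    FuzzyNPA J Θ tolOne (fuzzyCircuitSAT J Θ) := by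
  refine ⟨⟨?_, rfl⟩, fun _ => 1, rfl, satVerifier, ?_⟩
  · rintro _ ⟨C, e, h, rfl⟩
    exact describe_isFuzzyString h.2.1
  · obtain ⟨q, hq⟩ := evalProg.exists_haltsIn evalProg_scoped (.empty, .empty)
      ⟨true, true, false, none⟩
    refine ⟨q, ?_⟩
    rintro _ ⟨C, e, h, rfl⟩
    refine ⟨fun φ _ => ⟨hq _ _ _, mem_decisions fun w hw => ?_⟩, ?_⟩
    · rw [satVerifier_output hJ (describe_isFuzzyString h.2.1).1]
      refine iSup₂_eq_bot.2 fun x y => ?_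
      have : (⨆ (b : Bool) (_ : EvalState.init.Accepts y b x 0 ∧ w = [b]), (1 : Deg)) = ⊥ :=
        iSup₂_eq_bot.2 fun b hb => absurd hb.2 (hw b)
      simp only [this]
      exact inf_bot_eq _
    · rw [approximates_one_iff, satVerifier_outcome hJ h, fuzzyCircuitSAT_val hJ h]

end FuzzyComputation

namespace FuzzyComputation

/-! ### Levels with mostly crisp gates -/

/-- The best value of `κ` that the gates `gs` can reach from the configuration `v`. -/
def levelVal : List (Gate Deg) → List Bool → (List Bool → Deg) → Deg
  | [], _, κ => κ []
  | G :: gs, v, κ => ⨆ (w : List Bool) (_ : w.length = G.outs),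
      G.tab (G.ins.map fun i => v.getD i false) w ⊓ levelVal gs v (fun w' => κ (w ++ w'))

theorem iSup_levelDegree_inf (gs : List (Gate Deg)) (v : List Bool) (κ : List Bool → Deg) :
    ⨆ w, levelDegree gs v w ⊓ κ w = levelVal gs v κ := by
  induction gs generalizing κ with
  | nil =>
    apply le_antisymm
    · refine iSup_le fun w => ?_
      rw [levelDegree]
      split_ifs with h
      · rw [h]; exact inf_le_right
      · exact inf_le_left.trans bot_le
    · exact le_iSup_of_le [] (by rw [levelDegree, if_pos rfl]; exact (top_inf_eq _).ge)
  | cons G gs ih =>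
    simp only [levelVal, ← ih, inf_iSup_eq]
    apply le_antisymm
    · refine iSup_le fun w => ?_
      rw [levelDegree]
      split_ifs with h
      · exact inf_le_left.trans bot_le
      · refine le_iSup₂_of_le (w.take G.outs) (by simp; omega) (le_iSup_of_le (w.drop G.outs) ?_)
        rw [List.take_append_drop, inf_assoc]
    · refine iSup₂_le fun w hw => iSup_le fun w' => le_iSup_of_le (w ++ w') ?_
      rw [levelDegree, if_neg (by simp [← hw]), ← hw, List.take_left, List.drop_left, inf_assoc]

theorem circVal_cons (l : List (Gate Deg)) (ls : List (List (Gate Deg))) (v w : List Bool) :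
    circVal (l :: ls) v w = levelVal l v (fun v' => circVal ls v' w) :=
  iSup_levelDegree_inf l v _

open Classical in
/-- The gate that computes the function `f` from its inputs. -/
def crispGate (ins : List ℕ) (outs : ℕ) (f : List Bool → List Bool) : Gate Deg where
  ins := ins
  outs := outs
  tab v w := if w = f v then 1 else 0

theorem levelVal_crispGate {ins : List ℕ} {outs : ℕ} {f : List Bool → List Bool}
    (gs : List (Gate Deg)) (v : List Bool) (κ : List Bool → Deg)
    (hf : (f (ins.map fun i => v.getD i false)).length = outs) :
    levelVal (crispGate ins outs f :: gs) v κ =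
      levelVal gs v (fun w => κ (f (ins.map fun i => v.getD i false) ++ w)) := by
  rw [levelVal, crispGate]
  apply le_antisymm
  · refine iSup₂_le fun w hw => ?_
    simp only
    split_ifs with h
    · rw [h]; exact inf_le_right
    · exact inf_le_left.trans bot_le
  · refine le_iSup₂_of_le _ hf ?_
    simp only [if_true]
    exact (top_inf_eq _).ge

theorem levelVal_map_crispGate {ι : Type} (l : List ι) (ins : ι → List ℕ) (outs : ι → ℕ)
    (f : ι → List Bool → List Bool) (g : ι → List Bool) (gs : List (Gate Deg)) (v : List Bool)
    (κ : List Bool → Deg)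
    (hg : ∀ i ∈ l, f i ((ins i).map fun j => v.getD j false) = g i) (hl : ∀ i, (g i).length = outs i) :
    levelVal (l.map (fun i => crispGate (ins i) (outs i) (f i)) ++ gs) v κ =
      levelVal gs v (fun w => κ (l.flatMap g ++ w)) := by
  induction l generalizing κ with
  | nil => rfl
  | cons i l ih =>
    have h := hg i (by simp)
    rw [List.map_cons, List.cons_append, levelVal_crispGate _ _ _ (by rw [h, hl]), h,
      ih _ (fun j hj => hg j (by simp [hj]))]
    simp only [List.flatMap_cons, List.append_assoc]

/-! ### Blocks of variables -/

theorem map_getD_range' (v : List Bool) (a l : ℕ) (h : a + l ≤ v.length) :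
    (List.range' a l).map (fun i => v.getD i false) = (v.drop a).take l := by
  refine List.ext_getElem (by simp; omega) fun i h1 h2 => ?_
  simp at h1
  simp [List.getElem?_eq_getElem (show a + i < v.length by omega)]

theorem length_flatMap_range {g : ℕ → List Bool} {B : ℕ} (hg : ∀ i, (g i).length = B) (m : ℕ) :
    ((List.range m).flatMap g).length = m * B := by
  simp [List.length_flatMap, hg]

theorem map_getD_flatMap_range {g : ℕ → List Bool} {B : ℕ} (hg : ∀ i, (g i).length = B) {m j : ℕ}
    (hj : j < m) (u v : List Bool) :
    (List.range' (u.length + j * B) B).map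
      (fun i => (u ++ ((List.range m).flatMap g ++ v)).getD i false) = g j := by
  have hm : List.range m = List.range j ++ j :: List.range' (j + 1) (m - j - 1) := by
    rw [List.range_eq_range', List.range_eq_range', ← List.range'_succ]
    have := List.range'_append_1 (s := 0) (m := j) (n := m - j - 1 + 1)
    rw [Nat.zero_add] at this
    rw [this]
    congr 1
    omega
  have hl : (u ++ (List.range j).flatMap g).length = u.length + j * B := by
    rw [List.length_append, length_flatMap_range hg]
  have hs : u ++ ((List.range m).flatMap g ++ v) = (u ++ (List.range j).flatMap g) ++
      (g j ++ ((List.range' (j + 1) (m - j - 1)).flatMap g ++ v)) := by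
    rw [hm]
    simp
  rw [hs, map_getD_range' _ _ _ (by simp only [List.length_append, length_flatMap_range hg, hg]; omega),
    ← hl, List.drop_left]
  exact (congrArg (fun k => List.take k _) (hg j).symm).trans (List.take_left ..)

/-- A coding by bit strings of the same length; the proof uses unit vectors. -/
theorem exists_coding (X : Type) [Finite X] :
    ∃ (B : ℕ) (enc : X → List Bool), (∀ x, (enc x).length = B) ∧ Function.Injective enc := by
  classical
  have := Fintype.ofFinite X
  refine ⟨Fintype.card X, fun x => (List.finRange (Fintype.card X)).map fun i =>
    decide (Fintype.equivFin X x = i), fun x => by simp, fun x y h => ?_⟩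
  have := List.map_inj_left.1 h (Fintype.equivFin X x) (List.mem_finRange _)
  simpa [eq_comm] using this

/-! ### The circuit of a fuzzy proof verification system -/

instance {Q A W B : Type} [Finite Q] [Finite A] [Finite W] [Finite B] : Finite (Action Q A W B) :=
  have : Finite Move := Finite.of_injective (β := Fin 3)
    (fun | .stay => 0 | .fwd => 1 | .bwd => 2) (by rintro (_ | _ | _) (_ | _ | _) h <;> simp_all)
  Finite.of_injective (β := Q × WorkSym A W × Option B × Move × Move × Move)
    (fun a => (a.next, a.write, a.emit, a.workMove, a.auxMove, a.proofMove)) (by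
      rintro ⟨⟩ ⟨⟩ h; simp_all)

variable {A : Type}

/-- The symbols on the work tape, the auxiliary tape and the proof tape in cells at the same
distance from the heads. -/
abbrev Tri (M : Verifier A) : Type := WorkSym A M.W × AuxSym × Option Bool

/-- A summary of the output tape: `none` if it is empty, and its symbol if it has only one. -/
def outSummary : List Bool → Option (Option Bool)
  | [] => none
  | [b] => some (some b)
  | _ => some none

/-- The summary after a further symbol (if any) has been output. -/
def pushOut : Option (Option Bool) → Option Bool → Option (Option Bool)
  | o, none => o
  | none, some b => some (some b)
  | some _, some _ => some none

theorem outSummary_append (l : List Bool) (e : Option Bool) :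
    outSummary (l ++ e.toList) = pushOut (outSummary l) e := by
  match l, e with
  | l, none => cases h : outSummary l <;> simp [pushOut, h]
  | [], some b => rfl
  | [_], some b => rfl
  | _ :: _ :: _, some b => rfl

theorem outSummary_eq_iff {l : List Bool} {b : Bool} : outSummary l = some (some b) ↔ l = [b] := by
  match l with
  | [] => simp [outSummary]
  | [_] => simp [outSummary]
  | _ :: _ :: _ => simp [outSummary]

/-- The values of a block of variables. A configuration is represented by one block for the
control, with the symbols at the heads, the action that is to be performed next (if it has been
chosen already) and a summary of the output tape, and, for each `j > 0`, one block for the cells at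
distance `j` to the left and to the right of the heads. The blocks `cell` hold the input. -/
inductive Blk (M : Verifier A) : Type
  | ctl (q : M.Q) (h : Tri M) (pend : Option (Action M.Q A M.W Bool)) (out : Option (Option Bool))
  | grp (l r : Tri M)
  | cell (s : WorkSym A Empty) (a : AuxSym)
  | dum

instance [Finite A] (M : Verifier A) : Finite (Blk M) :=
  have := M.finQ
  have := M.finW
  Finite.of_injective (β := (M.Q × Tri M × Option (Action M.Q A M.W Bool) × Option (Option Bool)) ⊕
      (Tri M × Tri M) ⊕ (WorkSym A Empty × AuxSym) ⊕ Unit)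
    (fun | .ctl q h p o => .inl (q, h, p, o) | .grp l r => .inr (.inl (l, r))
         | .cell s a => .inr (.inr (.inl (s, a))) | .dum => .inr (.inr (.inr ()))) (by
      rintro (_ | _ | _ | _) (_ | _ | _ | _) h <;> simp_all)

namespace Blk

section Coding

variable [Finite A] (M : Verifier A)

/-- The number of variables in a block. -/
def width : ℕ := (exists_coding (Blk M)).choose

variable {M}

/-- The values of the variables in a block. -/
def enc : Blk M → List Bool := (exists_coding (Blk M)).choose_spec.choose

theorem length_enc (b : Blk M) : b.enc.length = width M :=
  (exists_coding (Blk M)).choose_spec.choose_spec.1 b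

theorem enc_injective : Function.Injective (enc (M := M)) :=
  (exists_coding (Blk M)).choose_spec.choose_spec.2

instance : Nonempty (Blk M) := ⟨.dum⟩

/-- The value of the block number `i` in `v`. -/
def nth (v : List Bool) (i : ℕ) : Blk M :=
  Function.invFun enc ((v.drop (i * width M)).take (width M))

theorem nth_zero (b : Blk M) (v : List Bool) : nth (b.enc ++ v) 0 = b := by
  rw [nth, Nat.zero_mul, List.drop_zero, ← length_enc b, List.take_left]
  exact Function.leftInverse_invFun enc_injective b

theorem nth_succ (b : Blk M) (v : List Bool) (i : ℕ) :
    (nth (b.enc ++ v) (i + 1) : Blk M) = nth v i := by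
  rw [nth, nth, Nat.succ_mul, Nat.add_comm, ← List.drop_drop]
  rw [show List.drop (width M) (b.enc ++ v) = v by rw [← length_enc b, List.drop_left]]

end Coding

variable {M : Verifier A}

/-- The symbols in a block on the left of the heads; in a control block, those at the heads after
the work symbol has been written. -/
def lft : Blk M → Tri M
  | .grp l _ => l
  | .ctl _ h (some a) _ => (a.write, h.2)
  | _ => (.blank, .blank, none)

/-- The symbols in a block on the right of the heads; in a control block, those at the heads after
the work symbol has been written. -/
def rgt : Blk M → Tri M
  | .grp _ r => r
  | .ctl _ h (some a) _ => (a.write, h.2)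
  | _ => (.blank, .blank, none)

end Blk

/-- The choice according to a head movement. -/
def Move.pick {X : Type} : Move → X → X → X → X
  | .bwd, x, _, _ => x
  | .stay, _, x, _ => x
  | .fwd, _, _, x => x

theorem Move.pick_eq {X : Type} (m : Move) (f : ℤ → X) (i : ℤ) :
    m.pick (f (i - 1)) (f i) (f (i + 1)) = f (i + m.shift) := by
  cases m <;> simp [pick, shift, sub_eq_add_neg]

/-- The choice according to the head movements of an action, on each tape. -/
def Action.pick {M : Verifier A} (a : Action M.Q A M.W Bool) (x y z : Tri M) : Tri M :=
  (a.workMove.pick x.1 y.1 z.1, a.auxMove.pick x.2.1 y.2.1 z.2.1,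
    a.proofMove.pick x.2.2 y.2.2 z.2.2)

section Steps

variable {M : Verifier A}

/-- Input symbols as work symbols of a machine. -/
def liftSym {A W : Type} : WorkSym A Empty → WorkSym A W
  | .blank => .blank
  | .left => .left
  | .right => .right
  | .inp a => .inp a

/-- The initial value of a block, given by a cell of the input and a cell of the proof tape. -/
def initBlk : Blk M → List Bool → Blk M
  | .cell .left a, [p, b] => .ctl M.start (.left, a, if p then some b else none) none none
  | .cell s a, [p, b] => .grp (.blank, .blank, none) (liftSym s, a, if p then some b else none)
  | _, _ => .dum

open Classical in
/-- The degrees of the possible next values of the control block `c`, where `g` is the next block: an action is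
chosen, or the chosen action is performed. Halted configurations do not change. -/
def ctlStep (c g c' : Blk M) : Deg :=
  match c with
  | .ctl q h none o =>
    if q ∈ M.halting then if c' = c then 1 else 0
    else ⨆ (a : Action M.Q A M.W Bool) (_ : c' = .ctl q h (some a) o), M.δ q h.1 h.2.1 h.2.2 a
  | .ctl _ _ (some a) o =>
    if c' = .ctl a.next (a.pick g.lft c.lft g.rgt) none (pushOut o a.emit) then 1 else 0
  | _ => 0

/-- The next value of the block `m` between `l` and `r`, when the control block is `c`. -/
def grpStep (c l m r : Blk M) : Blk M :=
  match c with
  | .ctl _ _ (some a) _ => .grp (a.pick r.lft m.lft l.lft) (a.pick l.rgt m.rgt r.rgt)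
  | _ => m

end Steps

section Circuit

variable [Finite A] (M : Verifier A)

open Blk

/-- The labels of the variables in the block number `j`. -/
def labels (j : ℕ) : List ℕ := List.range' (j * width M) (width M)

/-- The gate for the block `j` at the first level, if the proof variables begin at `w`. -/
def initGate (w j : ℕ) : Gate Deg :=
  crispGate (labels M j ++ List.range' (w + j * 2) 2) (width M)
    fun v => (initBlk (nth v 0 : Blk M) (v.drop (width M))).enc

/-- The gate for the blocks beyond the simulated cells, so that all gates have neighbours to read. -/
def dumGate : Gate Deg := crispGate [] (width M) fun _ => (Blk.dum : Blk M).enc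

/-- The gate for the control block, the only fuzzy gate of a main level. -/
def ctlGate : Gate Deg where
  ins := labels M 0 ++ labels M 1
  outs := width M
  tab v w := ⨆ (c' : Blk M) (_ : w = c'.enc), ctlStep (nth v 0) (nth v 1) c'

/-- The gate for the block `j + 1` at the main levels. -/
def grpGate (j : ℕ) : Gate Deg :=
  crispGate (labels M 0 ++ labels M j ++ labels M (j + 1) ++ labels M (j + 2)) (width M)
    fun v => (grpStep (nth v 0 : Blk M) (nth v 1) (nth v 2) (nth v 3)).enc

open Classical in
/-- The gate that reads the output off the control block of a halted configuration. -/
def finalGate : Gate Deg where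
  ins := labels M 0
  outs := 1
  tab v w := if ∃ q h b, (nth v 0 : Blk M) = .ctl q h none (some (some b)) ∧ q ∈ M.halting ∧
    w = [b] then 1 else 0

/-- The level that builds the blocks for the initial configuration. -/
def initLevel (w m : ℕ) : List (Gate Deg) :=
  (List.range m).map (initGate M w) ++ [dumGate M, dumGate M]

/-- The level that chooses an action or performs the chosen one. -/
def mainLevel (m : ℕ) : List (Gate Deg) :=
  ctlGate M :: ((List.range m).map (grpGate M) ++ [dumGate M])

/-- The circuit with `m` main levels that simulates `M` for `m / 2` steps, on inputs whose auxiliary string has length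
`n`. -/
def simCircuit (n m : ℕ) : Circuit Deg where
  consts := (n + 2 + m) * width M
  cells := m
  levels := initLevel M ((n + 2 + m) * width M) m ::
    (List.replicate m (mainLevel M m) ++ [[finalGate M]])

/-- The contents of the first cells of the work tape and the auxiliary tape, as a constant for the
circuit. The cells at a distance of more than `n + 1` from the start are blank; `m` of them are
provided, so that there are enough cells for all blocks however `m` and `n` compare. -/
def simConst (n m : ℕ) (x : List A) : List Bool :=
  (List.range (n + 2)).flatMap (fun j : ℕ => (Blk.cell (FuzzyMachine.inputTape x (j : ℤ))
    (FuzzyMachine.auxTape n (j : ℤ)) : Blk M).enc) ++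
  (List.range m).flatMap fun _ => (Blk.cell .blank .blank : Blk M).enc

variable {M}

/-- The values of `m` blocks. -/
def flat (m : ℕ) (bs : ℕ → Blk M) : List Bool := (List.range m).flatMap fun j => (bs j).enc

theorem map_getD_labels {m j : ℕ} (hj : j < m) (bs : ℕ → Blk M) (v : List Bool) :
    (labels M j).map (fun i => (flat m bs ++ v).getD i false) = (bs j).enc := by
  have := map_getD_flatMap_range (g := fun j => (bs j).enc) (fun i => length_enc (bs i)) hj [] v
  rwa [List.length_nil, Nat.zero_add, List.nil_append] at this

theorem map_getD_labels' {m j : ℕ} (hj : j < m) (bs : ℕ → Blk M) :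
    (labels M j).map (fun i => (flat m bs).getD i false) = (bs j).enc := by
  have := map_getD_labels hj bs []
  rwa [List.append_nil] at this

/-- The values of the blocks after the next main level, if the next control block is `c`. -/
def nextBlks (m : ℕ) (bs : ℕ → Blk M) (c : Blk M) : ℕ → Blk M
  | 0 => c
  | j + 1 => if j < m then grpStep (bs 0) (bs j) (bs (j + 1)) (bs (j + 2)) else .dum

/-- A main level chooses the value of the control block; all other blocks are determined. -/
theorem circVal_mainLevel (m : ℕ) (ls : List (List (Gate Deg))) (bs : ℕ → Blk M) (w : List Bool) :
    circVal (mainLevel M m :: ls) (flat (m + 2) bs) w =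
      ⨆ c, ctlStep (bs 0) (bs 1) c ⊓ circVal ls (flat (m + 2) (nextBlks m bs c)) w := by
  rw [circVal_cons, mainLevel, levelVal]
  have h1 : ∀ κ, levelVal ((List.range m).map (grpGate M) ++ [dumGate M]) (flat (m + 2) bs) κ =
      κ ((List.range m).flatMap (fun j => (grpStep (bs 0) (bs j) (bs (j + 1)) (bs (j + 2))).enc) ++
        (Blk.dum : Blk M).enc) := by
    intro κ
    unfold grpGate
    rw [levelVal_map_crispGate (g := fun j =>
      (grpStep (bs 0) (bs j) (bs (j + 1)) (bs (j + 2))).enc), dumGate, levelVal_crispGate, levelVal,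
      List.append_nil]
    · exact length_enc _
    · intro j hj
      rw [List.mem_range] at hj
      simp only [List.map_append]
      rw [map_getD_labels' (by omega), map_getD_labels' (by omega), map_getD_labels' (by omega),
        map_getD_labels' (by omega)]
      simp only [List.append_assoc, nth_zero, nth_succ]
      have := nth_zero (bs (j + 2)) []
      rw [List.append_nil] at this
      rw [this]
    · exact fun j => length_enc _
  have h2 : (ctlGate M).ins.map (fun i => (flat (m + 2) bs).getD i false) =
      (bs 0).enc ++ (bs 1).enc := by
    rw [ctlGate, List.map_append, map_getD_labels' (by omega), map_getD_labels' (by omega)]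
  have h3 : ∀ c, c.enc ++ ((List.range m).flatMap
      (fun j => (grpStep (bs 0) (bs j) (bs (j + 1)) (bs (j + 2))).enc) ++ (Blk.dum : Blk M).enc) =
      flat (m + 2) (nextBlks m bs c) := by
    intro c
    rw [flat, List.range_succ_eq_map, List.flatMap_cons, List.range_succ, List.map_append,
      List.flatMap_append, List.flatMap_map]
    simp only [nextBlks, List.map_cons, List.map_nil, List.flatMap_cons, List.flatMap_nil,
      List.append_nil, Nat.succ_eq_add_one, lt_self_iff_false, if_false]
    congr 2
    refine List.flatMap_congr fun j hj => ?_
    rw [if_pos (List.mem_range.1 hj)]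
  simp only [h1, h2]
  simp only [ctlGate, iSup_inf_eq]
  have h4 : (nth ((bs 0).enc ++ (bs 1).enc) 1 : Blk M) = bs 1 := by
    rw [nth_succ]
    have := nth_zero (bs 1) []
    rwa [List.append_nil] at this
  simp only [h4, nth_zero]
  apply le_antisymm
  · refine iSup₂_le fun u _ => iSup₂_le fun c hc => ?_
    subst hc
    exact le_iSup_of_le c (by rw [h3])
  · refine iSup_le fun c => le_iSup₂_of_le c.enc (length_enc c) (le_iSup₂_of_le c rfl ?_)
    rw [h3]

open Classical in
theorem circVal_final (m : ℕ) (bs : ℕ → Blk M) (b : Bool) :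
    circVal [[finalGate M]] (flat (m + 2) bs) [b] =
      if ∃ q h, bs 0 = .ctl q h none (some (some b)) ∧ q ∈ M.halting then 1 else 0 := by
  have h1 : (nth ((bs 0).enc) 0 : Blk M) = bs 0 := by
    have := nth_zero (bs 0) []
    rwa [List.append_nil] at this
  rw [circVal_cons]
  simp only [levelVal, finalGate, circVal, map_getD_labels' (show 0 < m + 2 by omega), h1,
    List.append_nil]
  apply le_antisymm
  · refine iSup₂_le fun w _ => ?_
    by_cases hw : w = [b]
    · subst hw
      refine inf_le_left.trans ?_
      split_ifs with h2 h3 h3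
      · exact le_rfl
      · obtain ⟨q, h, b', h2, h4, h5⟩ := h2
        obtain rfl : b = b' := by simpa using h5
        exact absurd ⟨q, h, h2, h4⟩ h3
      · exact bot_le
      · exact le_rfl
    · rw [if_neg hw]
      exact inf_le_right.trans bot_le
  · refine le_iSup₂_of_le [b] rfl ?_
    rw [if_pos rfl]
    split_ifs with h2 h3 h3
    · exact le_min le_rfl le_rfl
    · obtain ⟨q, h, h2, h4⟩ := h2
      exact absurd ⟨q, h, b, h2, h4, rfl⟩ h3
    · exact bot_le
    · exact bot_le

end Circuit

section Simulation

variable [Finite A] {M : Verifier A}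

open Blk FuzzyMachine

/-- The symbols in the cells at distance `i` from the heads. -/
def tri (n : ℕ) (c : M.Cfg) (i : ℤ) : Tri M :=
  (c.work (c.workHead + i), auxTape n (c.auxHead + i), proofTape c.proof (c.proofHead + i))

/-- The first `R` blocks represent the configuration `c` with the chosen action `pend`. -/
structure Agree (n : ℕ) (c : M.Cfg) (pend : Option (Action M.Q A M.W Bool)) (R : ℕ)
    (bs : ℕ → Blk M) : Prop where
  zero : bs 0 = .ctl c.state (tri n c 0) pend (outSummary c.out)
  pos : ∀ j, 0 < j → j < R → bs j = .grp (tri n c (-(j : ℤ))) (tri n c j)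

variable {n m R : ℕ} {c : M.Cfg} {bs : ℕ → Blk M}

omit [Finite A] in
theorem Agree.choose {a : Action M.Q A M.W Bool} (h : Agree n c none R bs) (hR : R ≤ m + 1) :
    Agree n c (some a) R
      (nextBlks m bs (.ctl c.state (tri n c 0) (some a) (outSummary c.out))) := by
  refine ⟨rfl, fun j hj hjR => ?_⟩
  obtain ⟨j, rfl⟩ : ∃ i, j = i + 1 := ⟨j - 1, by omega⟩
  rw [nextBlks, if_pos (by omega), h.zero]
  exact h.pos _ hj hjR

omit [Finite A] in
theorem Agree.idle (h : Agree n c none R bs) (hR : R ≤ m + 1) :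
    Agree n c none R (nextBlks m bs (bs 0)) := by
  refine ⟨h.zero, fun j hj hjR => ?_⟩
  obtain ⟨j, rfl⟩ : ∃ i, j = i + 1 := ⟨j - 1, by omega⟩
  rw [nextBlks, if_pos (by omega), h.zero]
  exact h.pos _ hj hjR

omit [Finite A] in
/-- Performing an action: the view from the heads moves, so that the outermost block is lost. -/
theorem Agree.perform {a : Action M.Q A M.W Bool} (h : Agree n c (some a) (R + 1) bs)
    (hR : R ≤ m) (hR' : 1 ≤ R) :
    Agree n (c.apply a) none R
      (nextBlks m bs (.ctl a.next (a.pick (bs 1).lft (bs 0).lft (bs 1).rgt) none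
        (pushOut (outSummary c.out) a.emit))) := by
  -- the tapes after the symbol has been written and before the heads move
  let g : ℤ → Tri M := fun i => (Function.update c.work c.workHead a.write (c.workHead + i),
    auxTape n (c.auxHead + i), proofTape c.proof (c.proofHead + i))
  have key : ∀ i : ℤ, a.pick (g (i - 1)) (g i) (g (i + 1)) = tri n (c.apply a) i := by
    intro i
    have h1 := a.workMove.pick_eq (fun i => (g i).1) i
    have h2 := a.auxMove.pick_eq (fun i => (g i).2.1) i
    have h3 := a.proofMove.pick_eq (fun i => (g i).2.2) i
    rw [Action.pick, h1, h2, h3]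
    simp only [tri, Cfg.apply, g, add_comm i, add_assoc]
  have hl : ∀ j : ℕ, j < R + 1 → (bs j).lft = g (-(j : ℤ)) ∧ (bs j).rgt = g j := by
    intro j hj
    rcases Nat.eq_zero_or_pos j with rfl | hj'
    · simp [h.zero, lft, rgt, tri, g]
    · rw [h.pos j hj' hj]
      have h1 : ∀ i : ℤ, i ≠ 0 → c.workHead + i ≠ c.workHead := by intro i hi; omega
      simp [lft, rgt, tri, g, Function.update_of_ne, h1, hj'.ne']
  refine ⟨?_, fun j hj hjR => ?_⟩
  · have := key 0
    rw [nextBlks, (hl 1 (by omega)).1, (hl 1 (by omega)).2, (hl 0 (by omega)).1, Cfg.apply,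
      outSummary_append]
    simp only [Nat.cast_zero, neg_zero, Nat.cast_one]
    rw [zero_sub, zero_add] at this
    rw [this]
    rfl
  · obtain ⟨j, rfl⟩ : ∃ i, j = i + 1 := ⟨j - 1, by omega⟩
    rw [nextBlks, if_pos (by omega), h.zero, grpStep, (hl j (by omega)).1, (hl j (by omega)).2,
      (hl (j + 1) (by omega)).1, (hl (j + 1) (by omega)).2, (hl (j + 2) (by omega)).1,
      (hl (j + 2) (by omega)).2]
    have h1 := key (-((j + 1 : ℕ) : ℤ))
    have h2 := key ((j + 1 : ℕ) : ℤ)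
    rw [← h1, ← h2]
    congr 3 <;> push_cast <;> ring

open Classical in
theorem circVal_halting (k : ℕ) (b : Bool) (hc : c.state ∈ M.halting) (h : Agree n c none R bs)
    (hR : R ≤ m + 1) :
    circVal (List.replicate k (mainLevel M m) ++ [[finalGate M]]) (flat (m + 2) bs) [b] =
      M.value n c [b] := by
  induction k generalizing bs with
  | zero =>
    rw [List.replicate_zero, List.nil_append, circVal_final, value_of_halting hc, h.zero]
    by_cases hb : c.out = [b]
    · rw [if_pos hb, if_pos ⟨_, _, by rw [outSummary_eq_iff.2 hb], hc⟩]
    · rw [if_neg hb, if_neg]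
      rintro ⟨q, h', h1, _⟩
      rw [ctl.injEq, outSummary_eq_iff] at h1
      exact hb h1.2.2.2
  | succ k ih =>
    rw [List.replicate_succ, List.cons_append, circVal_mainLevel]
    have : ∀ b', ctlStep (bs 0) (bs 1) b' = if b' = bs 0 then 1 else 0 := by
      intro b'
      rw [h.zero, ctlStep, if_pos hc]
    simp only [this]
    rw [iSup_ite_inf]
    exact ih (h.idle hR)

/-- The main levels simulate `M`. Each step takes two levels and costs one block. -/
theorem circVal_replicate_mainLevel (t k : ℕ) (b : Bool) (hs : M.StopsIn n c t) (hk : 2 * t ≤ k)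
    (h : Agree n c none R bs) (ht : t + 2 ≤ R) (hR : R ≤ m + 1) :
    circVal (List.replicate k (mainLevel M m) ++ [[finalGate M]]) (flat (m + 2) bs) [b] =
      M.value n c [b] := by
  classical
  induction t generalizing k c bs R with
  | zero =>
    by_cases hc : c.state ∈ M.halting
    · exact circVal_halting k b hc h hR
    have h0 : M.value n c [b] = 0 := by
      rw [value_of_not_halting hc]
      refine iSup_eq_bot.2 fun a => ?_
      rw [hs.degree_eq_zero hc]
      exact bot_inf_eq _
    rw [h0]
    cases k with
    | zero =>
      rw [List.replicate_zero, List.nil_append, circVal_final, h.zero, if_neg]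
      rintro ⟨q, h, h1, h2⟩
      rw [ctl.injEq] at h1
      exact hc (h1.1 ▸ h2)
    | succ k =>
      rw [List.replicate_succ, List.cons_append, circVal_mainLevel]
      refine iSup_eq_bot.2 fun c' => ?_
      rw [h.zero, ctlStep, if_neg hc]
      have : ⨆ (a : Action M.Q A M.W Bool)
          (_ : c' = .ctl c.state (tri n c 0) (some a) (outSummary c.out)),
          M.δ c.state (tri n c 0).1 (tri n c 0).2.1 (tri n c 0).2.2 a = ⊥ := by
        refine iSup₂_eq_bot.2 fun a _ => ?_
        have := hs.degree_eq_zero hc a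
        rw [show (⊥ : Deg) = 0 from rfl]
        simpa [tri, Cfg.degree] using this
      rw [this]
      exact bot_inf_eq _
  | succ t ih =>
    by_cases hc : c.state ∈ M.halting
    · exact circVal_halting k b hc h hR
    obtain ⟨k, rfl⟩ : ∃ k', k = k' + 2 := ⟨k - 2, by omega⟩
    obtain ⟨R, rfl⟩ : ∃ R', R = R' + 1 := ⟨R - 1, by omega⟩
    rw [List.replicate_succ, List.cons_append, circVal_mainLevel, value_of_not_halting hc]
    have h1 : ∀ c', ctlStep (bs 0) (bs 1) c' = ⨆ (a : Action M.Q A M.W Bool)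
        (_ : c' = .ctl c.state (tri n c 0) (some a) (outSummary c.out)), c.degree n a := by
      intro c'
      rw [h.zero, ctlStep, if_neg hc]
      simp [tri, Cfg.degree]
    simp only [h1, iSup_inf_eq]
    rw [iSup_comm]
    refine iSup_congr fun a => ?_
    rw [iSup_iSup_eq_left]
    by_cases ha : c.degree n a = 0
    · rw [ha]
      exact (bot_inf_eq _).trans (bot_inf_eq _).symm
    congr 1
    have h2 := h.choose (a := a) hR
    have h3 := h2.perform (m := m) (by omega) (by omega)
    rw [List.replicate_succ, List.cons_append, circVal_mainLevel]
    rw [← ih (k := k) (R := R) (hs.apply hc ha) (by omega) h3 (by omega) (by omega)]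
    have h4 : ∀ c', ctlStep (nextBlks m bs (.ctl c.state (tri n c 0) (some a) (outSummary c.out)) 0)
        (nextBlks m bs (.ctl c.state (tri n c 0) (some a) (outSummary c.out)) 1) c' =
        if c' = _ then 1 else 0 := fun c' => rfl
    simp only [h4]
    rw [iSup_ite_inf]

end Simulation

end FuzzyComputation

namespace FuzzyComputation

/-! ### The simulating circuit -/

open Blk FuzzyMachine

variable {A : Type}

theorem liftSym_inputTape {W : Type} (x : List A) (i : ℤ) :
    liftSym (inputTape x i : WorkSym A Empty) = (inputTape x i : WorkSym A W) := by
  match i with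
  | .ofNat 0 => rfl
  | .ofNat (j + 1) => simp only [inputTape]; split_ifs <;> rfl
  | .negSucc _ => rfl

theorem inputTape_of_lt {W : Type} {x : List A} {n j : ℕ} (hx : x.length ≤ n) (hj : n + 2 ≤ j) :
    (inputTape x (j : ℤ) : WorkSym A W) = .blank := by
  obtain ⟨j, rfl⟩ : ∃ i, j = i + 1 := ⟨j - 1, by omega⟩
  rw [inputTape_succ, dif_neg (by omega), if_neg (by omega)]

theorem auxTape_of_lt {n j : ℕ} (hj : n + 2 ≤ j) : auxTape n (j : ℤ) = .blank := by
  obtain ⟨j, rfl⟩ : ∃ i, j = i + 1 := ⟨j - 1, by omega⟩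
  change (if j < n then AuxSym.one else if j = n then .right else .blank) = _
  rw [if_neg (by omega), if_neg (by omega)]

section Init

variable [Finite A] {M : Verifier A} {n m : ℕ} {x : List A}

theorem simConst_eq (hx : x.length ≤ n) : simConst M n m x =
    flat (n + 2 + m) (fun j : ℕ => (.cell (inputTape x (j : ℤ)) (auxTape n (j : ℤ)) : Blk M)) := by
  rw [simConst, flat, show List.range (n + 2 + m) =
    List.range (n + 2) ++ (List.range m).map (n + 2 + ·) from List.range_add .., List.flatMap_append, List.flatMap_map]
  congr 1
  refine List.flatMap_congr fun j _ => ?_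
  rw [inputTape_of_lt hx (by omega), auxTape_of_lt (by omega)]

theorem length_simConst (x : List A) : (simConst M n m x).length = (n + 2 + m) * width M := by
  rw [simConst, List.length_append, length_flatMap_range fun j => length_enc _,
    length_flatMap_range fun j => length_enc _]
  ring

/-- The values of the blocks after the first level. -/
def startBlks (M : Verifier A) (n m : ℕ) (x : List A) (y : List Bool) (j : ℕ) : Blk M :=
  if j < m then initBlk (.cell (inputTape x (j : ℤ)) (auxTape n (j : ℤ)))
    [y[j]?.isSome, y[j]?.getD false] else .dum

theorem circVal_initLevel (hx : x.length ≤ n) (y : List Bool) (ls : List (List (Gate Deg)))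
    (w : List Bool) :
    circVal (initLevel M ((n + 2 + m) * width M) m :: ls) (simConst M n m x ++ window m y) w =
      circVal ls (flat (m + 2) (startBlks M n m x y)) w := by
  rw [circVal_cons, initLevel]
  unfold initGate
  rw [levelVal_map_crispGate (g := fun j => (startBlks M n m x y j).enc), dumGate,
    levelVal_crispGate, levelVal_crispGate, levelVal]
  · congr 1
    rw [flat, List.range_succ, List.range_succ]
    simp [startBlks]
  · exact length_enc _
  · exact length_enc _
  · intro j hj
    rw [List.mem_range] at hj
    rw [List.map_append]
    have h1 : (List.range' ((n + 2 + m) * width M + j * 2) 2).map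
        (fun i => (simConst M n m x ++ window m y).getD i false) =
        [y[j]?.isSome, y[j]?.getD false] := by
      have := map_getD_flatMap_range (g := fun i => [y[i]?.isSome, y[i]?.getD false]) (B := 2)
        (fun i => rfl) hj (simConst M n m x) []
      rw [length_simConst, List.append_nil, ← window_eq] at this
      exact this
    rw [h1, simConst_eq hx, map_getD_labels (by omega), nth_zero, startBlks, if_pos hj]
    congr 2
    rw [← length_enc (.cell (inputTape x (j : ℤ)) (auxTape n (j : ℤ)) : Blk M), List.drop_left]
  · exact fun j => length_enc _

omit [Finite A] in
theorem agree_startBlks (hm : 0 < m) (y : List Bool) :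
    Agree n (M.init x y) none m (startBlks M n m x y) := by
  have hp : ∀ j : ℕ, (if y[j]?.isSome then some (y[j]?.getD false) else none) =
      proofTape y (j : ℤ) := by
    intro j
    change _ = y[j]?
    cases y[j]? <;> rfl
  constructor
  · rw [startBlks, if_pos hm]
    change Blk.ctl M.start (.left, .left, if y[0]?.isSome then some (y[0]?.getD false) else none)
      none none = _
    rw [hp 0]
    rfl
  · intro j hj hjm
    obtain ⟨j, rfl⟩ : ∃ i, j = i + 1 := ⟨j - 1, by omega⟩
    have h1 : ∀ (s : WorkSym A Empty) (a : AuxSym) (p b : Bool), s ≠ .left →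
        (initBlk (.cell s a) [p, b] : Blk M) =
          .grp (.blank, .blank, none) (liftSym s, a, if p then some b else none) := by
      intro s a p b hs
      cases s <;> first | rfl | exact absurd rfl hs
    rw [startBlks, if_pos hjm, h1, hp, liftSym_inputTape]
    · simp only [tri, init, zero_add]
      rfl
    · rw [inputTape_succ]
      split_ifs <;> simp

/-- The circuit computes the output of the machine. -/
theorem circVal_simCircuit {t : ℕ} (hx : x.length ≤ n) {y : List Bool}
    (hs : M.StopsIn n (M.init x y) t) (hm : 2 * t + 2 ≤ m) (b : Bool) :
    circVal (simCircuit M n m).levels (simConst M n m x ++ window (simCircuit M n m).cells y) [b] =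
      M.value n (M.init x y) [b] := by
  rw [simCircuit, circVal_initLevel hx]
  exact circVal_replicate_mainLevel t m b hs (by omega) (agree_startBlks (by omega) y) (by omega)
    (by omega)

end Init

section WellFormed

variable [Finite A] {M : Verifier A} {n m : ℕ}

theorem lt_of_mem_labels {i j k : ℕ} (h : i ∈ labels M j) (hj : j < k) : i < k * width M := by
  rw [labels, List.mem_range'_1] at h
  calc i < (j + 1) * width M := by rw [Nat.succ_mul]; exact h.2
    _ ≤ k * width M := Nat.mul_le_mul_right _ hj

theorem simCircuit_wellFormed : (simCircuit M n m).WellFormed := by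
  have h1 : ∀ k, WellFormedLevels ((m + 2) * width M)
      (List.replicate k (mainLevel M m) ++ [[finalGate M]]) := by
    intro k
    induction k with
    | zero =>
      refine ⟨by simp, ?_, rfl⟩
      intro G hG i hi
      rw [List.mem_singleton] at hG
      subst hG
      exact lt_of_mem_labels hi (by omega)
    | succ k ih =>
      refine ⟨by simp [mainLevel], ?_, ?_⟩
      · intro G hG i hi
        rw [mainLevel, List.mem_cons, List.mem_append, List.mem_map, List.mem_singleton] at hG
        rcases hG with rfl | ⟨j, hj, rfl⟩ | rfl
        · rw [ctlGate, List.mem_append] at hi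
          rcases hi with hi | hi
          · exact lt_of_mem_labels hi (by omega)
          · exact lt_of_mem_labels hi (by omega)
        · rw [List.mem_range] at hj
          rw [grpGate, crispGate, List.mem_append, List.mem_append, List.mem_append] at hi
          rcases hi with ((hi | hi) | hi) | hi
          all_goals exact lt_of_mem_labels hi (by omega)
        · simp [dumGate, crispGate] at hi
      · have : ((mainLevel M m).map Gate.outs).sum = (m + 2) * width M := by
          simp [mainLevel, ctlGate, grpGate, crispGate, dumGate, Function.comp_def]
          ring
        rw [this]
        exact ih
  refine ⟨by simp [initLevel], ?_, ?_⟩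
  · intro G hG i hi
    rw [initLevel, List.mem_append, List.mem_map] at hG
    simp only [simCircuit]
    rcases hG with ⟨j, hj, rfl⟩ | hG
    · rw [List.mem_range] at hj
      rw [initGate, crispGate, List.mem_append, List.mem_range'_1] at hi
      rcases hi with hi | hi
      · have := lt_of_mem_labels hi (show j < n + 2 + m by omega)
        omega
      · omega
    · simp only [List.mem_cons, List.not_mem_nil, or_false, or_self] at hG
      subst hG
      simp [dumGate, crispGate] at hi
  · have : ((initLevel M ((n + 2 + m) * width M) m).map Gate.outs).sum = (m + 2) * width M := by
      simp [initLevel, initGate, crispGate, dumGate, Function.comp_def]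
      ring
    rw [this]
    exact h1 m

/-- The degrees of the entries of the gates of the circuits for `M`. -/
def simDegrees (M : Verifier A) : Set Deg :=
  insert 1 (insert 0 (Set.range fun p : Blk M × Blk M × Blk M => ctlStep p.1 p.2.1 p.2.2))

theorem simDegrees_finite : (simDegrees M).Finite :=
  ((Set.finite_range _).insert _).insert _

theorem simCircuit_degreesIn : (simCircuit M n m).DegreesIn (simDegrees M) := by
  have h0 : ∀ ins outs f v w, (crispGate ins outs f).tab v w ∈ simDegrees M := by
    intro ins outs f v w
    rw [crispGate]
    simp only
    split_ifs
    · exact .inl rfl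
    · exact .inr (.inl rfl)
  refine ⟨.inl rfl, ?_⟩
  intro l hl G hG v w _ _
  simp only [simCircuit, List.mem_cons, List.mem_append, List.mem_replicate, List.not_mem_nil,
    or_false] at hl
  rcases hl with rfl | ⟨_, rfl⟩ | rfl
  · simp only [initLevel, List.mem_append, List.mem_map, List.mem_cons, List.not_mem_nil, or_false,
      or_self] at hG
    rcases hG with ⟨j, _, rfl⟩ | rfl <;> exact h0 ..
  · simp only [mainLevel, List.mem_append, List.mem_map, List.mem_cons, List.not_mem_nil,
      or_false] at hG
    rcases hG with rfl | ⟨j, _, rfl⟩ | rfl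
    · by_cases hw : ∃ c : Blk M, w = c.enc
      · obtain ⟨c, rfl⟩ := hw
        refine .inr (.inr ⟨(nth v 0, nth v 1, c), ?_⟩)
        rw [ctlGate]
        apply le_antisymm
        · exact le_iSup₂_of_le c rfl le_rfl
        · refine iSup₂_le fun c' hc => ?_
          rw [enc_injective hc]
      · refine .inr (.inl ?_)
        refine iSup₂_eq_bot.2 fun c hc => absurd ⟨c, hc⟩ hw
    · exact h0 ..
    · exact h0 ..
  · rw [List.mem_singleton] at hG
    subst hG
    rw [finalGate]
    simp only
    split_ifs
    · exact .inl rfl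
    · exact .inr (.inl rfl)

end WellFormed

/-- The fuzzy constant of the circuit that simulates `M` on `s`. -/
def simFuzzyConst [Finite A] (M : Verifier A) (n m : ℕ) (s : FuzzySet (List A)) :
    FuzzySet (List Bool) := fun z => ⨆ (x : List A) (_ : z = simConst M n m x), s x

theorem simFuzzyConst_isFuzzyString [Finite A] {M : Verifier A} {n m : ℕ} {s : FuzzySet (List A)}
    (hs : IsFuzzyString s) : IsFuzzyString (simFuzzyConst M n m s) := by
  obtain ⟨hs, x₀, hx₀⟩ := hs
  have : Finite (supp s) := hs
  have h1 : s x₀ = 1 := by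
    have : x₀ ∈ core s := by rw [hx₀]; rfl
    exact this
  have key : ∀ z, simFuzzyConst M n m s z =
      ⨆ x : supp s, ⨆ (_ : z = simConst M n m x), s x := by
    intro z
    apply le_antisymm
    · refine iSup₂_le fun x hx => ?_
      by_cases h : s x = 0
      · rw [h]; exact bot_le
      · exact le_iSup₂_of_le ⟨x, h⟩ hx le_rfl
    · exact iSup₂_le fun x hx => le_iSup₂_of_le x.1 hx le_rfl
  constructor
  · refine (hs.image (simConst M n m)).subset fun z hz => ?_
    by_contra hc
    refine hz ?_
    rw [key]
    exact iSup₂_eq_bot.2 fun x hx => absurd ⟨x.1, x.2, hx.symm⟩ hc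
  · refine ⟨simConst M n m x₀, Set.ext fun z => ⟨fun hz => ?_, ?_⟩⟩
    · have hz' : simFuzzyConst M n m s z = 1 := hz
      rw [key] at hz'
      obtain ⟨⟨x, hx⟩, h⟩ := iSup_eq_one_of_finite hz'
      by_cases h2 : z = simConst M n m x
      · rw [iSup_pos h2] at h
        have h3 : x ∈ core s := h
        rw [hx₀] at h3
        rw [h2, h3]
        rfl
      · rw [iSup_neg h2] at h
        exact absurd h (show (0 : Deg) ≠ 1 from zero_ne_one)
    · rintro rfl
      refine le_antisymm unitInterval.le_one' ?_
      exact le_iSup₂_of_le x₀ rfl h1.ge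

theorem isFuzzyCircuit_sim [Finite A] {M : Verifier A} {n m : ℕ} {s : FuzzySet (List A)}
    (hs : IsFuzzyString s) : IsFuzzyCircuit (simCircuit M n m) (simFuzzyConst M n m s) := by
  refine ⟨simCircuit_wellFormed, simFuzzyConst_isFuzzyString hs, fun z hz => ?_⟩
  by_cases h : ∃ x, z = simConst M n m x
  · obtain ⟨x, rfl⟩ := h
    exact length_simConst x
  · refine absurd ?_ hz
    exact iSup₂_eq_bot.2 fun x hx => absurd ⟨x, hx⟩ h

end FuzzyComputation

namespace FuzzyComputation

/-! ### Counting with pointers -/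

section Count

variable {A P B R X K : Type}

/-- The number whose digits to the base `N` are the positions of the pointers `ds`. -/
def num (N : ℕ) (env : K → ℕ) : List K → ℕ
  | [] => 0
  | d :: ds => min (env d) N * N ^ ds.length + num N env ds

variable [DecidableEq K]

/-- The pointers after the digits of `j` have been stored in the pointers `ds`. -/
def setNum (N : ℕ) : (K → ℕ) → List K → ℕ → K → ℕ
  | env, [], _ => env
  | env, d :: ds, j => setNum N (Function.update env d (j / N ^ ds.length)) ds (j % N ^ ds.length)

theorem setNum_of_notMem {N : ℕ} {ds : List K} {b : K} (h : b ∉ ds) (env : K → ℕ) (j : ℕ) :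
    setNum N env ds j b = env b := by
  induction ds generalizing env j with
  | nil => rfl
  | cons d ds ih =>
    rw [List.mem_cons, not_or] at h
    rw [setNum, ih h.2, Function.update_of_ne h.1]

theorem num_setNum {N j : ℕ} {ds : List K} (hds : ds.Nodup) (env : K → ℕ) (hj : j < N ^ ds.length) :
    num N (setNum N env ds j) ds = j := by
  induction ds generalizing env j with
  | nil =>
    rw [List.length_nil, pow_zero, Nat.lt_one_iff] at hj
    exact hj.symm
  | cons d ds ih =>
    rw [List.nodup_cons] at hds
    rw [List.length_cons, pow_succ] at hj
    have hN : 0 < N ^ ds.length := Nat.pos_of_ne_zero fun h => by simp [h] at hj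
    rw [num, setNum, setNum_of_notMem hds.1, Function.update_self, ih hds.2 _ (Nat.mod_lt _ hN),
      min_eq_left (Nat.div_lt_of_lt_mul hj).le, Nat.mul_comm, Nat.div_add_mod]

/-- The program that runs `p` for all positions of the pointers `ds`. -/
def Prog.forAll : List K → Prog A P B R X K → Prog A P B R X K
  | [], p => p
  | d :: ds, p => .loop d (forAll ds p)

theorem flatMap_range_mul {α : Type} (a b : ℕ) (g : ℕ → ℕ → List α) :
    (List.range (a * b)).flatMap (fun j => g (j / b) (j % b)) =
      (List.range a).flatMap fun i => (List.range b).flatMap fun j => g i j := by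
  induction a with
  | zero => simp
  | succ a ih =>
    rw [Nat.succ_mul, show List.range (a * b + b) = List.range (a * b) ++
      (List.range b).map (a * b + ·) from List.range_add .., List.flatMap_append, ih,
      List.range_succ, List.flatMap_append, List.flatMap_map]
    congr 1
    rw [List.flatMap_singleton]
    refine List.flatMap_congr fun j hj => ?_
    rw [List.mem_range] at hj
    rw [Nat.mul_comm a b, Nat.mul_add_mod, Nat.mod_eq_of_lt hj, Nat.mul_add_div (by omega),
      Nat.div_eq_of_lt hj, Nat.add_zero]

variable {C : Ctx A P} {r : R} {ann : ℕ → X} {pos : ℕ}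

theorem Prog.Emits.forAll {p : Prog A P B R X K} {f : (K → ℕ) → List B}
    (hp : p.Emits C r ann pos f) (ds : List K) :
    (Prog.forAll ds p).Emits C r ann pos (fun env =>
      (List.range ((C.n + 2) ^ ds.length)).flatMap fun j => f (setNum (C.n + 2) env ds j)) := by
  induction ds with
  | nil => simpa [Prog.forAll, setNum] using hp
  | cons d ds ih =>
    refine ih.loop.congr (funext fun env => ?_)
    rw [List.length_cons, pow_succ', ← flatMap_range_mul]
    rfl

theorem flatMap_range_lt {α : Type} (a c N : ℕ) (t : α) :
    (List.range N).flatMap (fun i => if i < a then List.replicate c t else []) =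
      List.replicate (min a N * c) t := by
  induction N with
  | zero => simp
  | succ N ih =>
    rw [List.range_succ, List.flatMap_append, ih, List.flatMap_singleton]
    split_ifs with h
    · rw [← List.replicate_add, min_eq_right (by omega), min_eq_right (by omega), Nat.succ_mul]
    · rw [List.append_nil, min_eq_left (by omega), min_eq_left (by omega)]

theorem flatMap_range_const {α : Type} (c N : ℕ) (t : α) :
    (List.range N).flatMap (fun _ => List.replicate c t) = List.replicate (N * c) t := by
  induction N with
  | zero => simp
  | succ N ih =>
    rw [List.range_succ, List.flatMap_append, ih, List.flatMap_singleton, ← List.replicate_add,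
      Nat.succ_mul]

/-- The program that emits the symbol `t` for `u` times the number stored in the pointers `ds`. It
uses the auxiliary pointers `hs`. -/
def Prog.copies (t : B) (u : ℕ) : List K → List K → Prog A P B R X K
  | d :: ds, h :: hs => .seq
      (.loop h (.look h fun _ c =>
        if c.gt d then .forAll hs (.puts h (List.replicate u t)) else .nop))
      (copies t u ds hs)
  | _, _ => .nop

theorem Prog.emits_copies (t : B) (u : ℕ) {ds hs : List K} (hl : ds.length = hs.length)
    (hd : ∀ d ∈ ds, d ∉ hs) :
    (Prog.copies t u ds hs : Prog A P B R X K).Emits C r ann pos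
      (fun env => List.replicate (num (C.n + 2) env ds * u) t) := by
  induction ds generalizing hs with
  | nil => exact emits_nop.congr (by simp [num])
  | cons d ds ih =>
    obtain ⟨h, hs, rfl⟩ := List.exists_cons_of_length_eq_add_one hl.symm
    have hl' : ds.length = hs.length := by simpa using hl
    have hb : ∀ c : Info A P X K, (if c.gt d then Prog.forAll hs (.puts h (List.replicate u t))
        else .nop : Prog A P B R X K).Emits C r ann pos (fun _ =>
          if c.gt d then List.replicate ((C.n + 2) ^ ds.length * u) t else []) := by
      intro c
      split_ifs
      · refine ((emits_puts h _).forAll hs).congr (funext fun env => ?_)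
        rw [flatMap_range_const, hl']
      · exact emits_nop
    refine ((emits_look hb).loop.seq
      (ih hl' fun d' hd' h' => hd d' (by simp [hd']) (by simp [h']))).congr (funext fun env => ?_)
    have hne : d ≠ h := fun h' => hd d (by simp) (by simp [h'])
    simp only [Ctx.info, Function.update_self, Function.update_of_ne hne, decide_eq_true_eq]
    rw [flatMap_range_lt, ← List.replicate_add, num, Nat.add_mul, Nat.mul_assoc]

omit [DecidableEq K] in
theorem Prog.Scoped.mono {p : Prog A P B R X K} {U V : Set K} (h : p.Scoped U) (hUV : U ⊆ V) :
    p.Scoped V := by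
  induction p generalizing U V with
  | nop => trivial
  | act a F => trivial
  | seq p q hp hq => exact ⟨hp h.1 hUV, hq h.2 hUV⟩
  | look a F hF => exact fun r c => hF r c (h r c) hUV
  | loop a p hp => exact ⟨hUV h.1, hp h.2 (Set.sdiff_subset_sdiff_left hUV)⟩

omit [DecidableEq K] in
theorem Prog.Scoped.forAll {p : Prog A P B R X K} {U V : Set K} (h : p.Scoped U) (hUV : U ⊆ V)
    {ds : List K} (hds : ds.Nodup) (hV : ∀ d ∈ ds, d ∈ V) (hU : ∀ d ∈ ds, d ∉ U) :
    (Prog.forAll ds p).Scoped V := by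
  induction ds generalizing V with
  | nil => exact h.mono hUV
  | cons d ds ih =>
    rw [List.nodup_cons] at hds
    refine ⟨hV d (by simp), ih (fun b hb => ⟨hUV hb, ?_⟩) hds.2 (fun b hb => ⟨hV b (by simp [hb]), ?_⟩)
      fun b hb => hU b (by simp [hb])⟩
    · rintro rfl
      exact hU b (by simp) hb
    · rintro rfl
      exact hds.1 hb

omit [DecidableEq K] in
theorem Prog.scoped_copies (t : B) (u : ℕ) (ds : List K) {hs : List K} (hhs : hs.Nodup) {V : Set K}
    (hV : ∀ d ∈ hs, d ∈ V) : (Prog.copies t u ds hs : Prog A P B R X K).Scoped V := by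
  induction ds generalizing hs with
  | nil => trivial
  | cons d ds ih =>
    cases hs with
    | nil => trivial
    | cons h hs =>
      rw [List.nodup_cons] at hhs
      refine ⟨⟨hV h (by simp), fun r c => ?_⟩, ih hhs.2 fun d' hd' => hV d' (by simp [hd'])⟩
      beta_reduce
      split_ifs
      · refine (scoped_puts ∅ h _).forAll (Set.empty_subset _) hhs.2 (fun b hb => ⟨hV b (by simp [hb]), ?_⟩)
          (fun _ _ h => h.elim)
        rintro rfl
        exact hhs.1 hb
      · trivial

end Count

end FuzzyComputation

namespace FuzzyComputation

open Blk FuzzyMachine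

/-! ### The program that describes the circuit -/

/-- The input labels of a gate, as they appear in its description. -/
def insToks (ins : List ℕ) : List Tok := ins.flatMap fun i => List.replicate i .tick ++ [.sep]

open Classical in
/-- The part of the description of the cut of a gate that follows the input labels. -/
def Gate.cutTail (r : Deg) (G : Gate Deg) : List Tok :=
  List.replicate G.outs .port ++ (allBits G.ins.length).flatMap fun v =>
    ((allBits G.outs).filter fun w => decide (r ≤ G.tab v w)).flatMap fun w =>
      .row :: (v ++ w).map .bit

/-- The description of the cut of a gate. -/
def Gate.cutToks (r : Deg) (G : Gate Deg) : List Tok := [.gate] ++ insToks G.ins ++ G.cutTail r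

theorem encode_cut (C : Circuit Deg) (r : Deg) (z : List Bool) :
    (C.cut r).encode z = z.map .bit ++ List.replicate C.cells .cell ++
      C.levels.flatMap fun l => .level :: l.flatMap (Gate.cutToks r) := by
  rw [Circuit.encode]
  simp only [Circuit.cut, List.flatMap_map]
  congr 1
  refine List.flatMap_congr fun l _ => ?_
  congr 1
  refine List.flatMap_congr fun G _ => ?_
  simp only [Gate.encode, Gate.cutToks, Gate.cutTail, insToks, List.append_assoc]

theorem one_mem_simDegrees {A : Type} {M : Verifier A} : 1 ∈ simDegrees M := .inl rfl

/-- Gates of one kind differ only in their input labels, so that the rest of their descriptions is a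
constant word. -/
theorem cutTail_congr {r : Deg} {ins ins' : List ℕ} (h : ins.length = ins'.length) {outs : ℕ}
    {tab : List Bool → List Bool → Deg} :
    Gate.cutTail r ⟨ins, outs, tab⟩ = Gate.cutTail r ⟨ins', outs, tab⟩ := by
  simp only [Gate.cutTail, h]

section Program

variable {A : Type} [Finite A] (M : Verifier A) (k : ℕ)

/-- The pointers of the program: `k + 1` auxiliary pointers, `k + 1` digits of the number of a
block, and `k + 1` digits of the number of a level. -/
abbrev Ptr : Type := Fin 3 × Fin (k + 1)

/-- The pointers of one of the three kinds. -/
def ptrs (i : Fin 3) : List (Ptr k) := (List.finRange (k + 1)).map (i, ·)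

/-- Programs that emit descriptions of cuts; the register holds the degree of the cut. -/
abbrev TextProg : Type := Prog A Empty Tok (simDegrees M) Unit (Ptr k)

variable {k}

theorem length_ptrs (i : Fin 3) : (ptrs k i).length = k + 1 := by simp [ptrs]

theorem nodup_ptrs (i : Fin 3) : (ptrs k i).Nodup :=
  (List.nodup_finRange _).map fun _ _ h => (Prod.ext_iff.1 h).2

theorem fst_of_mem_ptrs {i : Fin 3} {d : Ptr k} (h : d ∈ ptrs k i) : d.1 = i := by
  rw [ptrs, List.mem_map] at h
  obtain ⟨_, _, rfl⟩ := h
  rfl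

theorem initGate_ins (w j : ℕ) :
    (initGate M w j).ins = labels M j ++ List.range' (w + j * 2) 2 := rfl

theorem grpGate_ins (j : ℕ) : (grpGate M j).ins =
    labels M 0 ++ labels M j ++ labels M (j + 1) ++ labels M (j + 2) := rfl

variable (k)

/-- Emits a word that does not depend on the input. -/
def word (w : List Tok) : TextProg M k := .puts (0, 0) w

/-- Emits the labels of the block whose number is stored in the block pointers, plus `c`. -/
def labelsProg (c : ℕ) : TextProg M k :=
  (List.range (width M)).foldr (fun b p => .seq
    (.seq (.copies .tick (width M) (ptrs k 1) (ptrs k 0))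
      (word M k (List.replicate (c * width M + b) .tick ++ [.sep]))) p) .nop

/-- Emits the label of the proof variable `b` of the cell whose number is stored in the
block pointers. -/
def windowProg (b : ℕ) : TextProg M k :=
  .seq (.loop (0, 0) (word M k (List.replicate (width M) .tick)))
    (.seq (.forAll (ptrs k 0) (word M k (List.replicate (width M) .tick)))
      (.seq (.copies .tick 2 (ptrs k 1) (ptrs k 0))
        (word M k (List.replicate b .tick ++ [.sep]))))

/-- Emits the constant of the circuit. -/
def constProg : TextProg M k :=
  .seq (.loop (0, 0) (.look (0, 0) fun _ c =>
      word M k ((Blk.cell c.sym c.aux : Blk M).enc.map .bit)))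
    (.forAll (ptrs k 1) (word M k ((Blk.cell .blank .blank : Blk M).enc.map .bit)))

/-- Emits the description of the first level. -/
def initProg (r : Deg) : TextProg M k :=
  .seq (word M k [.level])
    (.seq (.forAll (ptrs k 1) (.seq (word M k [.gate]) (.seq (labelsProg M k 0)
        (.seq (windowProg M k 0) (.seq (windowProg M k 1)
          (word M k ((initGate M 0 0).cutTail r)))))))
      (word M k ((dumGate M).cutToks r ++ (dumGate M).cutToks r)))

/-- Emits the description of a main level. -/
def mainProg (r : Deg) : TextProg M k :=
  .seq (word M k (.level :: (ctlGate M).cutToks r))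
    (.seq (.forAll (ptrs k 1) (.seq (word M k (.gate :: insToks (labels M 0)))
        (.seq (labelsProg M k 0) (.seq (labelsProg M k 1) (.seq (labelsProg M k 2)
          (word M k ((grpGate M 0).cutTail r)))))))
      (word M k ((dumGate M).cutToks r)))

/-- Emits the description of the `r`-cut of the circuit. -/
def circuitProg (r : Deg) : TextProg M k :=
  .seq (constProg M k) (.seq (.forAll (ptrs k 1) (word M k [.cell]))
    (.seq (initProg M k r) (.seq (.forAll (ptrs k 2) (mainProg M k r))
      (word M k (.level :: (finalGate M).cutToks r)))))

open Classical in
/-- The program that guesses the degree `r` of a cut, with degree `r`, and then emits the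
description of the `r`-cut of the circuit. -/
def describeProg : TextProg M k :=
  .seq (.act (0, 0) fun _ c e => if e = ⟨e.reg, c.ann, none, false⟩ then (e.reg : Deg) else 0)
    (.look (0, 0) fun r _ => circuitProg M k r)

variable {M k} {x : List A} {n : ℕ} {r₀ : simDegrees M} {ann : ℕ → Unit} {pos : ℕ}

local notation "Emit" => Prog.Emits (Ctx.mk x ([] : List Empty) n) r₀ ann pos

omit [Finite A] in
theorem emits_word (w : List Tok) : Emit (word M k w) (fun _ => w) := Prog.emits_puts _ w

theorem emits_labelsProg (c : ℕ) : Emit (labelsProg M k c)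
    (fun env => insToks (labels M (num (n + 2) env (ptrs k 1) + c))) := by
  have h : ∀ l : List ℕ, Emit (l.foldr (fun b p => .seq
      (.seq (.copies .tick (width M) (ptrs k 1) (ptrs k 0))
        (word M k (List.replicate (c * width M + b) .tick ++ [.sep]))) p) .nop)
      (fun env => insToks (l.map fun b => (num (n + 2) env (ptrs k 1) + c) * width M + b)) := by
    intro l
    induction l with
    | nil => exact Prog.emits_nop
    | cons b l ih =>
      refine (((Prog.emits_copies _ _ (by rw [length_ptrs, length_ptrs]) ?_).seq
        (emits_word _)).seq ih).congr (funext fun env => ?_)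
      · intro d hd hd'
        have := (fst_of_mem_ptrs hd).symm.trans (fst_of_mem_ptrs hd')
        exact absurd this (by decide)
      · have e : (num (n + 2) env (ptrs k 1) + c) * width M + b =
            num (n + 2) env (ptrs k 1) * width M + (c * width M + b) := by ring
        simp only [insToks, List.map_cons, List.flatMap_cons, e, List.replicate_add,
          List.append_assoc]
  refine (h (List.range (width M))).congr (funext fun env => ?_)
  rw [labels, List.range_eq_range', List.map_add_range', Nat.add_zero]

theorem emits_windowProg (b : ℕ) : Emit (windowProg M k b)
    (fun env => List.replicate ((n + 2 + (n + 2) ^ (k + 1)) * width M +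
      num (n + 2) env (ptrs k 1) * 2 + b) .tick ++ [.sep]) := by
  refine ((emits_word _).loop.seq (((emits_word _).forAll _).seq
    ((Prog.emits_copies _ _ (by rw [length_ptrs, length_ptrs]) ?_).seq
      (emits_word _)))).congr (funext fun env => ?_)
  · intro d hd hd'
    have := (fst_of_mem_ptrs hd).symm.trans (fst_of_mem_ptrs hd')
    exact absurd this (by decide)
  · rw [flatMap_range_const, flatMap_range_const, length_ptrs]
    simp only [← List.append_assoc, ← List.replicate_add]
    congr 2
    ring

theorem num_ptrs {i : Fin 3} {j : ℕ} (env : Ptr k → ℕ) (hj : j < (n + 2) ^ (k + 1)) :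
    num (n + 2) (setNum (n + 2) env (ptrs k i) j) (ptrs k i) = j :=
  num_setNum (nodup_ptrs i) env (by rwa [length_ptrs])

theorem emits_constProg : Emit (constProg M k)
    (fun _ => (simConst M n ((n + 2) ^ (k + 1)) x).map .bit) := by
  refine (((Prog.emits_look fun c => emits_word _).loop).seq ((emits_word _).forAll _)).congr
    (funext fun env => ?_)
  rw [simConst, List.map_append, List.map_flatMap, List.map_flatMap, length_ptrs]
  simp only [Ctx.info, Function.update_self]

theorem emits_initProg (r : Deg) : Emit (initProg M k r)
    (fun _ => .level :: (initLevel M ((n + 2 + (n + 2) ^ (k + 1)) * width M)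
      ((n + 2) ^ (k + 1))).flatMap (Gate.cutToks r)) := by
  refine ((emits_word _).seq ((Prog.Emits.forAll ((emits_word _).seq ((emits_labelsProg 0).seq
    ((emits_windowProg 0).seq ((emits_windowProg 1).seq (emits_word _))))) _).seq
      (emits_word _))).congr (funext fun env => ?_)
  rw [initLevel, List.flatMap_append, List.flatMap_map, length_ptrs]
  rw [List.singleton_append]
  congr 2
  · refine List.flatMap_congr fun j hj => ?_
    rw [num_ptrs _ (List.mem_range.1 hj)]
    have : (initGate M ((n + 2 + (n + 2) ^ (k + 1)) * width M) j).cutTail r =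
      (initGate M 0 0).cutTail r := cutTail_congr (by simp [labels])
    rw [Gate.cutToks, this, initGate_ins]
    simp [insToks, List.range'_succ]
  · simp

theorem emits_mainProg (r : Deg) : Emit (mainProg M k r)
    (fun _ => .level :: (mainLevel M ((n + 2) ^ (k + 1))).flatMap (Gate.cutToks r)) := by
  refine ((emits_word _).seq ((Prog.Emits.forAll ((emits_word _).seq ((emits_labelsProg 0).seq
    ((emits_labelsProg 1).seq ((emits_labelsProg 2).seq (emits_word _))))) _).seq
      (emits_word _))).congr (funext fun env => ?_)
  rw [mainLevel, List.flatMap_cons, List.flatMap_append, List.flatMap_map, length_ptrs,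
    List.cons_append]
  congr 3
  · refine List.flatMap_congr fun j hj => ?_
    rw [num_ptrs _ (List.mem_range.1 hj)]
    have : (grpGate M j).cutTail r = (grpGate M 0).cutTail r :=
      cutTail_congr (by simp [labels])
    rw [Gate.cutToks, this, grpGate_ins]
    simp [insToks]
  · simp

theorem emits_circuitProg (r : Deg) : Emit (circuitProg M k r)
    (fun _ => ((simCircuit M n ((n + 2) ^ (k + 1))).cut r).encode
      (simConst M n ((n + 2) ^ (k + 1)) x)) := by
  refine (emits_constProg.seq (((emits_word _).forAll _).seq ((emits_initProg r).seq
    (((emits_mainProg r).forAll _).seq (emits_word _))))).congr (funext fun env => ?_)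
  rw [encode_cut, simCircuit, List.flatMap_cons, List.flatMap_append, length_ptrs, length_ptrs,
    List.append_assoc]
  have h1 : ∀ (m : ℕ) (t : Tok), (List.range m).flatMap (fun _ => [t]) = List.replicate m t := by
    intro m t
    have := flatMap_range_const 1 m t
    rwa [Nat.mul_one] at this
  have h2 : ∀ (m : ℕ) (l : List Tok), (List.range m).flatMap (fun _ => l) =
      (List.replicate m l).flatten := by
    intro m l
    rw [List.flatMap, List.map_const', List.length_range]
  rw [h1, h2, List.flatMap_replicate]
  simp

theorem describeProg_result (w : List Tok) : (describeProg M k).result () ⟨1, one_mem_simDegrees⟩ ⟨x, [], n⟩ w =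
    ⨆ (r : simDegrees M) (_ : w = ((simCircuit M n ((n + 2) ^ (k + 1))).cut r).encode
      (simConst M n ((n + 2) ^ (k + 1)) x)), (r : Deg) := by
  classical
  rw [Prog.result, describeProg, Prog.den, Prog.den]
  simp only [Prog.den]
  have h : ∀ (κ : Store (simDegrees M) Unit Tok → Deg) (st : Store (simDegrees M) Unit Tok)
      (c : Info A Empty Unit (Ptr k)),
      ⨆ e : Eff (simDegrees M) Unit Tok,
        (if e = ⟨e.reg, c.ann, none, false⟩ then (e.reg : Deg) else 0) ⊓ κ (st.app 0 e) =
      ⨆ r : simDegrees M, (r : Deg) ⊓ κ (st.app 0 ⟨r, c.ann, none, false⟩) := by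
    intro κ st c
    apply le_antisymm
    · refine iSup_le fun e => ?_
      split_ifs with he
      · rw [he]
        exact le_iSup_of_le e.reg le_rfl
      · exact inf_le_left.trans bot_le
    · refine iSup_le fun r => le_iSup_of_le ⟨r, c.ann, none, false⟩ ?_
      rw [if_pos rfl]
  refine (h (fun st => (circuitProg M k st.reg).den ⟨x, [], n⟩ (fun _ => 0)
    (fun st => if st.out = w then 1 else 0) st) _ _).trans ?_
  refine iSup_congr fun r => ?_
  have := (emits_circuitProg (M := M) (k := k) (x := x) (n := n) (r₀ := r)
    (ann := Function.update (fun _ => ()) 0 ()) (pos := 0) r)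
    (fun _ => 0) (fun st => if st.out = w then 1 else 0) []
  refine (congrArg (fun d => (r : Deg) ⊓ d) this).trans ?_
  simp only [List.nil_append]
  by_cases hw : w = ((simCircuit M n ((n + 2) ^ (k + 1))).cut r).encode
      (simConst M n ((n + 2) ^ (k + 1)) x)
  · rw [iSup_pos hw, if_pos hw.symm]
    exact inf_top_eq _
  · rw [iSup_neg hw, if_neg (Ne.symm hw)]
    exact inf_bot_eq _

omit [Finite A] in
theorem Prog.Scoped.seq {p q : TextProg M k} {U : Set (Ptr k)} (hp : p.Scoped U)
    (hq : q.Scoped U) : (Prog.seq p q).Scoped U := ⟨hp, hq⟩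

omit [Finite A] in
theorem scoped_word (w : List Tok) (U : Set (Ptr k)) : (word M k w).Scoped U :=
  Prog.scoped_puts _ _ _

theorem scoped_labelsProg (c : ℕ) : (labelsProg M k c).Scoped {d | d.1 = 0} := by
  rw [labelsProg]
  generalize List.range (width M) = l
  induction l with
  | nil => trivial
  | cons b l ih =>
    exact ⟨⟨Prog.scoped_copies _ _ _ (nodup_ptrs 0) fun d hd => fst_of_mem_ptrs hd,
      scoped_word _ _⟩, ih⟩

theorem scoped_windowProg (b : ℕ) : (windowProg M k b).Scoped {d | d.1 = 0} := by
  refine ⟨⟨rfl, scoped_word _ _⟩, ?_, ?_, scoped_word _ _⟩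
  · exact (scoped_word _ ∅).forAll (Set.empty_subset _) (nodup_ptrs 0)
      (fun d hd => fst_of_mem_ptrs hd) (fun _ _ h => h.elim)
  · exact Prog.scoped_copies _ _ _ (nodup_ptrs 0) fun d hd => fst_of_mem_ptrs hd

omit [Finite A] in
theorem Prog.Scoped.forAll_ptrs {p : TextProg M k} {i : Fin 3} (h : p.Scoped {d | d.1 < i}) :
    (Prog.forAll (ptrs k i) p).Scoped {d | d.1 ≤ i} :=
  Prog.Scoped.forAll (V := {d : Ptr k | d.1 ≤ i}) h
    (fun d (hd : d.1 < i) => show d.1 ≤ i from hd.le) (nodup_ptrs i)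
    (fun d hd => show d.1 ≤ i from (fst_of_mem_ptrs hd).le)
    fun d hd (h : d.1 < i) => h.ne (fst_of_mem_ptrs hd)

/-- Auxiliary loops are nested in loops over blocks, and these in loops over levels. -/
theorem describeProg_scoped : (describeProg M k).Scoped Set.univ := by
  have h0 : ({d | d.1 = 0} : Set (Ptr k)) ⊆ {d | d.1 < 1} := by
    intro d hd
    change d.1 < 1
    rw [show d.1 = 0 from hd]
    decide
  have h1 : ({d | d.1 ≤ 1} : Set (Ptr k)) ⊆ {d | d.1 < 2} :=
    fun d (hd : d.1 ≤ 1) => lt_of_le_of_lt hd (show (1 : Fin 3) < 2 by decide)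
  have hl := fun c => (scoped_labelsProg (M := M) (k := k) c).mono h0
  have hw := fun b => (scoped_windowProg (M := M) (k := k) b).mono h0
  have hf : ∀ {p : TextProg M k}, p.Scoped {d | d.1 < 1} →
      (Prog.forAll (ptrs k 1) p).Scoped {d | d.1 ≤ 1} := fun h => h.forAll_ptrs
  refine ⟨trivial, fun r c => ⟨⟨⟨trivial, fun r c => scoped_word _ _⟩, ?_⟩, ?_, ⟨?_, ?_, ?_⟩, ?_, ?_⟩⟩
  · exact (hf (scoped_word _ _)).mono (Set.subset_univ _)
  · exact (hf (scoped_word _ _)).mono (Set.subset_univ _)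
  · exact scoped_word _ _
  · exact (hf ((scoped_word _ _).seq ((hl 0).seq ((hw 0).seq ((hw 1).seq (scoped_word _ _)))))).mono (Set.subset_univ _)
  · exact scoped_word _ _
  · have h2 : (mainProg M k r).Scoped {d | d.1 < 2} :=
      ⟨scoped_word _ _, (hf ((scoped_word _ _).seq ((hl 0).seq ((hl 1).seq ((hl 2).seq (scoped_word _ _)))))).mono h1,
        scoped_word _ _⟩
    exact h2.forAll_ptrs.mono (Set.subset_univ _)
  · exact scoped_word _ _

end Program

end FuzzyComputation

namespace FuzzyComputation

open FuzzyMachine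

/-! ### The reduction -/

theorem exists_le_pow (p : Polynomial ℕ) : ∃ k : ℕ, ∀ n, p.eval n ≤ (n + 2) ^ k := by
  induction p using Polynomial.induction_on' with
  | add p q hp hq =>
    obtain ⟨a, ha⟩ := hp
    obtain ⟨b, hb⟩ := hq
    refine ⟨max a b + 1, fun n => ?_⟩
    rw [Polynomial.eval_add, pow_succ]
    have h1 := (ha n).trans (Nat.pow_le_pow_right (by omega) (le_max_left a b))
    have h2 := (hb n).trans (Nat.pow_le_pow_right (by omega) (le_max_right a b))
    have : (n + 2) ^ max a b * 2 ≤ (n + 2) ^ max a b * (n + 2) := Nat.mul_le_mul_left _ (by omega)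
    omega
  | monomial m a =>
    refine ⟨a + m, fun n => ?_⟩
    rw [Polynomial.eval_monomial, pow_add]
    refine Nat.mul_le_mul ?_ (Nat.pow_le_pow_left (by omega) m)
    exact Nat.lt_two_pow_self.le.trans (Nat.pow_le_pow_left (by omega) a)

/-- The output of a pointer program on a fuzzy string. -/
theorem Prog.machine_result {A B R X K : Type} [DecidableEq K] [Finite A] [Finite X] [Finite K]
    [Finite R] (p : Prog A Empty B R X K) (hp : p.Scoped Set.univ) (x₀ : X) (r₀ : R)
    (s : FuzzySet (List A)) (w : List B) :
    DFTM.result (p.machine x₀ r₀) s w = ⨆ x, s x ⊓ p.result x₀ r₀ ⟨x, [], len s⟩ w := by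
  rw [DFTM.result, p.output_eq hp]
  refine iSup_congr fun x => ?_
  rw [iSup_unique]
  congr 1
  change s x ⊓ crisp [] [] = s x
  rw [crisp, if_pos rfl]
  exact inf_top_eq _

section Describe

variable {A : Type} [Finite A] (M : Verifier A) (k : ℕ)

instance : Finite (simDegrees M) := simDegrees_finite

/-- The machine that computes the description of the circuit that simulates `M`. -/
def describeMachine : DFTM A Tok := (describeProg M k).machine () ⟨1, one_mem_simDegrees⟩

/-- The guess of `r ∈ simDegrees M` covers all cuts of the circuit. -/
theorem describeMachine_result (s : FuzzySet (List A)) :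
    (describeMachine M k).result s = (simCircuit M (len s) ((len s + 2) ^ (k + 1))).describe
      (simFuzzyConst M (len s) ((len s + 2) ^ (k + 1)) s) := by
  funext u
  rw [describeMachine, Prog.machine_result _ describeProg_scoped,
    simCircuit_degreesIn.describe_eq simDegrees_finite]
  simp only [describeProg_result, simFuzzyConst, inf_iSup_eq]
  apply le_antisymm
  · refine iSup_le fun x => iSup₂_le fun r hr => ?_
    exact le_iSup₂_of_le r _ (le_iSup_of_le hr (le_iSup₂_of_le x rfl (inf_comm (s x) r).le))
  · refine iSup₂_le fun r z => iSup_le fun hr => iSup₂_le fun x hx => ?_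
    subst hx
    exact le_iSup_of_le x (le_iSup₂_of_le r hr (inf_comm (r : Deg) (s x)).le)

/-- The circuit has the same best and worst values of proofs as the machine. -/
theorem outcome_simCircuit {J : Deg → Deg → Deg} {Θ : Set (FuzzySet (List Bool))}
    (hJ : Admissible J Θ) {M : Verifier A} {s : FuzzySet (List A)} (hs : IsFuzzyString s) {t m : ℕ}
    (hM : ∀ φ ∈ Θ, M.HaltsIn J s φ t) (hm : 2 * t + 2 ≤ m) :
    M.outcome J Θ s = decision
      (⨆ φ ∈ Θ, (simCircuit M (len s) m).outcome J (simFuzzyConst M (len s) m s) φ [true])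
      (⨅ φ ∈ Θ, (simCircuit M (len s) m).outcome J (simFuzzyConst M (len s) m s) φ [false]) := by
  have key := fun b => hJ.proofValue_congr (a := s) (a' := simFuzzyConst M (len s) m s)
    (t := fun x y => M.value (len s) (M.init x y) [b])
    (t' := fun z y => circVal (simCircuit M (len s) m).levels
      (z ++ window (simCircuit M (len s) m).cells y) [b]) (fun φ hφ y hy => ?_)
  · rw [Verifier.outcome]
    simp only [Circuit.outcome_eq, FuzzyMachine.output_eq]
    exact congrArg₂ decision (key true).1 (key false).2
  · have : ∀ x, s x ⊓ M.value (len s) (M.init x y) [b] = s x ⊓ circVal (simCircuit M (len s) m).levels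
        (simConst M (len s) m x ++ window (simCircuit M (len s) m).cells y) [b] := by
      intro x
      by_cases hx : s x = 0
      · rw [hx]
        exact (bot_inf_eq _).trans (bot_inf_eq _).symm
      · rw [circVal_simCircuit (len_bound hs.1 hx) ((hM φ hφ).stopsIn fun h =>
          (hJ.eq_zero_iff.1 h).elim hx hy) hm]
    simp only [this, simFuzzyConst, iSup_inf_eq]
    rw [iSup_comm]
    refine iSup_congr fun x => ?_
    rw [iSup_iSup_eq_left]

end Describe

section Second

variable {A : Type}

/-- The part of a symbol that belongs to the second component of a pair. -/
def sndSym : WorkSym (A ⊕ Bool) Empty → List Bool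
  | .inp (.inr b) => [b]
  | _ => []

/-- The program that copies the second component of a pair to the output tape. -/
def sndProg (A : Type) : Prog (A ⊕ Bool) Empty Bool Unit Unit Unit :=
  .loop () (.look () fun _ c => .puts () (sndSym c.sym))

theorem sndProg_scoped : (sndProg A).Scoped Set.univ :=
  ⟨trivial, fun _ _ => Prog.scoped_puts _ _ _⟩

theorem flatMap_range_getElem? {α β : Type} (f : α → List β) (u : List α) {m : ℕ} (hm : u.length ≤ m) :
    (List.range m).flatMap (fun i => (u[i]?.map f).getD []) = u.flatMap f := by
  induction u generalizing m with
  | nil => simp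
  | cons a u ih =>
    obtain ⟨m, rfl⟩ : ∃ m', m = m' + 1 := ⟨m - 1, by simp at hm; omega⟩
    rw [List.range_succ_eq_map, List.flatMap_cons, List.flatMap_map, List.flatMap_cons,
      ← ih (m := m) (by simpa using hm)]
    rfl

open Classical in
theorem sndProg_result {u : List (A ⊕ Bool)} {n : ℕ} (hu : u.length ≤ n) (w : List Bool) :
    (sndProg A).result () () ⟨u, [], n⟩ w =
      if u.flatMap (Sum.elim (fun _ => []) ([·])) = w then 1 else 0 := by
  have h : (sndProg A).Emits ⟨u, [], n⟩ () (fun _ => ()) 0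
      (fun _ => (List.range (n + 2)).flatMap fun i : ℕ => sndSym (inputTape u (i : ℤ))) := by
    refine (Prog.emits_look fun c => Prog.emits_puts _ _).loop.congr (funext fun env => ?_)
    simp only [Ctx.info, Function.update_self]
  have h2 : (List.range (n + 2)).flatMap (fun i : ℕ => sndSym (inputTape u (i : ℤ))) =
      u.flatMap (Sum.elim (fun _ => []) ([·])) := by
    rw [List.range_succ_eq_map, List.flatMap_cons, List.flatMap_map,
      ← flatMap_range_getElem? _ u (show u.length ≤ n + 1 by omega)]
    refine List.flatMap_congr fun i _ => ?_
    rw [inputTape_succ]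
    by_cases hi : i < u.length
    · rw [dif_pos hi, List.getElem?_eq_getElem hi]
      rcases u[i] with a | b <;> rfl
    · rw [dif_neg hi, List.getElem?_eq_none (by omega)]
      split_ifs <;> rfl
  rw [h2] at h
  convert h (fun _ => 0) (fun st => if st.out = w then 1 else 0) [] using 1
  · rw [Prog.result]
    congr!
  · rfl

theorem sndProg_pair [Finite A] {s : FuzzySet (List A)} (hs : IsFuzzyString s)
    {b : FuzzySet (List Bool)} (hb : b ∈ decisions) :
    DFTM.result ((sndProg A).machine () ()) (pair s b) = b := by
  classical
  obtain ⟨hs, x₀, hx₀⟩ := hs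
  have hx₀ : s x₀ = 1 := by
    have : x₀ ∈ core s := by rw [hx₀]; rfl
    exact this
  have hb : (supp b).Finite := by
    obtain ⟨b₁, b₀, rfl⟩ := hb
    refine (Set.toFinite {[true], [false]}).subset fun w hw => ?_
    by_contra h
    simp only [Set.mem_insert_iff, Set.mem_singleton_iff, not_or] at h
    refine hw ?_
    rw [decision, if_neg h.1, if_neg h.2]
  have hp : (supp (pair s b)).Finite := by
    refine (Set.Finite.image2 (fun x y => x.map Sum.inl ++ y.map Sum.inr) hs hb).subset
      fun u hu => ?_
    by_contra h
    refine hu (iSup₂_eq_bot.2 fun x y => iSup_eq_bot.2 fun hxy => ?_)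
    by_contra h0
    refine h ⟨x, fun hx => h0 ?_, y, fun hy => h0 ?_, hxy.symm⟩
    · rw [hx]; exact bot_inf_eq _
    · rw [hy]; exact inf_bot_eq _
  funext w
  rw [Prog.machine_result _ sndProg_scoped]
  have h1 : ∀ u, pair s b u ⊓ (sndProg A).result () () ⟨u, [], len (pair s b)⟩ w =
      pair s b u ⊓ if u.flatMap (Sum.elim (fun _ => []) ([·])) = w then 1 else 0 := by
    intro u
    by_cases hu : pair s b u = 0
    · rw [hu]
      exact (bot_inf_eq _).trans (bot_inf_eq _).symm
    · rw [sndProg_result (len_bound hp hu)]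
  have h2 : ∀ (x : List A) (y : List Bool),
      (x.map Sum.inl ++ y.map Sum.inr).flatMap (Sum.elim (fun _ => []) ([·])) = y := by
    intro x y
    simp [List.flatMap_map]
  simp only [h1]
  apply le_antisymm
  · simp only [pair, iSup_inf_eq]
    refine iSup_le fun u => iSup₂_le fun x y => iSup_le fun hu => ?_
    rw [hu, h2]
    split_ifs with hw
    · rw [hw]
      exact inf_le_left.trans inf_le_right
    · exact inf_le_right.trans bot_le
  · refine le_iSup_of_le (x₀.map Sum.inl ++ w.map Sum.inr) ?_
    rw [h2, if_pos rfl]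
    refine le_min (le_iSup₂_of_le x₀ w (le_iSup_of_le rfl ?_)) unitInterval.le_one'
    rw [hx₀]
    exact le_min unitInterval.le_one' le_rfl

end Second

theorem fuzzyCircuitSAT_hard {J : Deg → Deg → Deg} {Θ : Set (FuzzySet (List Bool))}
    (hJ : Admissible J Θ) {A : Type} [Finite A] {L : FuzzyProblem A Bool}
    (hL : FuzzyNPA J Θ tolOne L) : AFReducible tolOne L (fuzzyCircuitSAT J Θ) := by
  obtain ⟨⟨hL1, hL2⟩, γ, rfl, M, p, hM⟩ := hL
  -- two levels for each step, and two more blocks than steps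
  obtain ⟨k, hk⟩ := exists_le_pow (2 * p + 2)
  have hm : ∀ n, 2 * p.eval n + 2 ≤ (n + 2) ^ (k + 1) := by
    intro n
    have h := hk n
    rw [Polynomial.eval_add, Polynomial.eval_mul] at h
    simp only [Polynomial.eval_ofNat] at h
    exact h.trans (Nat.pow_le_pow_right (by omega) (Nat.le_succ k))
  have hf : ∀ s ∈ L.dom, (describeMachine M k).result s ∈ (fuzzyCircuitSAT J Θ).dom := fun s hs =>
    ⟨_, _, isFuzzyCircuit_sim (hL1 s hs), describeMachine_result M k s⟩
  refine ⟨⟨L.dom, _, (describeMachine M k).result, hf⟩,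
    ⟨Set.image2 pair L.dom decisions, L.cod, DFTM.result ((sndProg A).machine () ()), ?_⟩,
    rfl, rfl, ⟨_, rfl, describeMachine M k, ?_⟩, rfl, rfl,
    ⟨_, rfl, (sndProg A).machine () (), ?_⟩, _, rfl, fun s hs => ?_⟩
  · rintro _ ⟨s, hs, b, hb, rfl⟩
    rw [sndProg_pair (hL1 s hs) hb, hL2]
    exact hb
  · obtain ⟨q, hq⟩ := (describeProg M k).exists_haltsIn describeProg_scoped ()
      ⟨1, one_mem_simDegrees⟩
    exact ⟨q, fun s hs => ⟨hq _ _ _, hf s hs, approximates_one_iff.2 rfl⟩⟩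
  · obtain ⟨q, hq⟩ := (sndProg A).exists_haltsIn sndProg_scoped () ()
    refine ⟨q, ?_⟩
    rintro _ ⟨s, hs, b, hb, rfl⟩
    refine ⟨hq _ _ _, ?_, approximates_one_iff.2 rfl⟩
    rw [sndProg_pair (hL1 s hs) hb, hL2]
    exact hb
  · rw [approximates_one_iff, ← approximates_one_iff.1 (hM s hs).2]
    simp only
    rw [sndProg_pair (hL1 s hs) ((fuzzyCircuitSAT J Θ).maps_to _ (hf s hs)), describeMachine_result,
      fuzzyCircuitSAT_val hJ (isFuzzyCircuit_sim (hL1 s hs)),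
      outcome_simCircuit hJ (hL1 s hs) (fun φ hφ => ((hM s hs).1 φ hφ).1) (hm _)]

end FuzzyComputation

end

open FuzzyComputation
theorem mainTheorem2 (Θ : Set (FuzzySet (List Bool))) (J : Deg → Deg → Deg)
    (hJ : (∀ a b, J a b = a ⊓ b) ∨ ((∀ a b, J a b = a * b) ∧ CrispGenerated Θ)) :
    IsCompleteNPA J Θ tolOne (fuzzyCircuitSAT J Θ) :=
  ⟨fuzzyCircuitSAT_mem hJ, fun _ _ _ h => fuzzyCircuitSAT_hard hJ h⟩
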